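/- Let $M$ be a smooth four-dimensional Lorentzian manifold with metric $g$ of signature $(+,-,-,-)$, carrying a smooth global orthonormal frame. The frame fixes the orientation with totally antisymmetric tensor $e_{abcd}$ (normalised by $e_{abcd}e^{abcd}=-24$), the time orientation, the spin structure and a spin frame. Let $\nabla$ be the Levi-Civita connection and its extension to spinors, and identify a tensor index $a$ with a pair of spinor indices $AA'$ in the usual way, so that $g_{ab}=\varepsilon_{AB}\bar\varepsilon_{A'B'}$. Let $T_{abc}$ be a smooth real tensor field on $M$ which is completely symmetric, trace-free ($T^a{}_{ab}=0$) and divergence-free ($\nabla^aT_{abc}=0$), and suppose that at every point $$T_{acd}T_b{}^{cd}T^a{}_{ef}T^{bef}\neq 0 .$$ Consider the conditions, to hold on all of $M$, $$\text{(i)}\quad T_{abj}T^{dej}=g_{(a}{}^{(d}T_{b)jk}T^{e)jk}-\tfrac14 g_{ab}T^{d}{}_{jk}T^{ejk}-\tfrac14 g^{de}T_{ajk}T_{b}{}^{jk},$$ $$\text{(ii)}\quad \nabla_aS_b=\nabla_bS_a,\qquad\text{where}\qquad S^h=\frac{e^{haef}\,T_{emn}T^{bmn}T_b{}^{cd}\,\nabla_fT_{acd}}{T_{acd}T_b{}^{cd}T^a{}_{ef}T^{bef}}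 .$$ For an open set $V\subseteq M$, say that $T$ is, up to sign, a massless spin-$\tfrac32$ superenergy tensor on $V$ if there are a sign $s\in\{1,-1\}$ and a smooth completely symmetric spinor field $\Psi_{ABC}$ on $V$ with $$s\,T_{abc}=\Psi_{ABC}\bar\Psi_{A'B'C'}\qquad\text{and}\qquad \nabla^{AA'}\Psi_{ABC}=0\qquad\text{on }V .$$ Then: 1. Every point of $M$ has an open neighbourhood $V$ on which $T$ is, up to sign, a massless spin-$\tfrac32$ superenergy tensor if and only if (i) and (ii) hold. 2. If $M$ is simply connected, then $T$ is, up to sign, a massless spin-$\tfrac32$ superenergy tensor on all of $M$ if and only if (i) and (ii) hold. -/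

import Mathlib

open scoped Manifold ContDiff

noncomputable section

namespace Rainich

/-- The signs `(+,-,-,-)` of the Lorentzian metric in an orthonormal frame. As the frame metric is
diagonal, raising or lowering a frame index `a` is multiplication by `η a`. -/
def η (a : Fin 4) : ℝ := if a = 0 then 1 else -1

/-- The frame components `g_{ab}` of the metric. -/
def gLow (a b : Fin 4) : ℝ := if a = b then η a else 0

/-- The totally antisymmetric tensor `e_{abcd}`, with `e_{0123} = 1`. -/
def eLow (a b c d : Fin 4) : ℝ :=
  Matrix.det (Matrix.of fun i j : Fin 4 => if ![a, b, c, d] i = j then (1 : ℝ) else 0)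

/-- `e^{abcd}`, all four indices raised. -/
def eUp (a b c d : Fin 4) : ℝ := η a * η b * η c * η d * eLow a b c d

/-- The Infeld-van der Waerden symbols `σ_a^{AA'}`: the identity matrix and the three Pauli-type
matrices, divided by `√2`. They satisfy `g_{ab} = ε_{AB} ε_{A'B'} σ_a^{AA'} σ_b^{BB'}`, where
`ε_{01} = 1 = -ε_{10}`. -/
def σUp (a : Fin 4) : Matrix (Fin 2) (Fin 2) ℂ :=
  ((1 / Real.sqrt 2 : ℝ) : ℂ) •
    (![!![1, 0; 0, 1], !![0, 1; 1, 0], !![0, Complex.I; -Complex.I, 0], !![1, 0; 0, -1]] a)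

/-- The symbols `σ^a_{AA'} = g^{ab} ε_{BA} ε_{B'A'} σ_b^{BB'}`, which are inverse to `σ_a^{AA'}`:
`σ^a_{AA'} σ_b^{AA'} = δ^a_b`. -/
def σLow (a : Fin 4) (A A' : Fin 2) : ℂ := star (σUp a A A')

/-- Values of covariant rank three tensors in a frame, `T_{abc}`. -/
abbrev Tensor3 : Type := Fin 4 → Fin 4 → Fin 4 → ℝ

/-- Values of valence three unprimed spinors in a spin frame, `Ψ_{ABC}`. -/
abbrev Spinor3 : Type := Fin 2 → Fin 2 → Fin 2 → ℂ

/-- Complete symmetry of a three-index array (transpositions of neighbours suffice). -/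
def IsSymm3 {ι R : Type*} (T : ι → ι → ι → R) : Prop :=
  ∀ a b c, T a b c = T b a c ∧ T a b c = T a c b

/-- The trace `T^a_{ab}` vanishes. -/
def IsTraceFree (T : Tensor3) : Prop := ∀ b, ∑ a, η a * T a a b = 0

/-- The superenergy tensor `Ψ_{ABC} Ψbar_{A'B'C'}` of a spinor, as a tensor: its component `abc` is
`σ_a^{AA'} σ_b^{BB'} σ_c^{CC'} Ψ_{ABC} Ψbar_{A'B'C'}`. -/
def superenergy (Ψ : Spinor3) (a b c : Fin 4) : ℂ :=
  ∑ A, ∑ B, ∑ C, ∑ A', ∑ B', ∑ C',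
    σUp a A A' * σUp b B B' * σUp c C C' * (Ψ A B C * star (Ψ A' B' C'))

/-- `T_{ajk} T_b^{jk}`. -/
def contr2 (T : Tensor3) (a b : Fin 4) : ℝ := ∑ j, ∑ k, η j * η k * (T a j k * T b j k)

/-- `T_{acd} T_b^{cd} T^a_{ef} T^{bef}`. -/
def quartic (T : Tensor3) : ℝ := ∑ a, ∑ b, η a * η b * (contr2 T a b * contr2 T a b)

/-- The quadratic identity
`T_{abj} T_{de}^j = g_{(a|(d} T_{b)jk} T_{e)}^{jk} - (1/4) g_{ab} T_{djk} T_e^{jk}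
  - (1/4) g_{de} T_{ajk} T_b^{jk}`,
where the round brackets symmetrize over `a, b` and over `d, e`. -/
def QuadraticIdentity (T : Tensor3) : Prop :=
  ∀ a b d e, ∑ j, η j * (T a b j * T d e j) =
    (1 / 4) * (gLow a d * contr2 T b e + gLow a e * contr2 T b d
      + gLow b d * contr2 T a e + gLow b e * contr2 T a d)
    - (1 / 4) * gLow a b * contr2 T d e - (1 / 4) * gLow d e * contr2 T a b

section Manifold

variable {M : Type*} [TopologicalSpace M] [ChartedSpace (EuclideanSpace ℝ (Fin 4)) M]
  [IsManifold (𝓡 4) ∞ M]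

variable (M) in
/-- A smooth global frame `E_0, …, E_3` of the tangent bundle of a four-manifold. It is declared
orthonormal, and so carries a Lorentzian metric, an orientation, a time orientation and
a spin structure (every spinor field is given by its components in the associated spin frame). -/
structure SpinFrame where
  /-- The frame at each point. -/
  E : ∀ x : M, Module.Basis (Fin 4) ℝ (TangentSpace (𝓡 4) x)
  /-- Each frame vector field is smooth. -/
  smooth : ∀ a, ContMDiff (𝓡 4) (𝓡 4).tangent ∞
    (fun x => (⟨x, E x a⟩ : TangentBundle (𝓡 4) M))

namespace SpinFrame

variable (𝓔 : SpinFrame M)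

/-- The Lorentzian metric for which the frame is orthonormal. -/
def metric (x : M) (v w : TangentSpace (𝓡 4) x) : ℝ :=
  ∑ a, η a * ((𝓔.E x).repr v a * (𝓔.E x).repr w a)

/-- The derivative `E_a(f)` of a function along a frame vector. -/
def D {F : Type*} [NormedAddCommGroup F] [NormedSpace ℝ F] (a : Fin 4) (f : M → F) (x : M) : F :=
  mfderiv (𝓡 4) 𝓘(ℝ, F) f x (𝓔.E x a)

/-- The Lie bracket `[E_a, E_b]` of two frame fields. -/
def bracket (a b : Fin 4) (x : M) : TangentSpace (𝓡 4) x :=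
  VectorField.mlieBracket (𝓡 4) (fun y => 𝓔.E y a) (fun y => 𝓔.E y b) x

/-- The coefficients `Γ_{abc} = g(∇_{E_a} E_b, E_c)` of the Levi-Civita connection, by the Koszul
formula in the orthonormal frame. -/
def ΓLow (a b c : Fin 4) (x : M) : ℝ :=
  (1 / 2) * (𝓔.metric x (𝓔.bracket a b x) (𝓔.E x c) - 𝓔.metric x (𝓔.bracket b c x) (𝓔.E x a)
    + 𝓔.metric x (𝓔.bracket c a x) (𝓔.E x b))

theorem bracket_swap (a b : Fin 4) (x : M) : 𝓔.bracket a b x = -𝓔.bracket b a x :=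
  VectorField.mlieBracket_swap_apply

theorem metric_neg (x : M) (v w : TangentSpace (𝓡 4) x) :
    𝓔.metric x (-v) w = -𝓔.metric x v w := by
  simp [metric]

theorem metric_frame (x : M) (a b : Fin 4) : 𝓔.metric x (𝓔.E x a) (𝓔.E x b) = gLow a b := by
  by_cases h : a = b <;> simp [metric, gLow, Finsupp.single_apply, h]

/-- The connection is metric. -/
theorem ΓLow_antisymm (a b c : Fin 4) (x : M) : 𝓔.ΓLow a b c x = -𝓔.ΓLow a c b x := by
  unfold ΓLow
  rw [𝓔.bracket_swap a c, 𝓔.bracket_swap c b, 𝓔.bracket_swap b a]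
  simp only [metric_neg]; ring

/-- The connection is torsion-free: `∇_{E_a} E_b - ∇_{E_b} E_a = [E_a, E_b]`. -/
theorem ΓLow_torsion_free (a b c : Fin 4) (x : M) :
    𝓔.ΓLow a b c x - 𝓔.ΓLow b a c x = 𝓔.metric x (𝓔.bracket a b x) (𝓔.E x c) := by
  unfold ΓLow
  rw [𝓔.bracket_swap a c, 𝓔.bracket_swap c b, 𝓔.bracket_swap b a]
  simp only [metric_neg]; ring

/-- The coefficients in `∇_{E_a} E_b = ∑ c, (Γ 𝓔 a c b) E_c`. -/
def Γ (a c b : Fin 4) (x : M) : ℝ := η c * 𝓔.ΓLow a b c x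

/-- The coefficients `γ_a^B_C = (1/2) Γ_a^{BB'}_{CB'}` of the spinor connection, that is, of the
unique connection on spinors for which `ε_{AB}` and `σ_a^{AA'}` are parallel. -/
def spinΓ (a : Fin 4) (B C : Fin 2) (x : M) : ℂ :=
  (1 / 2) * ∑ B', ∑ c, ∑ d, σUp c B B' * (𝓔.Γ a c d x : ℂ) * σLow d C B'

/-- `∇_a S_b` for a covector field. -/
def nabla1 (S : M → Fin 4 → ℝ) (a b : Fin 4) (x : M) : ℝ :=
  𝓔.D a (fun y => S y b) x - ∑ d, 𝓔.Γ a d b x * S x d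

/-- `∇_f T_{abc}` for a covariant rank three tensor field. -/
def nabla3 (T : M → Tensor3) (f a b c : Fin 4) (x : M) : ℝ :=
  𝓔.D f (fun y => T y a b c) x - ∑ d, 𝓔.Γ f d a x * T x d b c
    - ∑ d, 𝓔.Γ f d b x * T x a d c - ∑ d, 𝓔.Γ f d c x * T x a b d

/-- `∇_f Ψ_{ABC}` for a spinor field. -/
def nablaSpinor (Ψ : M → Spinor3) (f : Fin 4) (A B C : Fin 2) (x : M) : ℂ :=
  𝓔.D f (fun y => Ψ y A B C) x - ∑ D', 𝓔.spinΓ f D' A x * Ψ x D' B C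
    - ∑ D', 𝓔.spinΓ f D' B x * Ψ x A D' C - ∑ D', 𝓔.spinΓ f D' C x * Ψ x A B D'

/-- `∇^a T_{abc} = 0` on the whole manifold. -/
def IsDivergenceFree (T : M → Tensor3) : Prop :=
  ∀ x b c, ∑ a, η a * 𝓔.nabla3 T a a b c x = 0

/-- The massless spin-3/2 equation `∇^{AA'} Ψ_{ABC} = 0` at a point, where
`∇^{AA'} = g^{fh} σ_h^{AA'} ∇_f`. -/
def MasslessAt (Ψ : M → Spinor3) (x : M) : Prop :=
  ∀ A' B C, ∑ A, ∑ f, (η f : ℂ) * σUp f A A' * 𝓔.nablaSpinor Ψ f A B C x = 0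

/-- The vector
`S^h = e^{haef} T_{emn} T^{bmn} T_b^{cd} ∇_f T_{acd} / (T_{acd} T_b^{cd} T^a_{ef} T^{bef})`. -/
def SUp (T : M → Tensor3) (x : M) (h : Fin 4) : ℝ :=
  (∑ a, ∑ e, ∑ f, ∑ b, ∑ c, ∑ d, eUp h a e f * (η b * contr2 (T x) e b)
    * (η c * η d * T x b c d) * 𝓔.nabla3 T f a c d x) / quartic (T x)

/-- The covector `S_h`. -/
def SLow (T : M → Tensor3) (x : M) (h : Fin 4) : ℝ := η h * 𝓔.SUp T x h

/-- `∇_a S_b = ∇_b S_a` on the whole manifold. -/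
def SClosed (T : M → Tensor3) : Prop :=
  ∀ x a b, 𝓔.nabla1 (𝓔.SLow T) a b x = 𝓔.nabla1 (𝓔.SLow T) b a x

/-- On the open set `V`, either `T` or `-T` is the superenergy tensor of a smooth massless
spin-3/2 field (one choice of sign on all of `V`). -/
def IsMasslessSuperenergyOn (T : M → Tensor3) (V : Set M) : Prop :=
  ∃ s : ℝ, (s = 1 ∨ s = -1) ∧ ∃ Ψ : M → Spinor3,
    ContMDiffOn (𝓡 4) 𝓘(ℝ, Spinor3) ∞ Ψ V ∧
    ∀ x ∈ V, IsSymm3 (Ψ x) ∧ (∀ a b c, ((s * T x a b c : ℝ) : ℂ) = superenergy (Ψ x) a b c) ∧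
      𝓔.MasslessAt Ψ x

end SpinFrame

end Manifold

end Rainich

end

/-! In null components a rank three tensor is a matrix with rows ABC and columns A'B'C'. Symmetry
and vanishing trace make it symmetric within each triple, and reality makes it Hermitian. Condition
(i) forces all two by two minors to vanish (`minor_eq_of_lt`), and every product of two symmetric
spinors satisfies it (`quadratic_bil`). A nonzero Hermitian matrix of rank one is, up to sign, ΨΨ̄
with Ψ unique up to a phase. So (i) is exactly the pointwise existence of Ψ, and dividing a column
by the root of a diagonal entry makes Ψ smooth locally.

The phase remains. The binary cubic Ψ has the Hessian H, the discriminant Δ = H_{AB}H^{AB} and the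
cubic covariant Q, and contracting Q with Ψ gives (Δ/2)ε (`pol_cubic_self`). The quartic scalar of T
is |Δ|², so Δ never vanishes. By `numerator_eq` the numerator of S is a term linear in the
divergences of Ψ and Ψ̄ plus a multiple of Im(Δ̄ dΔ). When T is divergence-free these two
divergences determine each other, and the first term vanishes only if they do. Hence Ψ is massless
exactly when S is a quarter of the gradient of arg Δ (`masslessAt_iff`). A phase exp(iμ) preserves T
and adds dμ to that quarter, so a correct phase exists locally if and only if S is closed.

For the global statement, the sign is that of T_{000}, which has no zero. Two local solutions differ
by a phase, and since both obey the same equation with the same S this phase is locally constant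
(`eventually_ratio_eq`). The phases form a locally constant circle-valued cocycle, that is, a
covering space. Over a simply connected manifold it has a section
(`exists_trivialization_of_cocycle`), which corrects the local solutions so that they glue. -/

noncomputable section

namespace Rainich

/-! ### Null components and contractions -/

/-- The null components of a vector with complex frame components. -/
def low (v : Fin 4 → ℂ) (A A' : Fin 2) : ℂ := ∑ a, σLow a A A' * v a

/-- The frame components of a vector with given null components. -/
def up (F : Fin 2 → Fin 2 → ℂ) (a : Fin 4) : ℂ := ∑ A, ∑ A', σUp a A A' * F A A'

/-- The complete contraction `ε^{AB} ε^{A'B'} F_{AA'} G_{BB'}`. -/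
def pol (F G : Fin 2 → Fin 2 → ℂ) : ℂ :=
  F 0 0 * G 1 1 + F 1 1 * G 0 0 - F 0 1 * G 1 0 - F 1 0 * G 0 1

theorem inv_sqrt_two_sq : (((Real.sqrt 2 : ℝ) : ℂ)⁻¹) ^ 2 = 1 / 2 := by
  rw [inv_pow, ← Complex.ofReal_pow, Real.sq_sqrt (by norm_num)]
  norm_num

theorem inv_sqrt_two_cube : (((Real.sqrt 2 : ℝ) : ℂ)⁻¹) ^ 3 = ((Real.sqrt 2 : ℝ) : ℂ)⁻¹ / 2 := by
  rw [pow_succ, inv_sqrt_two_sq]; ring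

theorem low_up (F : Fin 2 → Fin 2 → ℂ) : low (up F) = F := by
  ext A A'
  fin_cases A <;> fin_cases A' <;>
  simp [low, up, σLow, σUp, Fin.sum_univ_four] <;> ring_nf <;>
  simp only [inv_sqrt_two_sq, Complex.I_sq] <;> ring

theorem up_low (v : Fin 4 → ℂ) : up (low v) = v := by
  ext a
  fin_cases a <;>
  simp [low, up, σLow, σUp, Fin.sum_univ_four] <;> ring_nf <;>
  simp only [inv_sqrt_two_sq, Complex.I_sq] <;> ring

theorem sum_eta_mul (v w : Fin 4 → ℂ) :
    ∑ a, (η a : ℂ) * (v a * w a) = pol (low v) (low w) := by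
  simp [low, pol, σLow, σUp, Fin.sum_univ_four, η]
  ring_nf
  simp only [inv_sqrt_two_sq, Complex.I_sq]
  ring

theorem sum_eta_up_mul_up (F G : Fin 2 → Fin 2 → ℂ) :
    ∑ a, (η a : ℂ) * (up F a * up G a) = pol F G := by
  rw [sum_eta_mul, low_up, low_up]

/-- The matrices `σUp a` are Hermitian, so conjugation exchanges the primed and the unprimed index.
-/
theorem star_low (v : Fin 4 → ℂ) (A A' : Fin 2) :
    star (low v A A') = low (fun a => star (v a)) A' A := by
  fin_cases A <;> fin_cases A' <;>
  simp [low, σLow, σUp, Fin.sum_univ_four]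

/-- The contraction of two further index pairs in null components. -/
theorem sum_eta_eta_up_up (F G : Fin 2 → Fin 2 → Fin 2 → Fin 2 → ℂ) :
    ∑ j, ∑ k, (η j : ℂ) * η k *
      (up (fun C C' => up (F C C') j) k * up (fun C C' => up (G C C') j) k) =
      pol (F 0 0) (G 1 1) + pol (F 1 1) (G 0 0) - pol (F 0 1) (G 1 0) - pol (F 1 0) (G 0 1) := by
  have : ∀ j, ∑ k, (η j : ℂ) * η k *
      (up (fun C C' => up (F C C') j) k * up (fun C C' => up (G C C') j) k) =
      η j * (up (F 0 0) j * up (G 1 1) j) + η j * (up (F 1 1) j * up (G 0 0) j)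
      - η j * (up (F 0 1) j * up (G 1 0) j) - η j * (up (F 1 0) j * up (G 0 1) j) := by
    intro j
    simp only [mul_assoc]
    rw [← Finset.mul_sum, sum_eta_up_mul_up, pol]
    ring
  simp only [this, Finset.sum_add_distrib, Finset.sum_sub_distrib, sum_eta_up_mul_up]

/-! ### Products of two independent spinors, with χ in place of the conjugate of Ψ -/

/-- The tensor with null components `Φ_{ABC} χ_{A'B'C'}`. -/
def bil (Φ χ : Spinor3) (a b c : Fin 4) : ℂ :=
  ∑ A, ∑ B, ∑ C, ∑ A', ∑ B', ∑ C',
    σUp a A A' * σUp b B B' * σUp c C C' * (Φ A B C * χ A' B' C')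

/-- The componentwise conjugate spinor. -/
def conjSpinor (Ψ : Spinor3) : Spinor3 := fun A B C => star (Ψ A B C)

theorem bil_eq_up (Φ χ : Spinor3) (a j k : Fin 4) :
    bil Φ χ a j k = up (fun C C' => up (fun B B' => ∑ A, ∑ A',
      σUp a A A' * (Φ A B C * χ A' B' C')) j) k := by
  simp only [bil, up, Fin.sum_univ_two]; ring

/-- Contracting two tensor index pairs contracts two unprimed and two primed pairs separately, so
the result factors. -/
theorem sum_bil_mul_bil (Φ χ Φ₂ χ₂ : Spinor3) (a b : Fin 4) :
    ∑ j, ∑ k, (η j : ℂ) * η k * (bil Φ χ a j k * bil Φ₂ χ₂ b j k) =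
      ∑ A, ∑ A', ∑ B, ∑ B', σUp a A A' * σUp b B B' *
        (pol (Φ A) (Φ₂ B) * pol (χ A') (χ₂ B')) := by
  simp only [bil_eq_up, sum_eta_eta_up_up]
  simp only [pol, Fin.sum_univ_two]
  ring

/-! ### Covariants of a binary cubic -/

/-- The Hessian covariant `H_{AB} = Ψ_{ACD} Ψ_B^{CD}`. -/
def hess (Ψ : Spinor3) (A B : Fin 2) : ℂ := pol (Ψ A) (Ψ B)

/-- The discriminant `H_{AB} H^{AB}`. -/
def disc (Ψ : Spinor3) : ℂ := pol (hess Ψ) (hess Ψ)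

/-- The derivative of the Hessian. -/
def dHess (Ψ N : Spinor3) (A B : Fin 2) : ℂ := pol (N A) (Ψ B) + pol (Ψ A) (N B)

/-- The derivative of the discriminant at `Ψ` in the direction `N`. -/
def dDisc (Ψ N : Spinor3) : ℂ := 2 * pol (hess Ψ) (dHess Ψ N)

/-- The cubic covariant `Q_{ACD} = H_A^B Ψ_{BCD}`. -/
def cubic (Ψ : Spinor3) : Spinor3 := fun A C D => hess Ψ A 0 * Ψ 1 C D - hess Ψ A 1 * Ψ 0 C D

/-- The alternating spinor `ε_{AB}`. -/
def eps (A B : Fin 2) : ℂ := if A = B then 0 else if A = 0 then 1 else -1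

theorem hess_symm (Ψ : Spinor3) (A B : Fin 2) : hess Ψ A B = hess Ψ B A := by
  simp only [hess, pol]; ring

/-- Since H is symmetric, the endomorphism H_A^B is trace-free, and by Cayley-Hamilton its square is
a scalar. -/
theorem hess_mul_hess (Ψ : Spinor3) (A B : Fin 2) :
    hess Ψ A 0 * hess Ψ 1 B - hess Ψ A 1 * hess Ψ 0 B = disc Ψ / 2 * eps A B := by
  have := hess_symm Ψ 1 0
  fin_cases A <;> fin_cases B <;> simp [disc, eps, pol, this] <;> ring

/-! ### The volume form in null components -/

/-- The product of differences is antisymmetric and equals 12 at (0, 1, 2, 3). It replaces the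
determinant by a polynomial in the indices that `simp` can evaluate. -/
theorem eInt_eq : ∀ a b c d : Fin 4,
    12 * Matrix.det (Matrix.of fun i j : Fin 4 => if ![a, b, c, d] i = j then (1 : ℤ) else 0) =
      ((b : ℤ) - a) * (c - a) * (d - a) * (c - b) * (d - b) * (d - c) := by
  decide +kernel

theorem eLow_eq (a b c d : Fin 4) :
    eLow a b c d =
      ((((b : ℤ) - a) * (c - a) * (d - a) * (c - b) * (d - b) * (d - c) : ℤ) : ℝ) / 12 := by
  rw [← eInt_eq, eLow, Int.cast_mul, Int.cast_det]
  have : ∀ x : ℝ, x = ((12 : ℤ) : ℝ) * x / 12 := fun x => by push_cast; ring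
  rw [← this]
  congr 1
  ext i j
  simp [Matrix.map_apply]

/-- Contraction of the volume form with a tensor `ε_{E'A'} P_{EAFF'}`. -/
theorem sum_eUp (P : Fin 2 → Fin 2 → Fin 2 → Fin 2 → ℂ) (h : Fin 4) :
    (η h : ℂ) * ∑ a, ∑ e, ∑ f, (eUp h a e f : ℂ) *
      ((∑ E, ∑ A, (σUp e E 0 * σUp a A 1 - σUp e E 1 * σUp a A 0) * up (P E A) f)) =
    up (fun H H' => -Complex.I *
      ((P H 0 1 H' + P 0 H 1 H') - (P H 1 0 H' + P 1 H 0 H'))) h := by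
  -- Only the part of P symmetric in E and A survives antisymmetrization in e and a. Times ε_{E'A'}
  -- it is an eigenvector of Hodge duality, with a factor -i here and +i for the conjugate type in
  -- `sum_eUp'`.
  fin_cases h <;>
  simp [eUp, eLow_eq, Fin.sum_univ_four, η, up, σUp] <;> ring_nf <;>
  try simp only [inv_sqrt_two_cube, Complex.I_sq] <;> ring_nf

/-- Contraction of the volume form with a tensor `ε_{EA} P_{E'A'FF'}`. -/
theorem sum_eUp' (P : Fin 2 → Fin 2 → Fin 2 → Fin 2 → ℂ) (h : Fin 4) :
    (η h : ℂ) * ∑ a, ∑ e, ∑ f, (eUp h a e f : ℂ) *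
      ((∑ E, ∑ A, (σUp e 0 E * σUp a 1 A - σUp e 1 E * σUp a 0 A) * up (P E A) f)) =
    up (fun H H' => Complex.I *
      ((P H' 0 H 1 + P 0 H' H 1) - (P H' 1 H 0 + P 1 H' H 0))) h := by
  fin_cases h <;>
  simp [eUp, eLow_eq, Fin.sum_univ_four, η, up, σUp] <;> ring_nf <;>
  try simp only [inv_sqrt_two_cube, Complex.I_sq] <;> ring_nf

/-! ### The numerator of S and the massless equation -/

theorem disc_eq (Ψ : Spinor3) :
    disc Ψ = 2 * (hess Ψ 0 0 * hess Ψ 1 1 - hess Ψ 0 1 * hess Ψ 0 1) := by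
  rw [disc, pol, hess_symm Ψ 1 0]; ring

/-- The null components of a covector-valued spinor. -/
def lowSpinor (n : Fin 4 → Spinor3) (F F' : Fin 2) : Spinor3 :=
  fun A B C => low (fun f => n f A B C) F F'

/-- The divergence `∇^A_{F'} Ψ_{ABC}` computed from the null components of the derivative. -/
def divSpinor (N : Fin 2 → Fin 2 → Spinor3) (F' C D : Fin 2) : ℂ :=
  N 0 F' 1 C D - N 1 F' 0 C D

/-- In the term with n the primed factor is the square of the Hessian of χ, which is (disc χ / 2) ε,
while the unprimed factor is `cubic Ψ` contracted with n; the term with m is the mirror image. The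
tensor thus splits into the two types of `sum_eUp` and `sum_eUp'`. -/
theorem sum_contr_mul (Ψ χ : Spinor3) (n m : Spinor3) (e a : Fin 4) :
    ∑ b, (η b : ℂ) * ((∑ j, ∑ k, (η j : ℂ) * η k * (bil Ψ χ e j k * bil Ψ χ b j k)) *
      ∑ c, ∑ d, (η c : ℂ) * η d * (bil Ψ χ b c d * (bil n χ a c d + bil Ψ m a c d))) =
    disc χ / 2 * (∑ E, ∑ A, (σUp e E 0 * σUp a A 1 - σUp e E 1 * σUp a A 0) *
        pol (cubic Ψ E) (n A)) +
    disc Ψ / 2 * (∑ E, ∑ A, (σUp e 0 E * σUp a 1 A - σUp e 1 E * σUp a 0 A) *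
        pol (cubic χ E) (m A)) := by
  have h1 : ∀ b, ∑ j, ∑ k, (η j : ℂ) * η k * (bil Ψ χ e j k * bil Ψ χ b j k) =
      up (fun B B' => ∑ E, ∑ E', σUp e E E' * (hess Ψ E B * hess χ E' B')) b := by
    intro b
    rw [sum_bil_mul_bil]
    simp only [up, Fin.sum_univ_two, hess]; ring
  have h2 : ∀ b, ∑ c, ∑ d, (η c : ℂ) * η d *
      (bil Ψ χ b c d * (bil n χ a c d + bil Ψ m a c d)) =
      up (fun B B' => ∑ A, ∑ A', σUp a A A' *
        (pol (Ψ B) (n A) * hess χ B' A' + hess Ψ B A * pol (χ B') (m A'))) b := by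
    intro b
    simp only [mul_add, Finset.sum_add_distrib]
    rw [sum_bil_mul_bil, sum_bil_mul_bil]
    simp only [up, Fin.sum_univ_two, hess]; ring
  have h3 : ∀ (Ψ n : Spinor3) E A, pol (cubic Ψ E) (n A) =
      hess Ψ E 0 * pol (Ψ 1) (n A) - hess Ψ E 1 * pol (Ψ 0) (n A) := by
    intro Ψ n E A
    simp only [pol, cubic]; ring
  simp only [h1, h2, h3, sum_eta_up_mul_up]
  -- These contractions enter only as numbers. Making them opaque keeps `ring` from expanding them
  -- into components.
  have h4 : ∀ (Ψ n : Spinor3), ∃ g : Fin 2 → Fin 2 → ℂ, ∀ B A, pol (Ψ B) (n A) = g B A :=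
    fun Ψ n => ⟨_, fun _ _ => rfl⟩
  obtain ⟨g, hg⟩ := h4 Ψ n
  obtain ⟨g', hg'⟩ := h4 χ m
  simp only [hg, hg']
  simp only [disc_eq, pol, Fin.sum_univ_two, hess_symm _ 1 0]
  ring

/-- The derivative of a spinor along a null tetrad, contracted with the cubic covariant. -/
theorem contr_cubic (Ψ : Spinor3) (hΨ : IsSymm3 Ψ) (N : Fin 2 → Fin 2 → Spinor3)
    (hN : ∀ F F', IsSymm3 (N F F')) (H H' : Fin 2) :
    (pol (cubic Ψ H) (N 1 H' 0) + pol (cubic Ψ 0) (N 1 H' H)) -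
      (pol (cubic Ψ H) (N 0 H' 1) + pol (cubic Ψ 1) (N 0 H' H)) =
      -2 * pol (cubic Ψ H) (divSpinor N H') + dDisc Ψ (N H H') / 4 := by
  -- Up to a constant `cubic Ψ` is the gradient of the discriminant, so its full contraction with
  -- N_{HH'} is `dDisc` / 4. Exchanging H with the index of the derivative costs one divergence
  -- term, and the first pair of terms is already another one.
  have e1 := (hΨ 1 0 0).1
  have e2 := (hΨ 0 1 0).2
  have e3 := (hΨ 1 0 1).1
  have e4 := (hΨ 1 1 0).2
  have f1 := fun F F' => (hN F F' 1 0 0).1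
  have f2 := fun F F' => (hN F F' 0 1 0).2
  have f3 := fun F F' => (hN F F' 1 0 1).1
  have f4 := fun F F' => (hN F F' 1 1 0).2
  fin_cases H <;>
  simp only [dDisc, dHess, divSpinor, cubic, pol, hess, Fin.zero_eta, Fin.mk_one,
    e1, e2, e3, e4, f1, f2, f3, f4] <;> ring

theorem isSymm3_lowSpinor (n : Fin 4 → Spinor3) (hn : ∀ f, IsSymm3 (n f)) (F F' : Fin 2) :
    IsSymm3 (lowSpinor n F F') := by
  intro a b c
  simp only [lowSpinor]
  exact ⟨by simp only [fun f => (hn f a b c).1], by simp only [fun f => (hn f a b c).2]⟩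

theorem pol_lowSpinor (c : Fin 2 → Fin 2 → ℂ) (n : Fin 4 → Spinor3) (A : Fin 2) (f : Fin 4) :
    pol c (n f A) = up (fun F F' => pol c (lowSpinor n F F' A)) f := by
  refine (congrFun (up_low (fun f => pol c (n f A))) f).symm.trans (congrArg (up · f) ?_)
  ext F F'
  simp only [low, lowSpinor, pol, Fin.sum_univ_four]; ring

theorem dDisc_lowSpinor (Ψ : Spinor3) (n : Fin 4 → Spinor3) (f : Fin 4) :
    dDisc Ψ (n f) = up (fun F F' => dDisc Ψ (lowSpinor n F F')) f := by
  refine (congrFun (up_low (fun f => dDisc Ψ (n f))) f).symm.trans (congrArg (up · f) ?_)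
  ext F F'
  simp only [low, lowSpinor, dDisc, dHess, pol, Fin.sum_univ_four]; ring

/-- The numerator of the vector `S`. -/
theorem numerator_eq (Ψ χ : Spinor3) (hΨ : IsSymm3 Ψ) (hχ : IsSymm3 χ) (n m : Fin 4 → Spinor3)
    (hn : ∀ f, IsSymm3 (n f)) (hm : ∀ f, IsSymm3 (m f)) (h : Fin 4) :
    (η h : ℂ) * ∑ a, ∑ e, ∑ f, (eUp h a e f : ℂ) *
      (∑ b, (η b : ℂ) * ((∑ j, ∑ k, (η j : ℂ) * η k * (bil Ψ χ e j k * bil Ψ χ b j k)) *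
        ∑ c, ∑ d, (η c : ℂ) * η d * (bil Ψ χ b c d * (bil (n f) χ a c d + bil Ψ (m f) a c d)))) =
    up (fun H H' => Complex.I * (disc χ * pol (cubic Ψ H) (divSpinor (lowSpinor n) H') -
      disc Ψ * pol (cubic χ H') (divSpinor (fun F F' => lowSpinor m F' F) H))) h
      - Complex.I / 8 * (disc χ * dDisc Ψ (n h) - disc Ψ * dDisc χ (m h)) := by
  have e1 := sum_eUp (fun E A F F' => pol (cubic Ψ E) (lowSpinor n F F' A)) h
  have e2 := sum_eUp' (fun E A F F' => pol (cubic χ E) (lowSpinor m F F' A)) h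
  simp only [← pol_lowSpinor] at e1 e2
  -- The primed half is the same identity, with the two indices of the derivative exchanged.
  have c2 := fun H H' => contr_cubic χ hχ (fun F F' => lowSpinor m F' F)
    (fun F F' => isSymm3_lowSpinor m hm F' F) H' H
  simp only [contr_cubic Ψ hΨ _ (isSymm3_lowSpinor n hn)] at e1
  simp only [c2] at e2
  simp only [sum_contr_mul]
  simp only [mul_add, Finset.sum_add_distrib]
  simp only [mul_left_comm _ (disc _ / 2), ← Finset.mul_sum, e1, e2, dDisc_lowSpinor]
  simp only [up, Fin.sum_univ_two]
  ring

/-- The numerator of the covector `S`, for a derivative given by its spinor parts. -/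
def numer (Ψ χ : Spinor3) (n m : Fin 4 → Spinor3) (h : Fin 4) : ℂ :=
  (η h : ℂ) * ∑ a, ∑ e, ∑ f, (eUp h a e f : ℂ) *
      (∑ b, (η b : ℂ) * ((∑ j, ∑ k, (η j : ℂ) * η k * (bil Ψ χ e j k * bil Ψ χ b j k)) *
        ∑ c, ∑ d, (η c : ℂ) * η d * (bil Ψ χ b c d * (bil (n f) χ a c d + bil Ψ (m f) a c d))))

theorem up_eq_zero {F : Fin 2 → Fin 2 → ℂ} (h : ∀ a, up F a = 0) (A A' : Fin 2) : F A A' = 0 := by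
  rw [← low_up F, funext h]; simp [low]

theorem sum_eta_σUp_mul (A A' : Fin 2) (v : Fin 4 → ℂ) :
    ∑ a, (η a : ℂ) * (σUp a A A' * v a) = pol (fun B B' => if B = A ∧ B' = A' then 1 else 0)
      (low v) := by
  rw [← sum_eta_up_mul_up, up_low]
  refine Finset.sum_congr rfl fun a _ => ?_
  fin_cases A <;> fin_cases A' <;> simp [up]

/-- Lowering the free primed index exchanges its values 0 and 1 up to sign, which does not affect
vanishing. -/
theorem massless_iff_divSpinor (n : Fin 4 → Spinor3) :
    (∀ A' B C, ∑ A, ∑ f, (η f : ℂ) * σUp f A A' * n f A B C = 0) ↔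
      ∀ A' B C, divSpinor (lowSpinor n) A' B C = 0 := by
  have h : ∀ A' A B C, ∑ f, (η f : ℂ) * σUp f A A' * n f A B C =
      pol (fun B B' => if B = A ∧ B' = A' then 1 else 0)
        (fun F F' => lowSpinor n F F' A B C) := by
    intro A' A B C
    simp only [mul_assoc, lowSpinor]
    exact sum_eta_σUp_mul A A' _
  have h0 : ∀ B C, ∑ A, ∑ f, (η f : ℂ) * σUp f A 0 * n f A B C =
      -divSpinor (lowSpinor n) 1 B C := by
    intro B C; simp [h, pol, divSpinor]
  have h1 : ∀ B C, ∑ A, ∑ f, (η f : ℂ) * σUp f A 1 * n f A B C =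
      divSpinor (lowSpinor n) 0 B C := by
    intro B C; simp [h, pol, divSpinor]
  simp only [Fin.forall_fin_two (p := fun A' => ∀ B C, _), h0, h1, neg_eq_zero]
  exact and_comm

theorem sum_div_bil (Ψ χ : Spinor3) (n m : Fin 4 → Spinor3) (b c : Fin 4) :
    ∑ a, (η a : ℂ) * (bil (n a) χ a b c + bil Ψ (m a) a b c) =
      up (fun C C' => up (fun B B' =>
        divSpinor (lowSpinor n) 0 B C * χ 1 B' C' - divSpinor (lowSpinor n) 1 B C * χ 0 B' C'
        + divSpinor (fun F F' => lowSpinor m F' F) 0 B' C' * Ψ 1 B C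
        - divSpinor (fun F F' => lowSpinor m F' F) 1 B' C' * Ψ 0 B C) b) c := by
  have e1 : ∑ a, (η a : ℂ) * (bil (n a) χ a b c + bil Ψ (m a) a b c) =
      ∑ A, ∑ A', ∑ a, (η a : ℂ) * (σUp a A A' * ∑ B, ∑ B', ∑ C, ∑ C', σUp b B B' * σUp c C C' *
        (n a A B C * χ A' B' C' + Ψ A B C * m a A' B' C')) := by
    simp only [bil, Fin.sum_univ_two, Fin.sum_univ_four]; ring
  have e2 : ∀ A A' F F', low (fun a => ∑ B, ∑ B', ∑ C, ∑ C', σUp b B B' * σUp c C C' *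
        (n a A B C * χ A' B' C' + Ψ A B C * m a A' B' C')) F F' =
      ∑ B, ∑ B', ∑ C, ∑ C', σUp b B B' * σUp c C C' *
        (lowSpinor n F F' A B C * χ A' B' C' + Ψ A B C * lowSpinor m F F' A' B' C') := by
    intro A A' F F'
    simp only [low, lowSpinor, Fin.sum_univ_two, Fin.sum_univ_four]; ring
  simp only [e1, sum_eta_σUp_mul, pol, e2]
  simp [up, divSpinor, Fin.sum_univ_two]
  ring

/-- This is the square of the Hessian again. When the discriminant is nonzero, contracting with
`cubic Ψ` therefore cancels a factor Ψ. -/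
theorem pol_cubic_self (Ψ : Spinor3) (H : Fin 2) (A : Fin 2) :
    pol (cubic Ψ H) (Ψ A) = disc Ψ / 2 * eps H A := by
  rw [← hess_mul_hess]
  simp only [pol, cubic, hess]; ring

/-- For a divergence-free tensor the massless equation is a condition on the numerator of `S`. -/
theorem massless_iff_numer (Ψ χ : Spinor3) (hΨ : IsSymm3 Ψ) (hχ : IsSymm3 χ)
    (n m : Fin 4 → Spinor3) (hn : ∀ f, IsSymm3 (n f)) (hm : ∀ f, IsSymm3 (m f))
    (hdΨ : disc Ψ ≠ 0) (hdχ : disc χ ≠ 0)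
    (hdiv : ∀ b c, ∑ a, (η a : ℂ) * (bil (n a) χ a b c + bil Ψ (m a) a b c) = 0) :
    (∀ A' B C, ∑ A, ∑ f, (η f : ℂ) * σUp f A A' * n f A B C = 0) ↔
      ∀ h, numer Ψ χ n m h =
        -(Complex.I / 8) * (disc χ * dDisc Ψ (n h) - disc Ψ * dDisc χ (m h)) := by
  rw [massless_iff_divSpinor]
  simp only [numer, numerator_eq Ψ χ hΨ hχ n m hn hm]
  set X := divSpinor (lowSpinor n)
  set Y := divSpinor (fun F F' => lowSpinor m F' F)
  have hXY : ∀ B B' C C', X 0 B C * χ 1 B' C' - X 1 B C * χ 0 B' C'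
        + Y 0 B' C' * Ψ 1 B C - Y 1 B' C' * Ψ 0 B C = 0 := by
    intro B B' C C'
    refine up_eq_zero (F := fun B B' => X 0 B C * χ 1 B' C' - X 1 B C * χ 0 B' C'
        + Y 0 B' C' * Ψ 1 B C - Y 1 B' C' * Ψ 0 B C) (fun b => ?_) B B'
    refine up_eq_zero (F := fun C C' => up (fun B B' => X 0 B C * χ 1 B' C' - X 1 B C * χ 0 B' C'
        + Y 0 B' C' * Ψ 1 B C - Y 1 B' C' * Ψ 0 B C) b) (fun c => ?_) C C'
    rw [← hdiv b c, sum_div_bil]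
  -- Contracting the divergence of T with `cubic χ` in the primed indices cancels χ, so X is
  -- determined by the four numbers `pol (cubic χ H') (Y H)`.
  have hX1 : ∀ H' B C, X H' B C * disc χ / 2 =
      - (pol (cubic χ H') (Y 0) * Ψ 1 B C - pol (cubic χ H') (Y 1) * Ψ 0 B C) := by
    intro H' B C
    have e0 := pol_cubic_self χ H' 0
    have e1 := pol_cubic_self χ H' 1
    have hp := fun B' C' => hXY B B' C C'
    have : (pol (cubic χ H') (χ 1) * X 0 B C - pol (cubic χ H') (χ 0) * X 1 B C) +
      (pol (cubic χ H') (Y 0) * Ψ 1 B C - pol (cubic χ H') (Y 1) * Ψ 0 B C) = 0 := by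
      simp only [pol]
      linear_combination cubic χ H' 0 0 * hp 1 1 + cubic χ H' 1 1 * hp 0 0
        - cubic χ H' 0 1 * hp 1 0 - cubic χ H' 1 0 * hp 0 1
    rw [e0, e1] at this
    fin_cases H' <;> simp [eps] at this ⊢ <;> linear_combination this
  -- A second contraction, now with `cubic Ψ`. The minus sign is decisive: the two divergence terms
  -- of the numerator add instead of cancelling.
  have hX2 : ∀ H H', disc χ * pol (cubic Ψ H) (X H') = - disc Ψ * pol (cubic χ H') (Y H) := by
    intro H H'
    have e0 := pol_cubic_self Ψ H 0
    have e1 := pol_cubic_self Ψ H 1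
    have : pol (cubic Ψ H) (X H') * disc χ / 2 = -(pol (cubic χ H') (Y 0) * pol (cubic Ψ H) (Ψ 1)
        - pol (cubic χ H') (Y 1) * pol (cubic Ψ H) (Ψ 0)) := by
      have hp := hX1 H'
      rw [pol, pol.eq_def (cubic Ψ H) (Ψ 1), pol.eq_def (cubic Ψ H) (Ψ 0)]
      linear_combination cubic Ψ H 0 0 * hp 1 1 + cubic Ψ H 1 1 * hp 0 0
        - cubic Ψ H 0 1 * hp 1 0 - cubic Ψ H 1 0 * hp 0 1
    rw [e0, e1] at this
    fin_cases H <;> simp [eps] at this ⊢ <;> linear_combination 2 * this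
  constructor
  · intro h0 h
    have hY : ∀ H H', pol (cubic χ H') (Y H) = 0 := by
      intro H H'
      have := hX2 H H'
      have h00 : pol (cubic Ψ H) (X H') = 0 := by simp [pol, h0]
      rw [h00] at this
      simpa [hdΨ] using this
    have h00 : ∀ H H', pol (cubic Ψ H) (X H') = 0 := by intro H H'; simp [pol, h0]
    simp [h00, hY, up]
  · intro h0
    have h1 : ∀ H H', pol (cubic χ H') (Y H) = 0 := by
      intro H H'
      have := up_eq_zero (F := fun H H' => Complex.I * (disc χ * pol (cubic Ψ H) (X H') -
        disc Ψ * pol (cubic χ H') (Y H))) (fun a => by linear_combination h0 a) H H'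
      simp only [hX2] at this
      have h2 : disc Ψ * pol (cubic χ H') (Y H) = 0 := by
        linear_combination (Complex.I / 2) * this
          + disc Ψ * pol (cubic χ H') (Y H) * Complex.I_mul_I
      simpa [hdΨ] using h2
    intro H' B C
    have := hX1 H' B C
    rw [h1, h1] at this
    simpa [hdχ] using this

/-! ### Products of spinors satisfy the quadratic identity -/

theorem low_const_mul (c : ℂ) (v : Fin 4 → ℂ) (A A' : Fin 2) :
    low (fun a => c * v a) A A' = c * low v A A' := by
  simp only [low, Fin.sum_univ_four]; ring

theorem low_mul_const (c : ℂ) (v : Fin 4 → ℂ) (A A' : Fin 2) :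
    low (fun a => v a * c) A A' = low v A A' * c := by
  simp only [low, Fin.sum_univ_four]; ring

theorem low_add (v w : Fin 4 → ℂ) (A A' : Fin 2) :
    low (fun a => v a + w a) A A' = low v A A' + low w A A' := by
  simp only [low, Fin.sum_univ_four]; ring

theorem low_sub (v w : Fin 4 → ℂ) (A A' : Fin 2) :
    low (fun a => v a - w a) A A' = low v A A' - low w A A' := by
  simp only [low, Fin.sum_univ_four]; ring

theorem low_comm (f : Fin 4 → Fin 4 → ℂ) (A A' B B' : Fin 2) :
    low (fun b => low (fun a => f a b) A A') B B' =
      low (fun a => low (fun b => f a b) B B') A A' := by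
  simp only [low, Finset.mul_sum]
  rw [Finset.sum_comm]
  simp only [mul_left_comm]

/-- Null components of the metric. -/
theorem low_low_gLow (A A' B B' : Fin 2) :
    low (fun b => low (fun a => (gLow a b : ℂ)) A A') B B' = eps A B * eps A' B' := by
  fin_cases A <;> fin_cases A' <;> fin_cases B <;> fin_cases B' <;>
  simp [low, σLow, σUp, Fin.sum_univ_four, gLow, η, eps] <;> ring_nf <;>
  simp only [inv_sqrt_two_sq, Complex.I_sq] <;> ring

/-- The tensor with given null components. -/
def sum4 (a b : Fin 4) (F : Fin 2 → Fin 2 → Fin 2 → Fin 2 → ℂ) : ℂ :=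
  ∑ A, ∑ A', ∑ B, ∑ B', σUp a A A' * σUp b B B' * F A A' B B'

theorem gLow_eq_sum4 (a b : Fin 4) :
    (gLow a b : ℂ) = sum4 a b fun A A' B B' => eps A B * eps A' B' := by
  have h := up_low (fun b' => (gLow a b' : ℂ))
  have h2 : ∀ b', up (low (fun a' => (gLow a' b' : ℂ))) a = gLow a b' := fun b' => by rw [up_low]
  have h3 : (fun b' => (gLow a b' : ℂ)) =
      fun b' => up (low (fun a' => (gLow a' b' : ℂ))) a := funext fun b' => (h2 b').symm
  rw [← congrFun h b, h3]
  have h4 : ∀ B B', low (fun b' => up (low (fun a' => (gLow a' b' : ℂ))) a) B B' =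
      ∑ A, ∑ A', σUp a A A' * (eps A B * eps A' B') := by
    intro B B'
    simp only [up, Fin.sum_univ_two, low_add, low_const_mul, low_low_gLow]
  change ∑ B, ∑ B', σUp b B B' * low (fun b' => up (low (fun a' => (gLow a' b' : ℂ))) a) B B' = _
  simp only [sum4, h4, Fin.sum_univ_two]
  ring

/-- The left side is antisymmetric under exchange of the symmetric pairs AB and DE. The second
exterior power of the symmetric square is again a symmetric square, so only ε times a symmetric
spinor can occur, and that spinor is the Hessian. -/
theorem mul_sub_mul_eq_hess (Ψ : Spinor3) (hΨ : IsSymm3 Ψ) (A B D E : Fin 2) :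
    Ψ A B 0 * Ψ D E 1 - Ψ A B 1 * Ψ D E 0 = 1 / 4 * (eps A D * hess Ψ B E +
      eps A E * hess Ψ B D + eps B D * hess Ψ A E + eps B E * hess Ψ A D) := by
  have e1 := (hΨ 1 0 0).1
  have e2 := (hΨ 0 1 0).2
  have e3 := (hΨ 1 0 1).1
  have e4 := (hΨ 1 1 0).2
  fin_cases A <;> fin_cases B <;> fin_cases D <;> fin_cases E <;>
  simp [eps, hess, pol, e1, e2, e3, e4] <;> ring

/-- The quadratic identity for the null components. -/
theorem eps_hess_identity (Ψ χ : Spinor3) (A B D E A' B' D' E' : Fin 2) :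
    (1 / 4 * (eps A D * hess Ψ B E +
      eps A E * hess Ψ B D + eps B D * hess Ψ A E + eps B E * hess Ψ A D)) *
    (1 / 4 * (eps A' D' * hess χ B' E' +
      eps A' E' * hess χ B' D' + eps B' D' * hess χ A' E' + eps B' E' * hess χ A' D')) =
    1 / 4 * ((eps A D * eps A' D') * (hess Ψ B E * hess χ B' E')
      + (eps A E * eps A' E') * (hess Ψ B D * hess χ B' D')
      + (eps B D * eps B' D') * (hess Ψ A E * hess χ A' E')
      + (eps B E * eps B' E') * (hess Ψ A D * hess χ A' D'))
    - 1 / 4 * (eps A B * eps A' B') * (hess Ψ D E * hess χ D' E')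
    - 1 / 4 * (eps D E * eps D' E') * (hess Ψ A B * hess χ A' B') := by
  have key : ∀ Ψ : Spinor3, ∀ A B D E,
      eps A D * hess Ψ B E - eps B D * hess Ψ A E = eps A B * hess Ψ D E ∧
      eps A E * hess Ψ B D - eps B E * hess Ψ A D = eps A B * hess Ψ D E ∧
      eps A D * hess Ψ B E - eps A E * hess Ψ B D = - (eps D E * hess Ψ A B) := by
    intro Ψ A B D E
    have h1 := hess_symm Ψ 1 0
    fin_cases A <;> fin_cases B <;> fin_cases D <;> fin_cases E <;> simp [eps, h1]
  obtain ⟨p, q, r⟩ := key Ψ A B D E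
  obtain ⟨p', q', r'⟩ := key χ A' B' D' E'
  have aux : ∀ a b c d u v a' b' c' d' u' v' : ℂ, a - c = u → b - d = u → a - b = -v →
      a' - c' = u' → b' - d' = u' → a' - b' = -v' →
      (1 / 4 * (a + b + c + d)) * (1 / 4 * (a' + b' + c' + d')) =
        1 / 4 * (a * a' + b * b' + c * c' + d * d') - 1 / 4 * (u * u') - 1 / 4 * (v * v') := by
    intro a b c d u v a' b' c' d' u' v' h1 h2 h3 h1' h2' h3'
    obtain rfl : c = a - u := by linear_combination -h1
    obtain rfl : b = a + v := by linear_combination -h3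
    obtain rfl : d = a + v - u := by linear_combination -h2
    obtain rfl : c' = a' - u' := by linear_combination -h1'
    obtain rfl : b' = a' + v' := by linear_combination -h3'
    obtain rfl : d' = a' + v' - u' := by linear_combination -h2'
    ring
  linear_combination aux _ _ _ _ _ _ _ _ _ _ _ _ p q r p' q' r'

/-- The rank four tensor with given null components. -/
def sum8 (a b d e : Fin 4)
    (F : Fin 2 → Fin 2 → Fin 2 → Fin 2 → Fin 2 → Fin 2 → Fin 2 → Fin 2 → ℂ) : ℂ :=
  ∑ A, ∑ A', ∑ B, ∑ B', ∑ D, ∑ D', ∑ E, ∑ E',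
    σUp a A A' * σUp b B B' * σUp d D D' * σUp e E E' * F A A' B B' D D' E E'

theorem sum8_ab_de (a b d e : Fin 4) (f g : Fin 2 → Fin 2 → Fin 2 → Fin 2 → ℂ) :
    sum4 a b f * sum4 d e g =
    sum8 a b d e fun A A' B B' D D' E E' => f A A' B B' * g D D' E E' := by
  simp only [sum8, sum4, Fin.sum_univ_two]; ring

theorem sum8_ad_be (a b d e : Fin 4) (f g : Fin 2 → Fin 2 → Fin 2 → Fin 2 → ℂ) :
    sum4 a d f * sum4 b e g =
    sum8 a b d e fun A A' B B' D D' E E' => f A A' D D' * g B B' E E' := by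
  simp only [sum8, sum4, Fin.sum_univ_two]; ring

theorem sum8_ae_bd (a b d e : Fin 4) (f g : Fin 2 → Fin 2 → Fin 2 → Fin 2 → ℂ) :
    sum4 a e f * sum4 b d g =
    sum8 a b d e fun A A' B B' D D' E E' => f A A' E E' * g B B' D D' := by
  simp only [sum8, sum4, Fin.sum_univ_two]; ring

theorem sum8_add (a b d e F G) : sum8 a b d e F + sum8 a b d e G =
    sum8 a b d e fun A A' B B' D D' E E' => F A A' B B' D D' E E' + G A A' B B' D D' E E' := by
  simp only [sum8, mul_add, Finset.sum_add_distrib]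

theorem sum8_const_mul (c : ℂ) (a b d e F) : c * sum8 a b d e F =
    sum8 a b d e fun A A' B B' D D' E E' => c * F A A' B B' D D' E E' := by
  simp only [sum8, Finset.mul_sum, mul_left_comm]

/-- `T_{ajk} T_b^{jk}` for a complex tensor. -/
def contrC (T : Fin 4 → Fin 4 → Fin 4 → ℂ) (a b : Fin 4) : ℂ :=
  ∑ j, ∑ k, (η j : ℂ) * η k * (T a j k * T b j k)

theorem contrC_bil (Ψ χ : Spinor3) (a b : Fin 4) :
    contrC (bil Ψ χ) a b = sum4 a b fun A A' B B' =>
      hess Ψ A B * hess χ A' B' := sum_bil_mul_bil Ψ χ Ψ χ a b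

/-- The contraction over j is an unprimed times a primed factor, each given by
`mul_sub_mul_eq_hess`; `eps_hess_identity` multiplies them out. -/
theorem quadratic_bil (Ψ χ : Spinor3) (hΨ : IsSymm3 Ψ) (hχ : IsSymm3 χ) (a b d e : Fin 4) :
    ∑ j, (η j : ℂ) * (bil Ψ χ a b j * bil Ψ χ d e j) =
    (1 / 4) * (gLow a d * contrC (bil Ψ χ) b e + gLow a e * contrC (bil Ψ χ) b d
      + gLow b d * contrC (bil Ψ χ) a e + gLow b e * contrC (bil Ψ χ) a d)
    - (1 / 4) * gLow a b * contrC (bil Ψ χ) d e - (1 / 4) * gLow d e * contrC (bil Ψ χ) a b := by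
  have h1 : ∀ a b, bil Ψ χ a b = up (fun C C' => ∑ A, ∑ A', ∑ B, ∑ B',
      σUp a A A' * σUp b B B' * (Ψ A B C * χ A' B' C')) := by
    intro a b
    ext j
    simp only [bil, up, Fin.sum_univ_two]; ring
  have h2 : ∑ j, (η j : ℂ) * (bil Ψ χ a b j * bil Ψ χ d e j) =
      sum8 a b d e fun A A' B B' D D' E E' =>
        ((Ψ A B 0 * Ψ D E 1 - Ψ A B 1 * Ψ D E 0) *
        (χ A' B' 0 * χ D' E' 1 - χ A' B' 1 * χ D' E' 0)) := by
    rw [h1, h1, sum_eta_up_mul_up]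
    simp only [sum8, pol, Fin.sum_univ_two]; ring
  rw [h2]
  simp only [mul_sub_mul_eq_hess _ hΨ, mul_sub_mul_eq_hess _ hχ, eps_hess_identity]
  have e1 : ∀ x y z w p q : ℂ, 1 / 4 * (x + y + z + w) - 1 / 4 * p - 1 / 4 * q =
      1 / 4 * (x + y + z + w + (-1) * p + (-1) * q) := by intros; ring
  simp only [mul_assoc (1 / 4 : ℂ), e1]
  rw [mul_comm (gLow b d : ℂ), mul_comm (gLow b e : ℂ), mul_comm (gLow d e : ℂ)]
  simp only [contrC_bil, gLow_eq_sum4]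
  rw [sum8_ad_be a b d e, sum8_ad_be a b d e, sum8_ae_bd a b d e, sum8_ae_bd a b d e,
    sum8_ab_de, sum8_ab_de]
  simp only [sum8_const_mul]
  simp only [sum8_add, sum8_const_mul]
  congr 1
  ext A A' B B' D D' E E'
  ring

/-! ### The quadratic identity forces rank one -/

/-- A completely symmetric array on two values depends on the sum of the indices only. -/
theorem isSymm3_fin_two {R : Type*} {f : Fin 2 → Fin 2 → Fin 2 → R} (hf : IsSymm3 f) :
    ∃ t : ℕ → R, (∀ A B C : Fin 2, f A B C = t (A.1 + B.1 + C.1)) ∧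
      ∀ n, ∃ A B C, t n = f A B C := by
  have e1 := (hf 1 0 0).1
  have e2 := (hf 0 1 0).2
  have e3 := (hf 1 0 1).1
  have e4 := (hf 1 1 0).2
  -- Index sums above 3 never occur. The default `f 1 1 1` keeps every `t n` a value of f, so
  -- properties of all values of f pass to `t n` for every n.
  refine ⟨fun n => if n = 0 then f 0 0 0 else if n = 1 then f 0 0 1 else if n = 2 then f 0 1 1
    else f 1 1 1, fun A B C => ?_, fun n => ?_⟩
  · fin_cases A <;> fin_cases B <;> fin_cases C <;> simp [e1, e2, e3, e4]
  · dsimp only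
    split_ifs <;> exact ⟨_, _, _, rfl⟩

theorem eps_eq (A B : Fin 2) : eps A B = (B.1 : ℂ) - A.1 := by
  fin_cases A <;> fin_cases B <;> simp [eps]

/-- Null components of a rank three tensor. -/
def nullT (T : Fin 4 → Fin 4 → Fin 4 → ℂ) (A A' B B' C C' : Fin 2) : ℂ :=
  low (fun a => low (fun b => low (fun c => T a b c) C C') B B') A A'

theorem eq_sum_nullT (T : Fin 4 → Fin 4 → Fin 4 → ℂ) (a b c : Fin 4) :
    T a b c = ∑ A, ∑ B, ∑ C, ∑ A', ∑ B', ∑ C',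
      σUp a A A' * σUp b B B' * σUp c C C' * nullT T A A' B B' C C' := by
  have h1 : ∀ A A', ∀ b' c', low (fun a => T a b' c') A A' =
      up (fun B B' => low (fun b => low (fun a => T a b c') A A') B B') b' := fun A A' b' c' =>
    (congrFun (up_low (fun b => low (fun a => T a b c') A A')) b').symm
  have h2 : ∀ A A' B B', ∀ c', low (fun b => low (fun a => T a b c') A A') B B' =
      up (fun C C' => low (fun c => low (fun b => low (fun a => T a b c) A A') B B') C C') c' :=
    fun A A' B B' c' =>
    (congrFun (up_low (fun c => low (fun b => low (fun a => T a b c) A A') B B')) c').symm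
  have h3 : ∀ A A' B B' C C',
      low (fun c => low (fun b => low (fun a => T a b c) A A') B B') C C' =
        nullT T A A' B B' C C' := by
    intro A A' B B' C C'
    simp only [low_comm (fun a b => T a b _)]
    rw [low_comm (fun a c => low (fun b => T a b c) B B')]
    simp only [low_comm (fun b c => T _ b c), nullT]
  have h0 : T a b c = up (fun A A' => low (fun a => T a b c) A A') a :=
    (congrFun (up_low (fun a => T a b c)) a).symm
  rw [h0]
  simp only [h1 _ _ b c, h2 _ _ _ _ c, h3]
  simp only [up, Fin.sum_univ_two]
  ring

theorem nullT_swap12 {T : Fin 4 → Fin 4 → Fin 4 → ℂ} (hT : IsSymm3 T) (A A' B B' C C' : Fin 2) :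
    nullT T A A' B B' C C' = nullT T B B' A A' C C' := by
  simp only [nullT]
  rw [low_comm]
  simp only [fun a b c => (hT a b c).1]

theorem nullT_swap23 {T : Fin 4 → Fin 4 → Fin 4 → ℂ} (hT : IsSymm3 T) (A A' B B' C C' : Fin 2) :
    nullT T A A' B B' C C' = nullT T A A' C C' B B' := by
  have : ∀ a, low (fun b => low (fun c => T a b c) C C') B B' =
      low (fun b => low (fun c => T a b c) B B') C C' := fun a => by
    rw [low_comm (fun c b => T a b c)]
    exact congrArg (low · C C') (funext fun x =>
      congrArg (low · B B') (funext fun y => (hT a y x).2))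
  simp only [nullT, this]

/-- The trace is the ε ε contraction of the first two index pairs; symmetry under their exchange
makes its four terms equal in twos. -/
theorem nullT_trace {T : Fin 4 → Fin 4 → Fin 4 → ℂ}
    (htr : ∀ b, ∑ a, (η a : ℂ) * T a a b = 0) (hT : IsSymm3 T) (C C' : Fin 2) :
    nullT T 0 0 1 1 C C' = nullT T 0 1 1 0 C C' := by
  have h : ∀ v : Fin 4 → Fin 4 → ℂ, ∑ a, (η a : ℂ) * v a a =
      low (fun a => low (v a) 1 1) 0 0 + low (fun a => low (v a) 0 0) 1 1
      - low (fun a => low (v a) 1 0) 0 1 - low (fun a => low (v a) 0 1) 1 0 := by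
    intro v
    simp [low, σLow, σUp, Fin.sum_univ_four, η]
    ring_nf
    simp only [inv_sqrt_two_sq, Complex.I_sq]
    ring
  have h2 : low (fun c => ∑ a, (η a : ℂ) * T a a c) C C' =
      ∑ a, (η a : ℂ) * low (fun c => T a a c) C C' := by
    simp only [Fin.sum_univ_four, low_add, low_const_mul]
  have h3 := h (fun a b => low (fun c => T a b c) C C')
  rw [← h2] at h3
  simp only [htr] at h3
  have h4 : low (fun _ => 0) C C' = 0 := by simp [low]
  rw [h4] at h3
  change 0 = nullT T 0 0 1 1 C C' + nullT T 1 1 0 0 C C' - nullT T 0 1 1 0 C C'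
    - nullT T 1 0 0 1 C C' at h3
  rw [nullT_swap12 hT 1 1 0 0, nullT_swap12 hT 1 0 0 1] at h3
  linear_combination (-1 / 2) * h3

/-- The null components of a symmetric trace-free tensor are symmetric in the unprimed and in the
primed indices. -/
theorem exists_nullT_eq {T : Fin 4 → Fin 4 → Fin 4 → ℂ} (hT : IsSymm3 T)
    (htr : ∀ b, ∑ a, (η a : ℂ) * T a a b = 0) :
    ∃ t : ℕ → ℕ → ℂ, ∀ A A' B B' C C' : Fin 2, nullT T A A' B B' C C' =
      t (A.1 + B.1 + C.1) (A'.1 + B'.1 + C'.1) := by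
  -- Symmetry under exchange of pairs leaves a part symmetric in both kinds of indices and a part
  -- antisymmetric in both. The latter is the trace, so the primed indices may be exchanged alone.
  have h12 : ∀ A A' B B' C C', nullT T A A' B B' C C' = nullT T A B' B A' C C' := by
    intro A A' B B' C C'
    have h1 := nullT_trace htr hT C C'
    have h2 := nullT_swap12 hT 1 1 0 0 C C'
    have h3 := nullT_swap12 hT 1 0 0 1 C C'
    have h4 := nullT_swap12 hT 0 0 0 1 C C'
    have h5 := nullT_swap12 hT 1 0 1 1 C C'
    fin_cases A <;> fin_cases A' <;> fin_cases B <;> fin_cases B' <;>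
    simp [h1, h2, h3, h4, h5]
  have h23 : ∀ A A' B B' C C', nullT T A A' B B' C C' = nullT T A A' B C' C B' := by
    intro A A' B B' C C'
    rw [nullT_swap12 hT, nullT_swap23 hT, nullT_swap12 hT, h12, nullT_swap12 hT, nullT_swap23 hT,
      nullT_swap12 hT]
  obtain ⟨t, ht, hr⟩ := isSymm3_fin_two (f := fun A B C A' B' C' => nullT T A A' B B' C C')
    fun A B C => by
      constructor <;> funext A' B' C'
      · exact (nullT_swap12 hT _ _ _ _ _ _).trans (h12 _ _ _ _ _ _)
      · exact (nullT_swap23 hT _ _ _ _ _ _).trans (h23 _ _ _ _ _ _)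
  have hs : ∀ n, IsSymm3 (t n) := by
    intro n A' B' C'
    obtain ⟨A, B, C, h⟩ := hr n
    rw [h]
    exact ⟨h12 _ _ _ _ _ _, h23 _ _ _ _ _ _⟩
  choose u hu using fun n => isSymm3_fin_two (hs n)
  refine ⟨u, fun A A' B B' C C' => ?_⟩
  rw [← (hu _).1, ← ht]

theorem contrC_eq_pol (T : Fin 4 → Fin 4 → Fin 4 → ℂ) (a b : Fin 4) :
    contrC T a b =
      pol (fun D D' => low (fun j => low (fun k => T a j k) 0 0) D D')
        (fun D D' => low (fun j => low (fun k => T b j k) 1 1) D D') +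
      pol (fun D D' => low (fun j => low (fun k => T a j k) 1 1) D D')
        (fun D D' => low (fun j => low (fun k => T b j k) 0 0) D D') -
      pol (fun D D' => low (fun j => low (fun k => T a j k) 0 1) D D')
        (fun D D' => low (fun j => low (fun k => T b j k) 1 0) D D') -
      pol (fun D D' => low (fun j => low (fun k => T a j k) 1 0) D D')
        (fun D D' => low (fun j => low (fun k => T b j k) 0 1) D D') := by
  have h : ∀ a j k, up (fun C C' => up (fun D D' =>
      low (fun j => low (fun k => T a j k) C C') D D') j) k = T a j k := by
    intro a j k
    have : ∀ C C', up (fun D D' => low (fun j => low (fun k => T a j k) C C') D D') j =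
        low (fun k => T a j k) C C' := fun C C' =>
      congrFun (up_low (fun j => low (fun k => T a j k) C C')) j
    simp only [this]
    exact congrFun (up_low (fun k => T a j k)) k
  have := sum_eta_eta_up_up (fun C C' D D' => low (fun j => low (fun k => T a j k) C C') D D')
    (fun C C' D D' => low (fun j => low (fun k => T b j k) C C') D D')
  rw [← this]
  simp only [h, contrC]

/-- The null components of `T_{ajk} T_b^{jk}` for null components `t` of `T`. -/
def contrNull (t : ℕ → ℕ → ℂ) (A A' B B' : ℕ) : ℂ :=
  pol (fun D D' => t (A + D) (A' + D')) (fun D D' => t (B + D + 1) (B' + D' + 1)) +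
  pol (fun D D' => t (A + D + 1) (A' + D' + 1)) (fun D D' => t (B + D) (B' + D')) -
  pol (fun D D' => t (A + D) (A' + D' + 1)) (fun D D' => t (B + D + 1) (B' + D')) -
  pol (fun D D' => t (A + D + 1) (A' + D')) (fun D D' => t (B + D) (B' + D' + 1))

theorem low_low_contrC {T : Fin 4 → Fin 4 → Fin 4 → ℂ} {t : ℕ → ℕ → ℂ}
    (ht : ∀ A A' B B' C C' : Fin 2, nullT T A A' B B' C C' =
      t (A.1 + B.1 + C.1) (A'.1 + B'.1 + C'.1)) (A A' B B' : Fin 2) :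
    low (fun a => low (fun b => contrC T a b) B B') A A' = contrNull t A A' B B' := by
  simp only [nullT] at ht
  simp only [contrC_eq_pol, pol, low_add, low_sub, low_const_mul, low_mul_const, ht, contrNull,
    Fin.val_zero, Fin.val_one, add_zero]

/-- The quadratic identity in null components. -/
theorem quadratic_null {T : Fin 4 → Fin 4 → Fin 4 → ℂ} {t : ℕ → ℕ → ℂ}
    (ht : ∀ A A' B B' C C' : Fin 2, nullT T A A' B B' C C' =
      t (A.1 + B.1 + C.1) (A'.1 + B'.1 + C'.1))
    (hq : ∀ a b d e, ∑ j, (η j : ℂ) * (T a b j * T d e j) =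
      (1 / 4) * (gLow a d * contrC T b e + gLow a e * contrC T b d
        + gLow b d * contrC T a e + gLow b e * contrC T a d)
      - (1 / 4) * gLow a b * contrC T d e - (1 / 4) * gLow d e * contrC T a b)
    (A A' B B' D D' E E' : Fin 2) :
    t (A + B) (A' + B') * t (D + E + 1) (D' + E' + 1)
      + t (A + B + 1) (A' + B' + 1) * t (D + E) (D' + E')
      - t (A + B) (A' + B' + 1) * t (D + E + 1) (D' + E')
      - t (A + B + 1) (A' + B') * t (D + E) (D' + E' + 1) =
    (1 / 4) * ((D - A) * (D' - A') * contrNull t B B' E E'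
      + (E - A) * (E' - A') * contrNull t B B' D D'
      + (D - B) * (D' - B') * contrNull t A A' E E'
      + (E - B) * (E' - B') * contrNull t A A' D D')
    - (1 / 4) * ((B - A) * (B' - A')) * contrNull t D D' E E'
    - (1 / 4) * ((E - D) * (E' - D')) * contrNull t A A' B B' := by
  have hg : ∀ A A' B B', low (fun a => low (fun b => (gLow a b : ℂ)) B B') A A' =
      eps A B * eps A' B' := fun A A' B B' => by
    rw [low_comm (fun b a => (gLow a b : ℂ)), low_low_gLow]
  have hc := low_low_contrC ht
  simp only [sum_eta_mul] at hq
  have h := congrArg (fun f : Fin 4 → Fin 4 → Fin 4 → Fin 4 → ℂ =>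
    low (fun a => low (fun b => low (fun d => low (fun e => f a b d e) E E') D D') B B') A A')
    (funext fun a => funext fun b => funext fun d => funext fun e => hq a b d e)
  simp only [nullT] at ht
  simp only [pol, low_add, low_sub, low_const_mul, low_mul_const, ht, hg, hc, eps_eq,
    Fin.val_zero, Fin.val_one, add_zero] at h
  linear_combination h

/-- The difference of the two sides of the quadratic identity in null components. -/
def quadDefect (t : ℕ → ℕ → ℂ) (A A' B B' D D' E E' : ℕ) : ℂ :=
    t (A + B) (A' + B') * t (D + E + 1) (D' + E' + 1)
      + t (A + B + 1) (A' + B' + 1) * t (D + E) (D' + E')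
      - t (A + B) (A' + B' + 1) * t (D + E + 1) (D' + E')
      - t (A + B + 1) (A' + B') * t (D + E) (D' + E' + 1) -
    ((1 / 4) * ((D - A) * (D' - A') * contrNull t B B' E E'
      + (E - A) * (E' - A') * contrNull t B B' D D'
      + (D - B) * (D' - B') * contrNull t A A' E E'
      + (E - B) * (E' - B') * contrNull t A A' D D')
    - (1 / 4) * ((B - A) * (B' - A')) * contrNull t D D' E E'
    - (1 / 4) * ((E - D) * (E' - D')) * contrNull t A A' B B')

/-- The quadratic identity makes all two by two minors of the null components vanish. -/
theorem minor_eq_of_lt {t : ℕ → ℕ → ℂ}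
    (hq : ∀ A A' B B' D D' E E' : Fin 2, quadDefect t A A' B B' D D' E E' = 0)
    {m p n q : ℕ} (hmp : m < p) (hp : p < 4) (hnq : n < q) (hq4 : q < 4) :
    t m n * t p q = t m q * t p n := by
  interval_cases p <;> interval_cases m <;> interval_cases q <;> interval_cases n
  -- Each of the 36 minors is a rational combination of components of the defect; the coefficients
  -- solve a linear system in the quadratic monomials of t. Normalization is postponed, and
  -- `rotate_left` passes to the next minor, so that all the goals are closed together at the end.
  linear_combination (norm := skip) (1/2) * hq 0 0 0 0 0 0 0 0
  rotate_left
  linear_combination (norm := skip) (1) * hq 0 0 0 0 0 0 0 1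
  rotate_left
  linear_combination (norm := skip) (1/2) * hq 0 0 0 1 0 0 0 1
  rotate_left
  linear_combination (norm := skip) (1/2) * hq 0 0 0 1 0 0 0 1 + (1) * hq 0 0 0 0 0 1 0 1
  rotate_left
  linear_combination (norm := skip) (1) * hq 0 0 0 1 0 1 0 1
  rotate_left
  linear_combination (norm := skip) (1/2) * hq 0 1 0 1 0 1 0 1
  rotate_left
  linear_combination (norm := skip) (1) * hq 0 0 0 0 0 0 1 0
  rotate_left
  linear_combination (norm := skip) (2) * hq 0 0 0 0 0 0 1 1
  rotate_left
  linear_combination (norm := skip) (1) * hq 0 0 0 1 0 0 1 1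
  rotate_left
  linear_combination (norm := skip) (1) * hq 0 0 0 1 0 0 1 1 + (2) * hq 0 0 0 0 0 1 1 1
  rotate_left
  linear_combination (norm := skip) (2) * hq 0 0 0 1 0 1 1 1
  rotate_left
  linear_combination (norm := skip) (1) * hq 0 1 0 1 0 1 1 1
  rotate_left
  linear_combination (norm := skip) (1/2) * hq 0 0 1 0 0 0 1 0
  rotate_left
  linear_combination (norm := skip) (1) * hq 0 0 1 0 0 0 1 1
  rotate_left
  linear_combination (norm := skip) (1/2) * hq 0 0 1 1 0 0 1 1
  rotate_left
  linear_combination (norm := skip) (-1/2) * hq 0 0 1 1 0 0 1 1 + (1) * hq 0 0 1 0 0 1 1 1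
    + (1) * hq 0 0 1 1 0 1 1 0
  rotate_left
  linear_combination (norm := skip) (1) * hq 0 0 1 1 0 1 1 1
  rotate_left
  linear_combination (norm := skip) (1/2) * hq 0 1 1 1 0 1 1 1
  rotate_left
  linear_combination (norm := skip) (1/2) * hq 0 0 1 0 0 0 1 0 + (1) * hq 0 0 0 0 1 0 1 0
  rotate_left
  linear_combination (norm := skip) (1) * hq 0 0 1 0 0 0 1 1 + (2) * hq 0 0 0 0 1 0 1 1
  rotate_left
  linear_combination (norm := skip) (-1/2) * hq 0 0 1 1 0 0 1 1 + (1) * hq 0 0 0 1 1 0 1 1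
    + (1) * hq 0 0 1 1 0 1 1 0
  rotate_left
  linear_combination (norm := skip) (11/2) * hq 0 0 1 1 0 0 1 1 + (3) * hq 0 0 0 0 1 1 1 1
    + (-4) * hq 0 0 1 1 0 1 1 0
  rotate_left
  linear_combination (norm := skip) (1) * hq 0 0 1 1 0 1 1 1 + (2) * hq 0 0 0 1 1 1 1 1
  rotate_left
  linear_combination (norm := skip) (1/2) * hq 0 1 1 1 0 1 1 1 + (1) * hq 0 1 0 1 1 1 1 1
  rotate_left
  linear_combination (norm := skip) (1) * hq 0 0 1 0 1 0 1 0
  rotate_left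
  linear_combination (norm := skip) (2) * hq 0 0 1 0 1 0 1 1
  rotate_left
  linear_combination (norm := skip) (1) * hq 0 0 1 1 1 0 1 1
  rotate_left
  linear_combination (norm := skip) (1) * hq 0 0 1 1 1 0 1 1 + (2) * hq 0 0 1 0 1 1 1 1
  rotate_left
  linear_combination (norm := skip) (2) * hq 0 0 1 1 1 1 1 1
  rotate_left
  linear_combination (norm := skip) (1) * hq 0 1 1 1 1 1 1 1
  rotate_left
  linear_combination (norm := skip) (1/2) * hq 1 0 1 0 1 0 1 0
  rotate_left
  linear_combination (norm := skip) (1) * hq 1 0 1 0 1 0 1 1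
  rotate_left
  linear_combination (norm := skip) (1/2) * hq 1 0 1 1 1 0 1 1
  rotate_left
  linear_combination (norm := skip) (1/2) * hq 1 0 1 1 1 0 1 1 + (1) * hq 1 0 1 0 1 1 1 1
  rotate_left
  linear_combination (norm := skip) (1) * hq 1 0 1 1 1 1 1 1
  rotate_left
  linear_combination (norm := skip) (1/2) * hq 1 1 1 1 1 1 1 1
  rotate_left
  all_goals
    simp only [quadDefect, contrNull, pol, Fin.val_zero, Fin.val_one, Nat.cast_zero, Nat.cast_one,
      Nat.reduceAdd, Fin.isValue]
    ring

theorem minor_eq {t : ℕ → ℕ → ℂ}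
    (hq : ∀ A A' B B' D D' E E' : Fin 2, quadDefect t A A' B B' D D' E E' = 0)
    {m p n q : ℕ} (hm : m < 4) (hp : p < 4) (hn : n < 4) (hq4 : q < 4) :
    t m n * t p q = t m q * t p n := by
  rcases lt_trichotomy m p with h | rfl | h
  · rcases lt_trichotomy n q with h' | rfl | h'
    · exact minor_eq_of_lt hq h hp h' hq4
    · rfl
    · exact (minor_eq_of_lt hq h hp h' hn).symm
  · ring
  · rcases lt_trichotomy n q with h' | rfl | h'
    · linear_combination -minor_eq_of_lt hq h hm h' hq4
    · ring
    · linear_combination minor_eq_of_lt hq h hm h' hn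

/-- Reality of T: the matrix with rows ABC and columns A'B'C' is Hermitian. -/
theorem star_nullT (T : Tensor3) (A A' B B' C C' : Fin 2) :
    star (nullT (fun a b c => (T a b c : ℂ)) A A' B B' C C') =
      nullT (fun a b c => (T a b c : ℂ)) A' A B' B C' C := by
  simp only [nullT, star_low]
  simp

theorem ofReal_contr2 (T : Tensor3) (a b : Fin 4) :
    ((contr2 T a b : ℝ) : ℂ) = contrC (fun a b c => (T a b c : ℂ)) a b := by
  simp [contr2, contrC]

/-- The quadratic identity says that the matrix of null components has rank at most one. -/
theorem nullT_mul_nullT {T : Tensor3} (hT : IsSymm3 T) (htr : IsTraceFree T)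
    (hq : QuadraticIdentity T) (i j k A A' B B' C C' : Fin 2) :
    nullT (fun a b c => (T a b c : ℂ)) A A' B B' C C' *
        nullT (fun a b c => (T a b c : ℂ)) i i j j k k =
      nullT (fun a b c => (T a b c : ℂ)) A i B j C k *
        star (nullT (fun a b c => (T a b c : ℂ)) A' i B' j C' k) := by
  have hTc : IsSymm3 (fun a b c => (T a b c : ℂ)) := fun a b c =>
    ⟨congrArg _ (hT a b c).1, congrArg _ (hT a b c).2⟩
  obtain ⟨t, ht⟩ := exists_nullT_eq hTc (fun b => by exact_mod_cast htr b)
  have hq' : ∀ A A' B B' D D' E E' : Fin 2, quadDefect t A A' B B' D D' E E' = 0 := by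
    intro A A' B B' D D' E E'
    refine sub_eq_zero.2 (quadratic_null ht (fun a b d e => ?_) A A' B B' D D' E E')
    simp only [← ofReal_contr2]
    have := congrArg Complex.ofReal (hq a b d e)
    push_cast at this
    exact this
  rw [star_nullT, ht, ht, ht, ht]
  exact minor_eq hq' (by omega) (by omega) (by omega) (by omega)

/-- In a Hermitian matrix of rank at most one, the squared modulus of an entry is the product of two
diagonal entries. A zero diagonal therefore forces the matrix to vanish. -/
theorem exists_nullT_ne_zero {T : Tensor3} (hT : IsSymm3 T) (htr : IsTraceFree T)
    (hq : QuadraticIdentity T) (h0 : T ≠ 0) :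
    ∃ i j k, nullT (fun a b c => (T a b c : ℂ)) i i j j k k ≠ 0 := by
  by_contra! h
  refine h0 ?_
  have h1 : ∀ A i B j C k, nullT (fun a b c => (T a b c : ℂ)) A i B j C k = 0 := by
    intro A i B j C k
    have := nullT_mul_nullT hT htr hq i j k A A B B C C
    rw [h, h, mul_zero] at this
    simpa using this.symm
  ext a b c
  have := eq_sum_nullT (fun a b c => (T a b c : ℂ)) a b c
  simp only [h1, mul_zero, Finset.sum_const_zero] at this
  exact_mod_cast this

/-- A tensor satisfying the quadratic identity is, up to sign, a superenergy tensor. -/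
theorem superenergy_of_quadratic {T : Tensor3} (hT : IsSymm3 T) (htr : IsTraceFree T)
    (hq : QuadraticIdentity T) {i j k : Fin 2} {s d r : ℝ}
    (hd : nullT (fun a b c => (T a b c : ℂ)) i i j j k k = d) (hr : r ^ 2 = s * d) (hr0 : r ≠ 0)
    (hs : s ^ 2 = 1) (a b c : Fin 4) :
    ((s * T a b c : ℝ) : ℂ) = superenergy
      (fun A B C => nullT (fun a b c => (T a b c : ℂ)) A i B j C k / r) a b c := by
  -- The spinor is the column ijk of the rank one matrix, normalized by a square root r of the
  -- modulus s d of its diagonal entry.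
  have h : ∀ A A' B B' C C', s * nullT (fun a b c => (T a b c : ℂ)) A A' B B' C C' =
      nullT (fun a b c => (T a b c : ℂ)) A i B j C k / r *
        star (nullT (fun a b c => (T a b c : ℂ)) A' i B' j C' k / r) := by
    intro A A' B B' C C'
    have h1 := nullT_mul_nullT hT htr hq i j k A A' B B' C C'
    have hrc : (r : ℂ) ≠ 0 := by exact_mod_cast hr0
    have hr' : (r : ℂ) ^ 2 = s * d := by exact_mod_cast hr
    have hs' : (s : ℂ) ^ 2 = 1 := by exact_mod_cast hs
    rw [star_div₀, Complex.star_def, Complex.conj_ofReal, div_mul_div_comm, eq_div_iff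
      (mul_ne_zero hrc hrc), ← Complex.star_def, ← h1, hd]
    linear_combination (s * nullT (fun a b c => (T a b c : ℂ)) A A' B B' C C') * hr' +
      (d * nullT (fun a b c => (T a b c : ℂ)) A A' B B' C C') * hs'
  rw [Complex.ofReal_mul]
  have e := eq_sum_nullT (fun a b c => (T a b c : ℂ)) a b c
  rw [e, superenergy]
  simp only [Finset.mul_sum, mul_left_comm (s : ℂ), h]

theorem isSymm3_nullT {T : Tensor3} (hT : IsSymm3 T) (htr : IsTraceFree T) (i j k : Fin 2) :
    IsSymm3 (fun A B C => nullT (fun a b c => (T a b c : ℂ)) A i B j C k) := by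
  have hTc : IsSymm3 (fun a b c => (T a b c : ℂ)) := fun a b c =>
    ⟨congrArg _ (hT a b c).1, congrArg _ (hT a b c).2⟩
  obtain ⟨t, ht⟩ := exists_nullT_eq hTc (fun b => by exact_mod_cast htr b)
  intro A B C
  simp only [ht]
  exact ⟨by rw [add_comm (A : ℕ)], by rw [add_right_comm]⟩

theorem isSymm3_conjSpinor {Ψ : Spinor3} (hΨ : IsSymm3 Ψ) : IsSymm3 (conjSpinor Ψ) :=
  fun a b c => ⟨congrArg star (hΨ a b c).1, congrArg star (hΨ a b c).2⟩

theorem disc_conjSpinor (Ψ : Spinor3) : disc (conjSpinor Ψ) = star (disc Ψ) := by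
  simp [disc, hess, pol, conjSpinor]

theorem dDisc_conjSpinor (Ψ N : Spinor3) :
    dDisc (conjSpinor Ψ) (conjSpinor N) = star (dDisc Ψ N) := by
  simp [dDisc, dHess, hess, pol, conjSpinor]

/-- The contraction is quadratic in T, so the sign drops out. -/
theorem contrC_superenergy {T : Tensor3} {Ψ : Spinor3} {s : ℝ}
    (hs : s ^ 2 = 1) (h : ∀ a b c, ((s * T a b c : ℝ) : ℂ) = superenergy Ψ a b c) (a b : Fin 4) :
    contrC (bil Ψ (conjSpinor Ψ)) a b = contr2 T a b := by
  have h1 : ∀ a b c, (s * T a b c : ℂ) = bil Ψ (conjSpinor Ψ) a b c := fun a b c => by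
    rw [← Complex.ofReal_mul, h]; rfl
  have hs' : (s : ℂ) * s = 1 := by exact_mod_cast (sq s).symm.trans hs
  rw [ofReal_contr2]
  simp only [contrC, ← h1]
  refine Finset.sum_congr rfl fun j _ => Finset.sum_congr rfl fun k _ => ?_
  linear_combination (η j * η k * (T a j k * T b j k) : ℂ) * hs'

/-- A superenergy tensor satisfies the quadratic identity. -/
theorem quadraticIdentity_of_superenergy {T : Tensor3} {Ψ : Spinor3} (hΨ : IsSymm3 Ψ) {s : ℝ}
    (hs : s ^ 2 = 1) (h : ∀ a b c, ((s * T a b c : ℝ) : ℂ) = superenergy Ψ a b c) :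
    QuadraticIdentity T := by
  have h1 : ∀ a b c, (s * T a b c : ℂ) = bil Ψ (conjSpinor Ψ) a b c := fun a b c => by
    rw [← Complex.ofReal_mul, h]; rfl
  have hs' : (s : ℂ) * s = 1 := by exact_mod_cast (sq s).symm.trans hs
  intro a b d e
  have := quadratic_bil Ψ _ hΨ (isSymm3_conjSpinor hΨ) a b d e
  simp only [contrC_superenergy hs h] at this
  have h3 : ∑ j, (η j : ℂ) * (bil Ψ (conjSpinor Ψ) a b j * bil Ψ (conjSpinor Ψ) d e j) =
      ∑ j, (η j : ℂ) * (T a b j * T d e j) := by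
    refine Finset.sum_congr rfl fun j _ => ?_
    rw [← h1, ← h1]
    linear_combination (η j * (T a b j * T d e j) : ℂ) * hs'
  rw [h3] at this
  apply Complex.ofReal_injective
  push_cast
  exact this

/-- The quartic invariant of a superenergy tensor. -/
theorem quartic_of_superenergy {T : Tensor3} {Ψ : Spinor3} {s : ℝ}
    (hs : s ^ 2 = 1) (h : ∀ a b c, ((s * T a b c : ℝ) : ℂ) = superenergy Ψ a b c) :
    (quartic T : ℂ) = disc Ψ * star (disc Ψ) := by
  have h4 : ∀ a b F, sum4 a b F = up (fun B B' => up (fun A A' => F A A' B B') a) b := by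
    intro a b F
    simp only [sum4, up, Fin.sum_univ_two]; ring
  have h5 : (quartic T : ℂ) = ∑ a, ∑ b, (η a : ℂ) * η b * (contrC (bil Ψ (conjSpinor Ψ)) a b *
      contrC (bil Ψ (conjSpinor Ψ)) a b) := by
    simp only [contrC_superenergy hs h]
    simp [quartic]
  rw [h5, ← disc_conjSpinor]
  simp only [contrC_bil, h4]
  rw [sum_eta_eta_up_up (fun B B' A A' => hess Ψ A B * hess (conjSpinor Ψ) A' B')]
  simp only [disc, pol]
  ring

/-! ### Calculus of derivatives along the frame -/

namespace SpinFrame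

variable {M : Type*} [TopologicalSpace M] [ChartedSpace (EuclideanSpace ℝ (Fin 4)) M]
  [IsManifold (𝓡 4) ∞ M] (𝓔 : SpinFrame M) {a : Fin 4} {x : M}

/-- `f` is differentiable at `x`, with derivative `f'` along the frame vector `E_a`. -/
def HasD {F : Type*} [NormedAddCommGroup F] [NormedSpace ℝ F] (a : Fin 4) (f : M → F) (f' : F)
    (x : M) : Prop :=
  MDifferentiableAt (𝓡 4) 𝓘(ℝ, F) f x ∧ 𝓔.D a f x = f'

variable {𝓔}

section
variable {F G : Type*} [NormedAddCommGroup F] [NormedSpace ℝ F] [NormedAddCommGroup G]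
  [NormedSpace ℝ G]

theorem _root_.MDifferentiableAt.hasD {f : M → F} (hf : MDifferentiableAt (𝓡 4) 𝓘(ℝ, F) f x) :
    𝓔.HasD a f (𝓔.D a f x) x := ⟨hf, rfl⟩

theorem HasD.congr {f g : M → F} {f' : F} (hf : 𝓔.HasD a f f' x) (h : g =ᶠ[nhds x] f) :
    𝓔.HasD a g f' x :=
  ⟨hf.1.congr_of_eventuallyEq h, by rw [← hf.2, D, D, h.mfderiv_eq]; rfl⟩

theorem HasD.congr_deriv {f : M → F} {f' g' : F} (hf : 𝓔.HasD a f f' x) (h : f' = g') :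
    𝓔.HasD a f g' x := h ▸ hf

theorem HasD.comp {f : M → F} {f' : F} {g : F → G} {g' : F →L[ℝ] G} (hf : 𝓔.HasD a f f' x)
    (hg : HasFDerivAt g g' (f x)) : 𝓔.HasD a (fun y => g (f y)) (g' f') x := by
  have h := hg.hasMFDerivAt.comp x hf.1.hasMFDerivAt
  refine ⟨h.mdifferentiableAt, ?_⟩
  rw [← hf.2, D, D]
  change mfderiv (𝓡 4) 𝓘(ℝ, G) (g ∘ f) x (𝓔.E x a) = _
  rw [h.mfderiv]
  rfl

theorem HasD.clm (L : F →L[ℝ] G) {f : M → F} {f' : F} (hf : 𝓔.HasD a f f' x) :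
    𝓔.HasD a (fun y => L (f y)) (L f') x := hf.comp L.hasFDerivAt

theorem HasD.prodMk {f : M → F} {f' : F} {g : M → G} {g' : G} (hf : 𝓔.HasD a f f' x)
    (hg : 𝓔.HasD a g g' x) : 𝓔.HasD a (fun y => (f y, g y)) (f', g') x := by
  have h := (hf.1.prodMk_space hg.1).hasD (𝓔 := 𝓔) (a := a)
  exact h.congr_deriv (Prod.ext ((h.clm (ContinuousLinearMap.fst ℝ F G)).2.symm.trans hf.2)
    ((h.clm (ContinuousLinearMap.snd ℝ F G)).2.symm.trans hg.2))

theorem HasD.add {f g : M → F} {f' g' : F} (hf : 𝓔.HasD a f f' x)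
    (hg : 𝓔.HasD a g g' x) : 𝓔.HasD a (fun y => f y + g y) (f' + g') x :=
  (hf.prodMk hg).clm (ContinuousLinearMap.fst ℝ F F + ContinuousLinearMap.snd ℝ F F)

theorem HasD.sub {f g : M → F} {f' g' : F} (hf : 𝓔.HasD a f f' x)
    (hg : 𝓔.HasD a g g' x) : 𝓔.HasD a (fun y => f y - g y) (f' - g') x :=
  (hf.prodMk hg).clm (ContinuousLinearMap.fst ℝ F F - ContinuousLinearMap.snd ℝ F F)

theorem HasD.const (c : F) : 𝓔.HasD a (fun _ => c) 0 x := by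
  refine ⟨mdifferentiableAt_const, ?_⟩
  rw [D, mfderiv_const]; rfl

theorem HasD.sum {ι : Type*} (s : Finset ι) {f : ι → M → F} {f' : ι → F}
    (hf : ∀ i, 𝓔.HasD a (f i) (f' i) x) :
    𝓔.HasD a (fun y => ∑ i ∈ s, f i y) (∑ i ∈ s, f' i) x := by
  classical
  induction s using Finset.induction_on with
  | empty => simpa using HasD.const (𝓔 := 𝓔) (0 : F)
  | insert i s hi ih => simpa only [Finset.sum_insert hi] using (hf i).add ih

end

theorem HasD.mul {f g : M → ℂ} {f' g' : ℂ} (hf : 𝓔.HasD a f f' x)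
    (hg : 𝓔.HasD a g g' x) : 𝓔.HasD a (fun y => f y * g y) (f' * g x + f x * g') x := by
  refine ((hf.prodMk hg).comp
    ((hasFDerivAt_fst (𝕜 := ℝ) (p := (f x, g x))).mul hasFDerivAt_snd)).congr_deriv ?_
  change f x * g' + g x * f' = _
  ring

theorem HasD.const_mul (c : ℂ) {f : M → ℂ} {f' : ℂ} (hf : 𝓔.HasD a f f' x) :
    𝓔.HasD a (fun y => c * f y) (c * f') x := by
  simpa using (HasD.const c).mul hf

theorem HasD.star {f : M → ℂ} {f' : ℂ} (hf : 𝓔.HasD a f f' x) :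
    𝓔.HasD a (fun y => star (f y)) (star f') x := hf.clm (Complex.conjCLE : ℂ →L[ℝ] ℂ)

theorem HasD.ofReal {f : M → ℝ} {f' : ℝ} (hf : 𝓔.HasD a f f' x) :
    𝓔.HasD a (fun y => (f y : ℂ)) (f' : ℂ) x := hf.clm Complex.ofRealCLM

theorem HasD.apply {ι F : Type*} [Fintype ι] [NormedAddCommGroup F] [NormedSpace ℝ F]
    {f : M → ι → F} {f' : ι → F} (hf : 𝓔.HasD a f f' x) (i : ι) :
    𝓔.HasD a (fun y => f y i) (f' i) x := hf.clm (ContinuousLinearMap.proj i)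

theorem HasD.pol {f g : M → Fin 2 → Fin 2 → ℂ} {f' g' : Fin 2 → Fin 2 → ℂ}
    (hf : ∀ i j, 𝓔.HasD a (fun y => f y i j) (f' i j) x)
    (hg : ∀ i j, 𝓔.HasD a (fun y => g y i j) (g' i j) x) :
    𝓔.HasD a (fun y => pol (f y) (g y)) (pol f' (g x) + pol (f x) g') x := by
  refine ((((hf 0 0).mul (hg 1 1)).add ((hf 1 1).mul (hg 0 0))).sub ((hf 0 1).mul (hg 1 0)) |>.sub
    ((hf 1 0).mul (hg 0 1))).congr_deriv ?_
  simp only [Rainich.pol]; ring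

theorem HasD.hess {Ψ : M → Spinor3} {N : Spinor3} (h : 𝓔.HasD a Ψ N x) (A B : Fin 2) :
    𝓔.HasD a (fun y => hess (Ψ y) A B) (dHess (Ψ x) N A B) x :=
  HasD.pol (f := fun y => Ψ y A) (g := fun y => Ψ y B) (fun i j => ((h.apply A).apply i).apply j)
    (fun i j => ((h.apply B).apply i).apply j)

theorem HasD.disc {Ψ : M → Spinor3} {N : Spinor3} (h : 𝓔.HasD a Ψ N x) :
    𝓔.HasD a (fun y => disc (Ψ y)) (dDisc (Ψ x) N) x := by
  refine (HasD.pol (f := fun y => Rainich.hess (Ψ y)) (g := fun y => Rainich.hess (Ψ y))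
    (f' := dHess (Ψ x) N) (g' := dHess (Ψ x) N) h.hess h.hess).congr_deriv ?_
  simp only [dDisc, Rainich.pol]; ring

theorem HasD.superenergy {Ψ : M → Spinor3} {N : Spinor3} {f : Fin 4} (h : 𝓔.HasD f Ψ N x)
    (a b c : Fin 4) : 𝓔.HasD f (fun y => superenergy (Ψ y) a b c)
      (bil N (conjSpinor (Ψ x)) a b c + bil (Ψ x) (conjSpinor N) a b c) x := by
  have hΨ : ∀ A B C, 𝓔.HasD f (fun y => Ψ y A B C) (N A B C) x :=
    fun A B C => ((h.apply A).apply B).apply C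
  refine (HasD.sum Finset.univ fun A => HasD.sum Finset.univ fun B => HasD.sum Finset.univ fun C =>
    HasD.sum Finset.univ fun A' => HasD.sum Finset.univ fun B' => HasD.sum Finset.univ fun C' =>
    ((hΨ A B C).mul (hΨ A' B' C').star).const_mul
      (σUp a A A' * σUp b B B' * σUp c C C')).congr_deriv ?_
  simp only [bil, conjSpinor, mul_add, Finset.sum_add_distrib]

end SpinFrame

/-! ### The spinor connection -/

/-- The spinor connection matrix of an antisymmetric matrix. -/
def spinMatrix (G : Fin 4 → Fin 4 → ℝ) (B C : Fin 2) : ℂ :=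
  (1 / 2) * ∑ B', ∑ c, ∑ d, σUp c B B' * ((η c * G d c : ℝ) : ℂ) * σLow d C B'

/-- The isomorphism of the Lorentz Lie algebra with sl(2, ℂ), in components. -/
theorem spinMatrix_eq {G : Fin 4 → Fin 4 → ℝ} (hG : ∀ a b, G a b = -G b a) :
    spinMatrix G 0 0 = -G 0 3 / 2 - Complex.I * G 1 2 / 2 ∧
    spinMatrix G 1 1 = G 0 3 / 2 + Complex.I * G 1 2 / 2 ∧
    spinMatrix G 0 1 = -(G 0 1 + Complex.I * G 0 2) / 2 - (Complex.I * G 2 3 + G 1 3) / 2 ∧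
    spinMatrix G 1 0 = -(G 0 1 - Complex.I * G 0 2) / 2 - (Complex.I * G 2 3 - G 1 3) / 2 := by
  have h0 : ∀ a, G a a = 0 := fun a => by linarith [hG a a]
  have h1 := hG 1 0
  have h2 := hG 2 0
  have h3 := hG 3 0
  have h4 := hG 2 1
  have h5 := hG 3 1
  have h6 := hG 3 2
  refine ⟨?_, ?_, ?_, ?_⟩ <;>
  simp [spinMatrix, σLow, σUp, Fin.sum_univ_four, η, h0, h1, h2, h3, h4, h5, h6] <;> ring_nf <;>
  simp only [inv_sqrt_two_sq] <;> ring

theorem spinMatrix_trace {G : Fin 4 → Fin 4 → ℝ} (hG : ∀ a b, G a b = -G b a) :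
    spinMatrix G 1 1 = -spinMatrix G 0 0 := by
  rw [(spinMatrix_eq hG).1, (spinMatrix_eq hG).2.1]; ring

/-- The symbols `σ_a^{AA'}` are parallel. -/
theorem sum_mul_σUp {G : Fin 4 → Fin 4 → ℝ} (hG : ∀ a b, G a b = -G b a) (a : Fin 4)
    (A A' : Fin 2) :
    ∑ d, ((η d * G a d : ℝ) : ℂ) * σUp d A A' =
      ∑ B, (spinMatrix G A B * σUp a B A' + star (spinMatrix G A' B) * σUp a A B) := by
  have h0 : ∀ a, G a a = 0 := fun a => by linarith [hG a a]
  have h1 := hG 1 0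
  have h2 := hG 2 0
  have h3 := hG 3 0
  have h4 := hG 2 1
  have h5 := hG 3 1
  have h6 := hG 3 2
  have hc : (starRingEnd ℂ) 2 = 2 := map_ofNat _ 2
  obtain ⟨e1, e2, e3, e4⟩ := spinMatrix_eq hG
  fin_cases a <;> fin_cases A <;> fin_cases A' <;>
  simp [e1, e2, e3, e4, hc, σUp, Fin.sum_univ_four, η, h0, h1, h2, h3, h4, h5, h6] <;> ring_nf <;>
  (try simp only [Complex.I_sq]) <;> ring_nf

/-- The action of a matrix on the three indices of a spinor. -/
def spinAct (γ : Fin 2 → Fin 2 → ℂ) (Φ : Spinor3) : Spinor3 := fun A B C =>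
  ∑ D, γ D A * Φ D B C + ∑ D, γ D B * Φ A D C + ∑ D, γ D C * Φ A B D

/-- The tensor `Φ χ` evaluated on three vectors. -/
def bilAt (S₁ S₂ S₃ : Fin 2 → Fin 2 → ℂ) (Φ χ : Spinor3) : ℂ :=
  ∑ A, ∑ B, ∑ C, ∑ A', ∑ B', ∑ C', S₁ A A' * S₂ B B' * S₃ C C' * (Φ A B C * χ A' B' C')

theorem bil_eq_bilAt (Φ χ : Spinor3) (a b c : Fin 4) :
    bil Φ χ a b c = bilAt (fun A A' => σUp a A A') (fun A A' => σUp b A A')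
      (fun A A' => σUp c A A') Φ χ := rfl

theorem sum_mul_bilAt₁ (g : Fin 4 → ℂ) (S : Fin 4 → Fin 2 → Fin 2 → ℂ) (S₂ S₃ Φ χ) :
    ∑ d, g d * bilAt (S d) S₂ S₃ Φ χ = bilAt (fun A A' => ∑ d, g d * S d A A') S₂ S₃ Φ χ := by
  simp only [bilAt, Fin.sum_univ_four, Fin.sum_univ_two]; ring

theorem sum_mul_bilAt₂ (g : Fin 4 → ℂ) (S : Fin 4 → Fin 2 → Fin 2 → ℂ) (S₁ S₃ Φ χ) :
    ∑ d, g d * bilAt S₁ (S d) S₃ Φ χ = bilAt S₁ (fun A A' => ∑ d, g d * S d A A') S₃ Φ χ := by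
  simp only [bilAt, Fin.sum_univ_four, Fin.sum_univ_two]; ring

theorem sum_mul_bilAt₃ (g : Fin 4 → ℂ) (S : Fin 4 → Fin 2 → Fin 2 → ℂ) (S₁ S₂ Φ χ) :
    ∑ d, g d * bilAt S₁ S₂ (S d) Φ χ = bilAt S₁ S₂ (fun A A' => ∑ d, g d * S d A A') Φ χ := by
  simp only [bilAt, Fin.sum_univ_four, Fin.sum_univ_two]; ring

theorem bilAt_act (γ δ : Fin 2 → Fin 2 → ℂ) (S₁ S₂ S₃ : Fin 2 → Fin 2 → ℂ) (Φ χ : Spinor3) :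
    bilAt (fun A A' => ∑ B, (γ A B * S₁ B A' + δ A' B * S₁ A B)) S₂ S₃ Φ χ
    + bilAt S₁ (fun A A' => ∑ B, (γ A B * S₂ B A' + δ A' B * S₂ A B)) S₃ Φ χ
    + bilAt S₁ S₂ (fun A A' => ∑ B, (γ A B * S₃ B A' + δ A' B * S₃ A B)) Φ χ =
    bilAt S₁ S₂ S₃ (spinAct γ Φ) χ + bilAt S₁ S₂ S₃ Φ (spinAct δ χ) := by
  simp only [bilAt, spinAct, Fin.sum_univ_two]; ring

/-- The discriminant is invariant under SL(2, ℂ), so it is stationary along trace-free infinitesimal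
actions. -/
theorem dDisc_spinAct {γ : Fin 2 → Fin 2 → ℂ} (hγ : γ 1 1 = -γ 0 0) {Ψ : Spinor3}
    (hΨ : IsSymm3 Ψ) : dDisc Ψ (spinAct γ Ψ) = 0 := by
  have e1 := (hΨ 1 0 0).1
  have e2 := (hΨ 0 1 0).2
  have e3 := (hΨ 1 0 1).1
  have e4 := (hΨ 1 1 0).2
  simp only [dDisc, dHess, hess, pol, spinAct, Fin.sum_univ_two, hγ, e1, e2, e3, e4]
  ring

theorem conjSpinor_spinAct (γ : Fin 2 → Fin 2 → ℂ) (Φ : Spinor3) :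
    conjSpinor (spinAct γ Φ) = spinAct (fun A B => star (γ A B)) (conjSpinor Φ) := by
  ext A B C
  simp [conjSpinor, spinAct]

theorem isSymm3_spinAct {γ : Fin 2 → Fin 2 → ℂ} {Φ : Spinor3} (hΦ : IsSymm3 Φ) :
    IsSymm3 (spinAct γ Φ) := by
  intro A B C
  simp only [spinAct]
  constructor
  · simp only [(hΦ _ B C).1, fun D => (hΦ A D C).1, fun D => (hΦ A B D).1]
    rw [add_comm (∑ D, γ D A * _)]
  · simp only [fun D => (hΦ D B C).2, fun D => (hΦ A D C).2, fun D => (hΦ A B D).2]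
    rw [add_right_comm]

namespace SpinFrame

variable {M : Type*} [TopologicalSpace M] [ChartedSpace (EuclideanSpace ℝ (Fin 4)) M]
  [IsManifold (𝓡 4) ∞ M] {𝓔 : SpinFrame M} {x : M}

theorem spinΓ_eq (f : Fin 4) (B C : Fin 2) (x : M) :
    𝓔.spinΓ f B C x = spinMatrix (fun d c => 𝓔.ΓLow f d c x) B C := rfl

variable (𝓔) in
/-- The covariant derivative of a spinor field along a frame vector, as a spinor. -/
def covSpinor (Ψ : M → Spinor3) (x : M) (f : Fin 4) : Spinor3 :=
  fun A B C => 𝓔.nablaSpinor Ψ f A B C x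

theorem covSpinor_eq {Ψ : M → Spinor3} {f : Fin 4} {N : Spinor3} (h : 𝓔.HasD f Ψ N x) :
    𝓔.covSpinor Ψ x f = N - spinAct (fun B C => 𝓔.spinΓ f B C x) (Ψ x) := by
  ext A B C
  have := (((h.apply A).apply B).apply C).2
  simp only [covSpinor, nablaSpinor, this, Pi.sub_apply, spinAct]
  ring

theorem HasD.isSymm3 {Ψ : M → Spinor3} {f : Fin 4} {N : Spinor3} (h : 𝓔.HasD f Ψ N x)
    (hΨ : ∀ᶠ y in nhds x, IsSymm3 (Ψ y)) : IsSymm3 N := by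
  intro A B C
  have h0 : ∀ A B C, 𝓔.HasD f (fun y => Ψ y A B C) (N A B C) x :=
    fun A B C => ((h.apply A).apply B).apply C
  exact ⟨(h0 A B C).2.symm.trans ((h0 B A C).congr (hΨ.mono fun y hy => (hy A B C).1)).2,
    (h0 A B C).2.symm.trans ((h0 A C B).congr (hΨ.mono fun y hy => (hy A B C).2)).2⟩

theorem isSymm3_covSpinor {Ψ : M → Spinor3} (h : MDifferentiableAt (𝓡 4) 𝓘(ℝ, Spinor3) Ψ x)
    (hΨ : ∀ᶠ y in nhds x, IsSymm3 (Ψ y)) (f : Fin 4) : IsSymm3 (𝓔.covSpinor Ψ x f) := by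
  rw [covSpinor_eq (h.hasD (a := f))]
  have h1 := (h.hasD (𝓔 := 𝓔) (a := f)).isSymm3 hΨ
  have h2 := isSymm3_spinAct (γ := fun B C => 𝓔.spinΓ f B C x) hΨ.self_of_nhds
  intro A B C
  simp only [Pi.sub_apply]
  exact ⟨by rw [(h1 A B C).1, (h2 A B C).1], by rw [(h1 A B C).2, (h2 A B C).2]⟩

/-- The discriminant is a scalar: the connection terms act by a trace-free matrix and drop out. -/
theorem dDisc_covSpinor {Ψ : M → Spinor3} (h : MDifferentiableAt (𝓡 4) 𝓘(ℝ, Spinor3) Ψ x)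
    (hΨ : IsSymm3 (Ψ x)) (f : Fin 4) :
    dDisc (Ψ x) (𝓔.covSpinor Ψ x f) = 𝓔.D f (fun y => disc (Ψ y)) x := by
  have h1 := h.hasD (𝓔 := 𝓔) (a := f)
  rw [covSpinor_eq h1, h1.disc.2]
  have h2 : ∀ N N', dDisc (Ψ x) (N - N') = dDisc (Ψ x) N - dDisc (Ψ x) N' := by
    intro N N'
    simp only [dDisc, dHess, pol, Pi.sub_apply]; ring
  rw [h2, dDisc_spinAct _ hΨ, sub_zero]
  exact spinMatrix_trace fun a b => 𝓔.ΓLow_antisymm f a b x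

/-- As the symbols σ are parallel (`sum_mul_σUp`), the connection on tensor indices can be moved
onto the two spinor factors. -/
theorem bil_conn (f : Fin 4) (Φ : Spinor3) (a b c : Fin 4) :
    ∑ d, (𝓔.Γ f d a x : ℂ) * bil Φ (conjSpinor Φ) d b c
      + ∑ d, (𝓔.Γ f d b x : ℂ) * bil Φ (conjSpinor Φ) a d c
      + ∑ d, (𝓔.Γ f d c x : ℂ) * bil Φ (conjSpinor Φ) a b d =
    bil (spinAct (fun B C => 𝓔.spinΓ f B C x) Φ) (conjSpinor Φ) a b c
    + bil Φ (conjSpinor (spinAct (fun B C => 𝓔.spinΓ f B C x) Φ)) a b c := by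
  have hG := fun a b => 𝓔.ΓLow_antisymm f a b x
  have h := fun a => sum_mul_σUp hG a
  simp only [bil_eq_bilAt, sum_mul_bilAt₁, sum_mul_bilAt₂, sum_mul_bilAt₃]
  rw [conjSpinor_spinAct, ← bilAt_act]
  simp only [Γ, h, spinΓ_eq]

/-- The covariant derivative of a superenergy tensor. -/
theorem nabla3_superenergy {T : M → Tensor3} {Ψ : M → Spinor3} {s : ℝ}
    (hT : MDifferentiableAt (𝓡 4) 𝓘(ℝ, Tensor3) T x)
    (hΨ : MDifferentiableAt (𝓡 4) 𝓘(ℝ, Spinor3) Ψ x)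
    (h : ∀ᶠ y in nhds x, ∀ a b c, ((s * T y a b c : ℝ) : ℂ) = superenergy (Ψ y) a b c)
    (f a b c : Fin 4) :
    ((s * 𝓔.nabla3 T f a b c x : ℝ) : ℂ) =
      bil (𝓔.covSpinor Ψ x f) (conjSpinor (Ψ x)) a b c
      + bil (Ψ x) (conjSpinor (𝓔.covSpinor Ψ x f)) a b c := by
  have h1 := hΨ.hasD (𝓔 := 𝓔) (a := f)
  have h2 := (h1.superenergy a b c).congr (h.mono fun y hy => hy a b c)
  have h3 := ((((hT.hasD (𝓔 := 𝓔) (a := f)).apply a).apply b).apply c).ofReal.const_mul (s : ℂ)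
  have h4 := ((((hT.hasD (𝓔 := 𝓔) (a := f)).apply a).apply b).apply c).2
  have h5 : (s : ℂ) * (𝓔.D f T x a b c : ℂ) = _ := h3.2.symm.trans
    (by simpa only [Complex.ofReal_mul] using h2.2)
  have h6 := h.self_of_nhds
  have h7 : ∀ a b c, (s : ℂ) * T x a b c = bil (Ψ x) (conjSpinor (Ψ x)) a b c := by
    intro a b c
    rw [← Complex.ofReal_mul, h6]; rfl
  have h8 := bil_conn (𝓔 := 𝓔) (x := x) f (Ψ x) a b c
  simp only [← h7] at h8
  have h9 : ∀ N N' a b c, bil (N - N') (conjSpinor (Ψ x)) a b c =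
      bil N (conjSpinor (Ψ x)) a b c - bil N' (conjSpinor (Ψ x)) a b c := by
    intro N N' a b c
    simp only [bil, Pi.sub_apply, sub_mul, mul_sub, Finset.sum_sub_distrib]
  have h10 : ∀ N N' a b c, bil (Ψ x) (conjSpinor (N - N')) a b c =
      bil (Ψ x) (conjSpinor N) a b c - bil (Ψ x) (conjSpinor N') a b c := by
    intro N N' a b c
    simp only [bil, conjSpinor, Pi.sub_apply, star_sub, mul_sub, Finset.sum_sub_distrib]
  rw [covSpinor_eq h1, h9, h10]
  have e : bil (𝓔.D f Ψ x) (conjSpinor (Ψ x)) a b c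
      - bil (spinAct (fun B C => 𝓔.spinΓ f B C x) (Ψ x)) (conjSpinor (Ψ x)) a b c
      + (bil (Ψ x) (conjSpinor (𝓔.D f Ψ x)) a b c
      - bil (Ψ x) (conjSpinor (spinAct (fun B C => 𝓔.spinΓ f B C x) (Ψ x))) a b c) =
      (s : ℂ) * (𝓔.D f T x a b c : ℂ) - (∑ d, (𝓔.Γ f d a x : ℂ) * ((s : ℂ) * T x d b c)
      + ∑ d, (𝓔.Γ f d b x : ℂ) * ((s : ℂ) * T x a d c)
      + ∑ d, (𝓔.Γ f d c x : ℂ) * ((s : ℂ) * T x a b d)) := by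
    rw [h8, h5]; ring
  rw [e, nabla3, h4]
  push_cast
  simp only [mul_sub, Finset.mul_sum, mul_left_comm (s : ℂ)]
  ring

end SpinFrame

namespace SpinFrame

variable {M : Type*} [TopologicalSpace M] [ChartedSpace (EuclideanSpace ℝ (Fin 4)) M]
  [IsManifold (𝓡 4) ∞ M] {𝓔 : SpinFrame M} {x : M}

/-- The tensor and its derivative enter the numerator four times in all, so the sign s cancels;
multiplying by the quartic scalar clears the denominator of S. -/
theorem numer_superenergy {T : M → Tensor3} {Ψ : M → Spinor3} {s : ℝ} (hs : s ^ 2 = 1)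
    (hT : MDifferentiableAt (𝓡 4) 𝓘(ℝ, Tensor3) T x)
    (hΨ : MDifferentiableAt (𝓡 4) 𝓘(ℝ, Spinor3) Ψ x)
    (h : ∀ᶠ y in nhds x, ∀ a b c, ((s * T y a b c : ℝ) : ℂ) = superenergy (Ψ y) a b c)
    (hne : quartic (T x) ≠ 0) (k : Fin 4) :
    numer (Ψ x) (conjSpinor (Ψ x)) (𝓔.covSpinor Ψ x)
      (fun f => conjSpinor (𝓔.covSpinor Ψ x f)) k = (quartic (T x) * 𝓔.SLow T x k : ℝ) := by
  have h1 := contrC_superenergy hs h.self_of_nhds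
  have h2 : ∀ a b c, bil (Ψ x) (conjSpinor (Ψ x)) a b c = ((s * T x a b c : ℝ) : ℂ) :=
    fun a b c => (h.self_of_nhds a b c).symm
  have h3 := nabla3_superenergy (𝓔 := 𝓔) hT hΨ h
  have h4 : ∀ u v : ℝ, (s * u) * (s * v) = u * v := fun u v => by linear_combination u * v * hs
  simp only [contrC] at h1
  simp only [numer, h1, ← h3]
  simp only [h2]
  simp only [← Complex.ofReal_mul, ← Complex.ofReal_sum, h4]
  congr 1
  rw [SLow, SUp, mul_left_comm, mul_div_cancel₀ _ hne]
  congr 1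
  refine Finset.sum_congr rfl fun a _ => Finset.sum_congr rfl fun e _ =>
    Finset.sum_congr rfl fun f _ => ?_
  rw [Finset.mul_sum]
  refine Finset.sum_congr rfl fun b _ => ?_
  simp only [Finset.mul_sum]
  refine Finset.sum_congr rfl fun c _ => Finset.sum_congr rfl fun d _ => ?_
  ring

/-- Given the algebraic structure of a divergence-free `T`, the massless equation says that `S` is
a quarter of the gradient of the argument of the discriminant of the spinor. -/
theorem masslessAt_iff {T : M → Tensor3} {Ψ : M → Spinor3} {s : ℝ} (hs : s ^ 2 = 1)
    (hT : MDifferentiableAt (𝓡 4) 𝓘(ℝ, Tensor3) T x)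
    (hΨ : MDifferentiableAt (𝓡 4) 𝓘(ℝ, Spinor3) Ψ x)
    (hsymm : ∀ᶠ y in nhds x, IsSymm3 (Ψ y))
    (h : ∀ᶠ y in nhds x, ∀ a b c, ((s * T y a b c : ℝ) : ℂ) = superenergy (Ψ y) a b c)
    (hdiv : ∀ b c, ∑ a, η a * 𝓔.nabla3 T a a b c x = 0) (hne : quartic (T x) ≠ 0) :
    𝓔.MasslessAt Ψ x ↔
      ∀ k, 𝓔.SLow T x k = 1 / 4 * (𝓔.D k (fun y => disc (Ψ y)) x / disc (Ψ x)).im := by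
  have hq := quartic_of_superenergy hs h.self_of_nhds
  have hd : disc (Ψ x) ≠ 0 := fun h0 => hne (by simpa [h0] using hq)
  have hsym := isSymm3_covSpinor (𝓔 := 𝓔) hΨ hsymm
  have h3 := nabla3_superenergy (𝓔 := 𝓔) hT hΨ h
  refine (massless_iff_numer (Ψ x) (conjSpinor (Ψ x)) hsymm.self_of_nhds
    (isSymm3_conjSpinor hsymm.self_of_nhds) (𝓔.covSpinor Ψ x)
    (fun f => conjSpinor (𝓔.covSpinor Ψ x f)) hsym (fun f => isSymm3_conjSpinor (hsym f)) hd
    (by rw [disc_conjSpinor]; simpa using hd) fun b c => ?_).trans (forall_congr' fun k => ?_)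
  · simp only [← h3]
    have := congrArg (fun r : ℝ => ((s * r : ℝ) : ℂ)) (hdiv b c)
    simp only [Finset.mul_sum, Complex.ofReal_sum, mul_zero, Complex.ofReal_zero] at this
    rw [← this]
    refine Finset.sum_congr rfl fun a _ => ?_
    push_cast; ring
  · rw [numer_superenergy hs hT hΨ h hne, disc_conjSpinor, dDisc_conjSpinor,
      dDisc_covSpinor hΨ hsymm.self_of_nhds]
    set z := disc (Ψ x)
    set w := 𝓔.D k (fun y => disc (Ψ y)) x
    -- The bracket is 2i Im(z̄w), which gives the factor 1/4. Dividing by |z|², the quartic scalar,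
    -- turns z̄w into w/z.
    have e1 : -(Complex.I / 8) * (star z * w - z * star w) =
        ((1 / 4 * (star z * w).im : ℝ) : ℂ) := by
      apply Complex.ext <;> simp <;> ring
    have e2 : (star z * w).im = quartic (T x) * (w / z).im := by
      have : star z * w = quartic (T x) * (w / z) := by
        rw [hq]; field_simp
      rw [this, Complex.im_ofReal_mul]
    rw [e1, e2, Complex.ofReal_inj, mul_left_comm, mul_right_inj' hne]

end SpinFrame

/-! ### Lie brackets in a chart and smoothness of the connection -/

namespace SpinFrame

variable {M : Type*} [TopologicalSpace M] [ChartedSpace (EuclideanSpace ℝ (Fin 4)) M]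
  [IsManifold (𝓡 4) ∞ M] {𝓔 : SpinFrame M} {x : M}

/-- The derivative is the fibre component of the tangent map of f composed with the smooth section
`E a`. -/
theorem contMDiffOn_D {F : Type*} [NormedAddCommGroup F] [NormedSpace ℝ F] {s : Set M}
    (hs : IsOpen s) {f : M → F} (hf : ContMDiffOn (𝓡 4) 𝓘(ℝ, F) ∞ f s) (a : Fin 4) :
    ContMDiffOn (𝓡 4) 𝓘(ℝ, F) ∞ (𝓔.D a f) s := by
  have h1 := hf.contMDiffOn_tangentMapWithin (m := ∞) (by simp) hs.uniqueMDiffOn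
  have h2 := h1.comp (𝓔.smooth a).contMDiffOn (s := s) fun x hx => hx
  refine ((contMDiff_snd_tangentBundle_modelSpace F 𝓘(ℝ, F) (n := ∞)).comp_contMDiffOn
    h2).congr fun x hx => ?_
  rw [D, ← mfderivWithin_of_isOpen hs hx]
  rfl

variable (𝓔) in
/-- The frame vector `E_a` read in the chart at `p`. -/
def X (p : M) (a : Fin 4) (x : M) : EuclideanSpace ℝ (Fin 4) := 𝓔.D a (extChartAt (𝓡 4) p) x

theorem contMDiffOn_X (p : M) (a : Fin 4) :
    ContMDiffOn (𝓡 4) 𝓘(ℝ, EuclideanSpace ℝ (Fin 4)) ∞ (𝓔.X p a) (extChartAt (𝓡 4) p).source := by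
  refine contMDiffOn_D (isOpen_extChartAt_source p) ?_ a
  rw [extChartAt_source]
  exact contMDiffOn_extChartAt

theorem hasD_comp_chart {F : Type*} [NormedAddCommGroup F] [NormedSpace ℝ F] {p : M}
    (hx : x ∈ (extChartAt (𝓡 4) p).source) {g : EuclideanSpace ℝ (Fin 4) → F}
    (hg : DifferentiableAt ℝ g (extChartAt (𝓡 4) p x)) (a : Fin 4) :
    𝓔.HasD a (fun y => g (extChartAt (𝓡 4) p y)) (fderiv ℝ g (extChartAt (𝓡 4) p x) (𝓔.X p a x))
      x := by
  refine HasD.comp ?_ hg.hasFDerivAt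
  exact (mdifferentiableAt_extChartAt (by rwa [extChartAt_source] at hx)).hasD

theorem mfderiv_bracket (x : M) (a b : Fin 4) :
    mfderiv (𝓡 4) 𝓘(ℝ, EuclideanSpace ℝ (Fin 4)) (extChartAt (𝓡 4) x) x (𝓔.bracket a b x) =
      𝓔.D a (𝓔.X x b) x - 𝓔.D b (𝓔.X x a) x := by
  set φ := extChartAt (𝓡 4) x
  have hx : x ∈ φ.source := mem_extChartAt_source x
  let V : Fin 4 → EuclideanSpace ℝ (Fin 4) → EuclideanSpace ℝ (Fin 4) := fun a =>
    VectorField.mpullbackWithin 𝓘(ℝ, EuclideanSpace ℝ (Fin 4)) (𝓡 4) φ.symm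
      (fun y => 𝓔.E y a) (Set.range (𝓡 4))
  have hV' : ∀ a, ∀ z ∈ φ.target, V a z = 𝓔.X x a (φ.symm z) := by
    intro a z hz
    refine ((isInvertible_mfderivWithin_extChartAt_symm hz).inverse_apply_eq).2 ?_
    exact (DFunLike.congr_fun (mfderivWithin_extChartAt_symm_comp_mfderiv_extChartAt hz)
      (𝓔.E (φ.symm z) a)).symm
  have hV : ∀ a, ∀ y ∈ φ.source, V a (φ y) = 𝓔.X x a y := fun a y hy => by
    rw [hV' a _ (φ.map_source hy), φ.left_inv hy]
  have hd : ∀ a, DifferentiableAt ℝ (V a) (φ x) := by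
    intro a
    have := MDifferentiableWithinAt.differentiableWithinAt_mpullbackWithin_vectorField
      (((𝓔.smooth a).mdifferentiable (by simp)).mdifferentiableAt (x := x)).mdifferentiableWithinAt
      (s := Set.univ)
    have e : (φ.symm ⁻¹' Set.univ ∩ Set.range (𝓡 4)) = Set.univ := by simp
    rw [e] at this
    exact differentiableWithinAt_univ.1 this
  have hD : ∀ a b, 𝓔.D a (𝓔.X x b) x = fderiv ℝ (V b) (φ x) (𝓔.X x a x) := by
    intro a b
    have := (hasD_comp_chart (𝓔 := 𝓔) hx (hd b) a).congr (g := 𝓔.X x b)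
      (Filter.eventuallyEq_of_mem ((isOpen_extChartAt_source x).mem_nhds hx)
        fun y hy => (hV b y hy).symm)
    exact this.2
  have e : VectorField.lieBracketWithin ℝ (V a) (V b)
      (φ.symm ⁻¹' Set.univ ∩ Set.range (𝓡 4)) (φ x) =
      fderiv ℝ (V b) (φ x) (𝓔.X x a x) - fderiv ℝ (V a) (φ x) (𝓔.X x b x) := by
    rw [Set.preimage_univ, Set.univ_inter, ModelWithCorners.range_eq_univ,
      VectorField.lieBracketWithin_univ, VectorField.lieBracket, hV a x hx, hV b x hx]
  rw [hD, hD, ← e]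
  exact (isInvertible_mfderiv_extChartAt (I := 𝓡 4) hx).self_apply_inverse _

/-- In a chart the second derivatives of f cancel by symmetry. What remains is df applied to the
antisymmetrized derivative of the frame, which is the bracket by `mfderiv_bracket`. -/
theorem D_comm {F : Type*} [NormedAddCommGroup F] [NormedSpace ℝ F] {s : Set M}
    (hs : IsOpen s) {f : M → F} (hf : ContMDiffOn (𝓡 4) 𝓘(ℝ, F) ∞ f s) (hx : x ∈ s)
    (a b : Fin 4) : 𝓔.D a (𝓔.D b f) x - 𝓔.D b (𝓔.D a f) x =
      mfderiv (𝓡 4) 𝓘(ℝ, F) f x (𝓔.bracket a b x) := by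
  set φ := extChartAt (𝓡 4) x
  have hxs : x ∈ φ.source := mem_extChartAt_source x
  set g : EuclideanSpace ℝ (Fin 4) → F := fun y => f (φ.symm y)
  have hfg : ∀ y ∈ φ.source, f y = g (φ y) := fun y hy => by simp only [g, φ.left_inv hy]
  have hg : ContDiffAt ℝ ∞ g (φ x) := by
    have h1 := (hf.contMDiffAt (hs.mem_nhds hx))
    have h2 := contMDiffAt_iff.1 h1
    rw [ModelWithCorners.range_eq_univ, contDiffWithinAt_univ] at h2
    exact h2.2
  have hloc : ∀ᶠ y in nhds x, y ∈ φ.source ∧ DifferentiableAt ℝ g (φ y) := by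
    have h1 : ∀ᶠ z in nhds (φ x), DifferentiableAt ℝ g z :=
      ((hg.of_le (m := 1) (by simp)).eventually (by simp)).mono fun z hz =>
        hz.differentiableAt (by simp)
    exact Filter.Eventually.and ((isOpen_extChartAt_source x).mem_nhds hxs)
      ((continuousAt_extChartAt (I := 𝓡 4) x).eventually h1)
  have h1 : ∀ a, 𝓔.D a f =ᶠ[nhds x] fun y => fderiv ℝ g (φ y) (𝓔.X x a y) := by
    intro a
    filter_upwards [hloc] with y hy
    exact ((hasD_comp_chart (𝓔 := 𝓔) hy.1 hy.2 a).congr (Filter.eventuallyEq_of_mem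
      ((isOpen_extChartAt_source x).mem_nhds hy.1) hfg)).2
  have hX : ∀ a, MDifferentiableAt (𝓡 4) 𝓘(ℝ, EuclideanSpace ℝ (Fin 4)) (𝓔.X x a) x := fun a =>
    ((contMDiffOn_X x a).contMDiffAt ((isOpen_extChartAt_source x).mem_nhds hxs)).mdifferentiableAt
      (by simp)
  have hdg : DifferentiableAt ℝ (fderiv ℝ g) (φ x) :=
    (hg.fderiv_right (m := 1) (WithTop.coe_le_coe.2 le_top)).differentiableAt (by simp)
  have h2 : ∀ a b, 𝓔.D b (𝓔.D a f) x = fderiv ℝ (fderiv ℝ g) (φ x) (𝓔.X x b x) (𝓔.X x a x)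
      + fderiv ℝ g (φ x) (𝓔.D b (𝓔.X x a) x) := by
    intro a b
    have h3 := ((hasD_comp_chart (𝓔 := 𝓔) hxs hdg b).prodMk ((hX a).hasD (𝓔 := 𝓔) (a := b))).comp
      (isBoundedBilinearMap_apply.hasFDerivAt (𝕜 := ℝ) (fderiv ℝ g (φ x), 𝓔.X x a x))
    have h4 := (h3.congr (h1 a)).2
    rw [h4]
    exact add_comm _ _
  have hmin : minSmoothness ℝ 2 ≤ (∞ : WithTop ℕ∞) := by
    rw [minSmoothness_of_isRCLikeNormedField]
    exact WithTop.coe_le_coe.2 le_top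
  have hsym : fderiv ℝ (fderiv ℝ g) (φ x) (𝓔.X x a x) (𝓔.X x b x) =
      fderiv ℝ (fderiv ℝ g) (φ x) (𝓔.X x b x) (𝓔.X x a x) :=
    (hg.isSymmSndFDerivAt hmin).eq _ _
  rw [h2, h2, hsym, add_sub_add_left_eq_sub, ← map_sub, ← mfderiv_bracket]
  have h5 : HasMFDerivAt (𝓡 4) 𝓘(ℝ, F) (fun y => g (φ y)) x _ :=
    (hg.differentiableAt (by simp)).hasFDerivAt.hasMFDerivAt.comp x
    (mdifferentiableAt_extChartAt (I := 𝓡 4) (mem_chart_source _ x)).hasMFDerivAt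
  rw [Filter.EventuallyEq.mfderiv_eq (Filter.eventuallyEq_of_mem
      ((isOpen_extChartAt_source x).mem_nhds hxs) hfg), h5.mfderiv]
  rfl

end SpinFrame

namespace SpinFrame

variable {M : Type*} [TopologicalSpace M] [ChartedSpace (EuclideanSpace ℝ (Fin 4)) M]
  [IsManifold (𝓡 4) ∞ M] {𝓔 : SpinFrame M} {x : M}

theorem mfderiv_eq_sum {F : Type*} [NormedAddCommGroup F] [NormedSpace ℝ F] (f : M → F)
    (v : TangentSpace (𝓡 4) x) :
    mfderiv (𝓡 4) 𝓘(ℝ, F) f x v = ∑ a, (𝓔.E x).repr v a • 𝓔.D a f x := by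
  conv_lhs => rw [← (𝓔.E x).sum_repr v, map_sum]
  exact Finset.sum_congr rfl fun a _ => map_smul _ _ _

variable (𝓔) in
/-- The structure functions `[E_a, E_b] = c_{ab}^d E_d`. -/
def struct (a b d : Fin 4) (x : M) : ℝ := (𝓔.E x).repr (𝓔.bracket a b x) d

variable (𝓔) in
/-- The matrix of the frame in the chart at `p`. -/
def frameMap (p x : M) : (Fin 4 → ℝ) →L[ℝ] EuclideanSpace ℝ (Fin 4) :=
  ∑ a, (ContinuousLinearMap.proj a : (Fin 4 → ℝ) →L[ℝ] ℝ).smulRight (𝓔.X p a x)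

theorem frameMap_apply (p x : M) (c : Fin 4 → ℝ) : 𝓔.frameMap p x c = ∑ a, c a • 𝓔.X p a x := by
  simp [frameMap]

theorem frameMap_isInvertible {p : M} (hx : x ∈ (extChartAt (𝓡 4) p).source) :
    (𝓔.frameMap p x).IsInvertible := by
  obtain ⟨e, he⟩ := isInvertible_mfderiv_extChartAt (I := 𝓡 4) hx
  have : T2Space (TangentSpace (𝓡 4) x) := inferInstanceAs (T2Space (EuclideanSpace ℝ (Fin 4)))
  refine ⟨(𝓔.E x).equivFun.symm.toContinuousLinearEquiv.trans e, ?_⟩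
  ext1 c
  rw [frameMap_apply]
  have h1 : ((𝓔.E x).equivFun.symm.toContinuousLinearEquiv.trans e) c =
    mfderiv (𝓡 4) 𝓘(ℝ, EuclideanSpace ℝ (Fin 4)) (extChartAt (𝓡 4) p) x
      ((𝓔.E x).equivFun.symm c) := by
    rw [← he]; rfl
  refine h1.trans ((mfderiv_eq_sum (𝓔 := 𝓔) _ _).trans ?_)
  refine Finset.sum_congr rfl fun a _ => ?_
  rw [← (𝓔.E x).equivFun_apply, LinearEquiv.apply_symm_apply]
  rfl

theorem contMDiffOn_frameMap_inverse (p : M) :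
    ContMDiffOn (𝓡 4) 𝓘(ℝ, EuclideanSpace ℝ (Fin 4) →L[ℝ] (Fin 4 → ℝ)) ∞
      (fun x => (𝓔.frameMap p x).inverse) (extChartAt (𝓡 4) p).source := by
  have h1 : ContMDiffOn (𝓡 4) 𝓘(ℝ, Fin 4 → EuclideanSpace ℝ (Fin 4)) ∞
      (fun x a => 𝓔.X p a x) (extChartAt (𝓡 4) p).source :=
    contMDiffOn_pi_space.2 fun a => contMDiffOn_X p a
  have h2 : ContDiff ℝ ∞ fun v : Fin 4 → EuclideanSpace ℝ (Fin 4) =>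
      ∑ a, (ContinuousLinearMap.proj a : (Fin 4 → ℝ) →L[ℝ] ℝ).smulRight (v a) := by
    fun_prop
  have h3 : ContMDiffOn (𝓡 4) 𝓘(ℝ, (Fin 4 → ℝ) →L[ℝ] EuclideanSpace ℝ (Fin 4)) ∞
      (fun x => 𝓔.frameMap p x) (extChartAt (𝓡 4) p).source := h2.contMDiff.comp_contMDiffOn h1
  intro x hx
  obtain ⟨e, he⟩ := frameMap_isInvertible (𝓔 := 𝓔) hx
  have h4 := (contDiffAt_map_inverse (n := ∞) e).contMDiffAt
  rw [he] at h4
  exact h4.comp_contMDiffWithinAt x (h3 x hx)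

theorem sum_struct_smul_X {p : M} (hx : x ∈ (extChartAt (𝓡 4) p).source) (a b : Fin 4) :
    ∑ d, 𝓔.struct a b d x • 𝓔.X p d x = 𝓔.D a (𝓔.X p b) x - 𝓔.D b (𝓔.X p a) x := by
  have h := D_comm (𝓔 := 𝓔) (isOpen_extChartAt_source (I := 𝓡 4) p) (f := extChartAt (𝓡 4) p)
    (by rw [extChartAt_source]; exact contMDiffOn_extChartAt) hx a b
  exact ((h.trans (mfderiv_eq_sum (𝓔 := 𝓔) _ _))).symm

/-- In a chart these are the coordinates of a smooth vector function in a smooth frame, and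
inversion of the frame matrix is smooth. -/
theorem contMDiff_struct (a b d : Fin 4) : ContMDiff (𝓡 4) 𝓘(ℝ, ℝ) ∞ (𝓔.struct a b d) := by
  intro p
  have hp : (extChartAt (𝓡 4) p).source ∈ nhds p := extChartAt_source_mem_nhds p
  have hs := isOpen_extChartAt_source (I := 𝓡 4) p
  have h1 := (contMDiffOn_frameMap_inverse (𝓔 := 𝓔) p).clm_apply
    ((contMDiffOn_D (𝓔 := 𝓔) hs (contMDiffOn_X (𝓔 := 𝓔) p b) a).sub
      (contMDiffOn_D (𝓔 := 𝓔) hs (contMDiffOn_X (𝓔 := 𝓔) p a) b))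
  refine ((contMDiffOn_pi_space.1 h1 d).congr fun x hx => ?_).contMDiffAt hp
  have h2 : (𝓔.frameMap p x).inverse (𝓔.D a (𝓔.X p b) x - 𝓔.D b (𝓔.X p a) x) =
      fun d => 𝓔.struct a b d x := by
    rw [(frameMap_isInvertible hx).inverse_apply_eq, frameMap_apply, sum_struct_smul_X hx]
  exact (congrFun h2 d).symm

theorem η_mul_self (a : Fin 4) : η a * η a = 1 := by
  unfold η; split_ifs <;> norm_num

theorem metric_bracket (a b c : Fin 4) (x : M) :
    𝓔.metric x (𝓔.bracket a b x) (𝓔.E x c) = η c * 𝓔.struct a b c x := by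
  simp [metric, struct, Finsupp.single_apply]

theorem contMDiff_Γ (a c b : Fin 4) : ContMDiff (𝓡 4) 𝓘(ℝ, ℝ) ∞ (𝓔.Γ a c b) := by
  have h : 𝓔.Γ a c b = fun x => η c * (1 / 2 * (η c * 𝓔.struct a b c x - η a * 𝓔.struct b c a x
      + η b * 𝓔.struct c a b x)) := by
    ext x
    simp only [Γ, ΓLow, metric_bracket]
  rw [h]
  have h0 := contMDiff_struct (𝓔 := 𝓔)
  exact contMDiff_const.mul (contMDiff_const.mul (((contMDiff_const.mul (h0 a b c)).sub
    (contMDiff_const.mul (h0 b c a))).add (contMDiff_const.mul (h0 c a b))))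

/-- Absence of torsion turns the antisymmetrized covariant derivative into the exterior derivative,
written in the frame. -/
theorem nabla1_sub_nabla1 (S : M → Fin 4 → ℝ) (a b : Fin 4) (x : M) :
    𝓔.nabla1 S a b x - 𝓔.nabla1 S b a x = 𝓔.D a (fun y => S y b) x - 𝓔.D b (fun y => S y a) x
      - ∑ d, 𝓔.struct a b d x * S x d := by
  have h : ∀ d, 𝓔.struct a b d x = 𝓔.Γ a d b x - 𝓔.Γ b d a x := by
    intro d
    rw [Γ, Γ, ← mul_sub, ΓLow_torsion_free, metric_bracket, ← mul_assoc, η_mul_self, one_mul]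
  simp only [nabla1, h, sub_mul, Finset.sum_sub_distrib]
  ring

/-- A gradient is closed. -/
theorem nabla1_symm_of_gradient {s : Set M} (hs : IsOpen s) {β : M → ℝ}
    (hβ : ContMDiffOn (𝓡 4) 𝓘(ℝ, ℝ) ∞ β s) {S : M → Fin 4 → ℝ}
    (h : ∀ y ∈ s, ∀ a, S y a = 𝓔.D a β y) (hx : x ∈ s) (a b : Fin 4) :
    𝓔.nabla1 S a b x = 𝓔.nabla1 S b a x := by
  have h1 : ∀ a b, 𝓔.D a (fun y => S y b) x = 𝓔.D a (𝓔.D b β) x := fun a b => by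
    rw [D, D, Filter.EventuallyEq.mfderiv_eq
      (Filter.eventuallyEq_of_mem (hs.mem_nhds hx) fun y hy => h y hy b)]
    rfl
  rw [← sub_eq_zero, nabla1_sub_nabla1, h1, h1, D_comm hs hβ hx, mfderiv_eq_sum (𝓔 := 𝓔)]
  simp only [h x hx]
  exact sub_self _

theorem contMDiff_nabla3 {T : M → Tensor3} (hT : ContMDiff (𝓡 4) 𝓘(ℝ, Tensor3) ∞ T)
    (f a b c : Fin 4) : ContMDiff (𝓡 4) 𝓘(ℝ, ℝ) ∞ (𝓔.nabla3 T f a b c) := by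
  have h0 : ∀ a b c, ContMDiff (𝓡 4) 𝓘(ℝ, ℝ) ∞ (fun x => T x a b c) := fun a b c =>
    contMDiff_pi_space.1 (contMDiff_pi_space.1 (contMDiff_pi_space.1 hT a) b) c
  have h1 : ContMDiff (𝓡 4) 𝓘(ℝ, ℝ) ∞ (𝓔.D f fun y => T y a b c) :=
    contMDiffOn_univ.1 (contMDiffOn_D isOpen_univ (h0 a b c).contMDiffOn f)
  have h2 := contMDiff_Γ (𝓔 := 𝓔)
  exact ((h1.sub (contMDiff_finsetSum fun d _ => (h2 f d a).mul (h0 d b c))).sub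
    (contMDiff_finsetSum fun d _ => (h2 f d b).mul (h0 a d c))).sub
    (contMDiff_finsetSum fun d _ => (h2 f d c).mul (h0 a b d))

theorem contMDiff_SLow {T : M → Tensor3} (hT : ContMDiff (𝓡 4) 𝓘(ℝ, Tensor3) ∞ T)
    (hne : ∀ x, quartic (T x) ≠ 0) (h : Fin 4) :
    ContMDiff (𝓡 4) 𝓘(ℝ, ℝ) ∞ (fun x => 𝓔.SLow T x h) := by
  have h0 : ∀ a b c, ContMDiff (𝓡 4) 𝓘(ℝ, ℝ) ∞ (fun x => T x a b c) := fun a b c =>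
    contMDiff_pi_space.1 (contMDiff_pi_space.1 (contMDiff_pi_space.1 hT a) b) c
  have h1 : ∀ a b, ContMDiff (𝓡 4) 𝓘(ℝ, ℝ) ∞ (fun x => contr2 (T x) a b) := fun a b =>
    contMDiff_finsetSum fun j _ => contMDiff_finsetSum fun k _ =>
      contMDiff_const.mul ((h0 a j k).mul (h0 b j k))
  have h2 : ContMDiff (𝓡 4) 𝓘(ℝ, ℝ) ∞ (fun x => quartic (T x)) :=
    contMDiff_finsetSum fun a _ => contMDiff_finsetSum fun b _ =>
      contMDiff_const.mul ((h1 a b).mul (h1 a b))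
  refine contMDiff_const.mul (ContMDiff.div₀ ?_ h2 hne)
  exact contMDiff_finsetSum fun a _ => contMDiff_finsetSum fun e _ =>
    contMDiff_finsetSum fun f _ => contMDiff_finsetSum fun b _ => contMDiff_finsetSum fun c _ =>
    contMDiff_finsetSum fun d _ => ((contMDiff_const.mul (contMDiff_const.mul (h1 e b))).mul
      (contMDiff_const.mul (h0 b c d))).mul (contMDiff_nabla3 hT f a c d)

/-! ### The Poincaré lemma for the covector S -/

/-- A closed covector field is locally a gradient. -/
theorem exists_primitive {S : M → Fin 4 → ℝ}
    (hS : ∀ a, ContMDiff (𝓡 4) 𝓘(ℝ, ℝ) ∞ (fun x => S x a))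
    (hclosed : ∀ x a b, 𝓔.nabla1 S a b x = 𝓔.nabla1 S b a x) (p : M) :
    ∃ (V : Set M) (β : M → ℝ), IsOpen V ∧ p ∈ V ∧ ContMDiffOn (𝓡 4) 𝓘(ℝ, ℝ) ∞ β V ∧
      ∀ x ∈ V, ∀ a, 𝓔.D a β x = S x a := by
  set φ := extChartAt (𝓡 4) p
  have hs : IsOpen φ.source := isOpen_extChartAt_source p
  -- the covector field in the chart
  let θ : M → EuclideanSpace ℝ (Fin 4) →L[ℝ] ℝ := fun x =>
    (∑ a, S x a • (ContinuousLinearMap.proj a : (Fin 4 → ℝ) →L[ℝ] ℝ)).comp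
      (𝓔.frameMap p x).inverse
  have hθ : ContMDiffOn (𝓡 4) 𝓘(ℝ, EuclideanSpace ℝ (Fin 4) →L[ℝ] ℝ) ∞ θ φ.source := by
    refine ContMDiffOn.clm_comp (ContMDiff.contMDiffOn ?_) (contMDiffOn_frameMap_inverse p)
    exact contMDiff_finsetSum fun a _ => (hS a).smul contMDiff_const
  have hθX : ∀ x ∈ φ.source, ∀ a, θ x (𝓔.X p a x) = S x a := by
    intro x hx a
    have h1 : (𝓔.frameMap p x).inverse (𝓔.X p a x) = Pi.single a 1 := by
      rw [(frameMap_isInvertible hx).inverse_apply_eq, frameMap_apply]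
      simp [Pi.single_apply]
    simp [θ, h1, Pi.single_apply]
  set g : EuclideanSpace ℝ (Fin 4) → EuclideanSpace ℝ (Fin 4) →L[ℝ] ℝ := fun y => θ (φ.symm y)
  have hgθ : ∀ x ∈ φ.source, θ x = g (φ x) := fun x hx => by simp only [g, φ.left_inv hx]
  have hg : ContDiffOn ℝ ∞ g φ.target := by
    have h1 := hθ.comp (contMDiffOn_extChartAt_symm p) fun y hy => φ.map_target hy
    exact contMDiffOn_iff_contDiffOn.1 h1
  have ht : IsOpen φ.target := isOpen_extChartAt_target p
  have hgd : ∀ y ∈ φ.target, DifferentiableAt ℝ g y := fun y hy =>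
    (hg.contDiffAt (ht.mem_nhds hy)).differentiableAt (by simp)
  -- It is enough to test on frame vectors. There the product rule produces θ of the antisymmetrized
  -- derivative of the frame, which cancels the structure functions in the closedness condition.
  have hsym : ∀ x ∈ φ.source, ∀ v w, fderiv ℝ g (φ x) v w = fderiv ℝ g (φ x) w v := by
    intro x hx
    have hD : ∀ a b, 𝓔.D a (fun y => S y b) x = fderiv ℝ g (φ x) (𝓔.X p a x) (𝓔.X p b x)
        + θ x (𝓔.D a (𝓔.X p b) x) := by
      intro a b
      have h1 := hasD_comp_chart (𝓔 := 𝓔) hx (hgd _ (φ.map_source hx)) a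
      have h2 := ((contMDiffOn_X (𝓔 := 𝓔) p b).contMDiffAt (hs.mem_nhds hx)).mdifferentiableAt
        (by simp)
      have h3 := (h1.prodMk (h2.hasD (𝓔 := 𝓔) (a := a))).comp
        (isBoundedBilinearMap_apply.hasFDerivAt (𝕜 := ℝ) (g (φ x), 𝓔.X p b x))
      have h4 := (h3.congr (g := fun y => S y b) (Filter.eventuallyEq_of_mem (hs.mem_nhds hx)
        fun y hy => by rw [← hθX y hy, hgθ y hy])).2
      rw [h4, hgθ x hx]
      exact add_comm _ _
    have hX : ∀ a b, fderiv ℝ g (φ x) (𝓔.X p a x) (𝓔.X p b x) =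
        fderiv ℝ g (φ x) (𝓔.X p b x) (𝓔.X p a x) := by
      intro a b
      have h1 := nabla1_sub_nabla1 (𝓔 := 𝓔) S a b x
      rw [hclosed x a b, sub_self, hD, hD] at h1
      have h2 := congrArg (θ x) (sum_struct_smul_X (𝓔 := 𝓔) hx a b)
      simp only [map_sum, map_smul, hθX x hx, smul_eq_mul, map_sub] at h2
      linarith
    intro v w
    have hv : ∀ v, ∃ c : Fin 4 → ℝ, v = ∑ a, c a • 𝓔.X p a x := fun v =>
      ⟨(𝓔.frameMap p x).inverse v, by
        rw [← frameMap_apply, (frameMap_isInvertible hx).self_apply_inverse]⟩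
    obtain ⟨c, rfl⟩ := hv v
    obtain ⟨d, rfl⟩ := hv w
    simp only [map_sum, map_smul, _root_.sum_apply, _root_.smul_apply, hX]
    simp only [Finset.smul_sum]
    rw [Finset.sum_comm]
    refine Finset.sum_congr rfl fun a _ => Finset.sum_congr rfl fun b _ => ?_
    rw [smul_comm, hX]
  -- The Poincaré lemma needs a convex domain, hence the restriction to a ball.
  obtain ⟨r, hr, hball⟩ := Metric.isOpen_iff.1 ht (φ p) (mem_extChartAt_target p)
  have hsym' : ∀ y ∈ Metric.ball (φ p) r, ∀ v w, fderiv ℝ g y v w = fderiv ℝ g y w v := by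
    intro y hy
    have := hsym _ (φ.map_target (hball hy))
    rwa [φ.right_inv (hball hy)] at this
  obtain ⟨u, hu⟩ := (convex_ball (φ p) r).exists_forall_hasFDerivAt_of_fderiv_symmetric
    Metric.isOpen_ball (fun y hy => (hgd y (hball hy)).differentiableWithinAt) hsym'
  have hus : ContDiffOn ℝ ∞ u (Metric.ball (φ p) r) := by
    refine (contDiffOn_infty_iff_fderiv_of_isOpen Metric.isOpen_ball).2
      ⟨fun y hy => (hu y hy).differentiableAt.differentiableWithinAt, ?_⟩
    exact (hg.mono hball).congr fun y hy => (hu y hy).fderiv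
  refine ⟨φ.source ∩ φ ⁻¹' Metric.ball (φ p) r, fun x => u (φ x),
    isOpen_extChartAt_preimage' p Metric.isOpen_ball,
    ⟨mem_extChartAt_source p, Metric.mem_ball_self hr⟩, ?_, ?_⟩
  · refine hus.contMDiffOn.comp ?_ fun x hx => hx.2
    refine contMDiffOn_extChartAt.mono fun x hx => ?_
    rw [← extChartAt_source (𝓡 4)]
    exact hx.1
  · rintro x ⟨hx, hxb⟩ a
    rw [(hasD_comp_chart (𝓔 := 𝓔) hx (hu _ hxb).differentiableAt a).2, (hu _ hxb).fderiv,
      ← hgθ x hx, hθX x hx]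

end SpinFrame

/-! ### The choice of phase and the local theorem -/

theorem contDiff_nullT (i i' j j' k k' : Fin 2) :
    ContDiff ℝ ∞ fun T : Tensor3 => nullT (fun a b c => (T a b c : ℂ)) i i' j j' k k' := by
  have h : ∀ a b c, ContDiff ℝ ∞ fun T : Tensor3 => (T a b c : ℂ) := fun a b c =>
    Complex.ofRealCLM.contDiff.comp (by fun_prop)
  simp only [nullT, low]
  fun_prop

theorem contDiff_disc : ContDiff ℝ ∞ disc := by
  simp only [funext fun Ψ => disc.eq_def Ψ, hess, pol]
  fun_prop

/-- A phase exp(iμ) shifts the argument of the discriminant by 4μ; this matches the factor 1/4 in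
`masslessAt_iff`. -/
theorem disc_smul (c : ℂ) (Ψ : Spinor3) : disc (c • Ψ) = c ^ 4 * disc Ψ := by
  simp only [disc, hess, pol, Pi.smul_apply, smul_eq_mul]; ring

theorem superenergy_smul {c : ℂ} (hc : ‖c‖ = 1) (Ψ : Spinor3) (a b d : Fin 4) :
    superenergy (c • Ψ) a b d = superenergy Ψ a b d := by
  have h : c * star c = 1 := by
    have := Complex.mul_conj' c
    rw [hc] at this
    simpa using this
  have h1 : ∀ z w : ℂ, c * z * star (c * w) = z * star w := fun z w => by
    rw [star_mul']
    linear_combination z * star w * h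
  simp only [superenergy, Pi.smul_apply, smul_eq_mul, h1]

theorem IsSymm3.smul {Ψ : Spinor3} (h : IsSymm3 Ψ) (c : ℂ) : IsSymm3 (c • Ψ) := fun A B C =>
  ⟨congrArg (c * ·) (h A B C).1, congrArg (c * ·) (h A B C).2⟩

namespace SpinFrame

variable {M : Type*} [TopologicalSpace M] [ChartedSpace (EuclideanSpace ℝ (Fin 4)) M]
  [IsManifold (𝓡 4) ∞ M] {𝓔 : SpinFrame M} {x p : M}

/-- A local argument of a nonvanishing function. -/
theorem exists_arg {V : Set M} (hV : IsOpen V) {f : M → ℂ}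
    (hf : ContMDiffOn (𝓡 4) 𝓘(ℝ, ℂ) ∞ f V) (hp : p ∈ V) (h0 : f p ≠ 0) :
    ∃ (W : Set M) (β : M → ℝ), IsOpen W ∧ p ∈ W ∧ W ⊆ V ∧ ContMDiffOn (𝓡 4) 𝓘(ℝ, ℝ) ∞ β W ∧
      ∀ x ∈ W, f x ≠ 0 ∧ ∀ a, 𝓔.D a β x = (𝓔.D a f x / f x).im := by
  -- Division by f p moves the value at p to 1, inside the domain where the logarithm is smooth, and
  -- changes the argument only by a constant.
  refine ⟨V ∩ (fun x => f x / f p) ⁻¹' Complex.slitPlane, fun x => (Complex.log (f x / f p)).im,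
    (hf.continuousOn.div_const _).isOpen_inter_preimage hV Complex.isOpen_slitPlane,
    ⟨hp, by simp [h0]⟩, Set.inter_subset_left, ?_, ?_⟩
  · intro x hx
    have h1 : ContDiffAt ℝ ∞ (fun z : ℂ => (Complex.log (z / f p)).im) (f x) := by
      have h2 : ContDiffAt ℝ ∞ (fun z : ℂ => Complex.log (z / f p)) (f x) :=
        ContDiffAt.comp (g := Complex.log) (f := fun z : ℂ => z / f p) (f x)
          ((Complex.contDiffAt_log hx.2).restrict_scalars ℝ) (contDiff_id.div_const _).contDiffAt
      exact Complex.imCLM.contDiff.contDiffAt.comp (f x) h2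
    exact h1.contMDiffAt.comp_contMDiffWithinAt x ((hf x hx.1).mono Set.inter_subset_left)
  · intro x hx
    have hfx : f x ≠ 0 := fun h => by simpa [h] using Complex.slitPlane_ne_zero hx.2
    refine ⟨hfx, fun a => ?_⟩
    have h1 := ((hf.contMDiffAt (hV.mem_nhds hx.1)).mdifferentiableAt (by simp)).hasD (𝓔 := 𝓔)
      (a := a)
    have h2 : HasDerivAt (fun z : ℂ => Complex.log (z / f p)) (1 / f x) (f x) := by
      refine (((hasDerivAt_id (f x)).div_const (f p)).clog hx.2).congr_deriv ?_
      simp only [id]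
      field_simp
    have h3 := (h1.comp (h2.hasFDerivAt.restrictScalars ℝ)).clm Complex.imCLM
    refine h3.2.trans ?_
    simp [div_eq_mul_inv]

/-- By `masslessAt_iff`, S is locally the gradient of a quarter of an argument of the discriminant,
hence closed. -/
theorem conditions_of_massless {T : M → Tensor3}
    (hT : ContMDiff (𝓡 4) 𝓘(ℝ, Tensor3) ∞ T) (hdiv : 𝓔.IsDivergenceFree T)
    (hne : ∀ x, quartic (T x) ≠ 0) {V : Set M} (hV : IsOpen V)
    (h : 𝓔.IsMasslessSuperenergyOn T V) (hx : x ∈ V) :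
    QuadraticIdentity (T x) ∧
      ∀ a b, 𝓔.nabla1 (𝓔.SLow T) a b x = 𝓔.nabla1 (𝓔.SLow T) b a x := by
  obtain ⟨s, hs, Ψ, hΨ, h⟩ := h
  have hs2 : s ^ 2 = 1 := by rcases hs with rfl | rfl <;> norm_num
  refine ⟨quadraticIdentity_of_superenergy (h x hx).1 hs2 (h x hx).2.1, fun a b => ?_⟩
  have hd : ContMDiffOn (𝓡 4) 𝓘(ℝ, ℂ) ∞ (fun y => disc (Ψ y)) V :=
    contDiff_disc.contMDiff.comp_contMDiffOn hΨ
  have hd0 : disc (Ψ x) ≠ 0 := fun h0 => hne x (by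
    simpa [h0] using quartic_of_superenergy hs2 (h x hx).2.1)
  obtain ⟨W, β, hW, hxW, hWV, hβ, hDβ⟩ := exists_arg (𝓔 := 𝓔) hV hd hx hd0
  refine nabla1_symm_of_gradient hW (β := fun y => 1 / 4 * β y)
    (contMDiffOn_const.mul hβ) (fun y hy k => ?_) hxW a b
  have hVy := hV.mem_nhds (hWV hy)
  have h1 := (masslessAt_iff hs2 (hT.mdifferentiable (by simp) y)
    ((hΨ.contMDiffAt hVy).mdifferentiableAt (by simp))
    (Filter.eventually_of_mem hVy fun z hz => (h z hz).1)
    (Filter.eventually_of_mem hVy fun z hz => (h z hz).2.1) (hdiv y) (hne y)).1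
    (h y (hWV hy)).2.2 k
  have h2 := (((hβ.contMDiffAt (hW.mem_nhds hy)).mdifferentiableAt (by simp)).hasD (𝓔 := 𝓔)
    (a := k)).clm ((1 / 4 : ℝ) • ContinuousLinearMap.id ℝ ℝ)
  rw [h1, ← (hDβ y hy).2 k]
  exact h2.2.symm

/-- A diagonal entry nonzero at p keeps its sign nearby, so its square root, and with it the
normalized column, is smooth there. -/
theorem exists_superenergy {T : M → Tensor3} (hT : ContMDiff (𝓡 4) 𝓘(ℝ, Tensor3) ∞ T)
    (hsymm : ∀ x, IsSymm3 (T x)) (htrace : ∀ x, IsTraceFree (T x))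
    (hq : ∀ x, QuadraticIdentity (T x)) (h0 : T p ≠ 0) :
    ∃ (V : Set M) (s : ℝ) (Ψ : M → Spinor3), IsOpen V ∧ p ∈ V ∧ (s = 1 ∨ s = -1) ∧
      ContMDiffOn (𝓡 4) 𝓘(ℝ, Spinor3) ∞ Ψ V ∧ ∀ x ∈ V, IsSymm3 (Ψ x) ∧
        ∀ a b c, ((s * T x a b c : ℝ) : ℂ) = superenergy (Ψ x) a b c := by
  obtain ⟨i, j, k, hd0⟩ := exists_nullT_ne_zero (hsymm p) (htrace p) (hq p) h0
  let d : M → ℝ := fun x => (nullT (fun a b c => (T x a b c : ℂ)) i i j j k k).re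
  have hd : ∀ x, nullT (fun a b c => (T x a b c : ℂ)) i i j j k k = d x := fun x =>
    (Complex.conj_eq_iff_re.1 (star_nullT (T x) i i j j k k)).symm
  have hn : ∀ i i' j j' k k', ContMDiff (𝓡 4) 𝓘(ℝ, ℂ) ∞
      (fun x => nullT (fun a b c => (T x a b c : ℂ)) i i' j j' k k') := fun i i' j j' k k' =>
    (contDiff_nullT i i' j j' k k').contMDiff.comp hT
  have hds : ContMDiff (𝓡 4) 𝓘(ℝ, ℝ) ∞ d :=
    Complex.reCLM.contDiff.contMDiff.comp (hn i i j j k k)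
  have hdp : d p ≠ 0 := fun h => hd0 (by rw [hd, h]; rfl)
  obtain ⟨s, hs, hsd⟩ : ∃ s : ℝ, (s = 1 ∨ s = -1) ∧ 0 < s * d p := by
    rcases hdp.lt_or_gt with h | h
    · exact ⟨-1, Or.inr rfl, by linarith⟩
    · exact ⟨1, Or.inl rfl, by linarith⟩
  have hs2 : s ^ 2 = 1 := by rcases hs with rfl | rfl <;> norm_num
  refine ⟨{x | 0 < s * d x}, s, fun x A B C =>
    nullT (fun a b c => (T x a b c : ℂ)) A i B j C k / (Real.sqrt (s * d x) : ℝ),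
    isOpen_lt continuous_const (continuous_const.mul hds.continuous), hsd, hs, ?_,
    fun x hx => ⟨?_, ?_⟩⟩
  · refine contMDiffOn_pi_space.2 fun A => contMDiffOn_pi_space.2 fun B =>
      contMDiffOn_pi_space.2 fun C => fun x hx => ?_
    have h1 : ContDiffAt ℝ ∞ (fun q : ℂ × ℝ => q.1 / (Real.sqrt (s * q.2) : ℝ))
        (nullT (fun a b c => (T x a b c : ℂ)) A i B j C k, d x) := by
      have h2 : ContDiffAt ℝ ∞ (fun q : ℂ × ℝ => Real.sqrt (s * q.2))
          (nullT (fun a b c => (T x a b c : ℂ)) A i B j C k, d x) :=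
        (contDiffAt_const.mul contDiffAt_snd).sqrt (ne_of_gt hx)
      have h3 : ContDiffAt ℝ ∞ (fun q : ℂ × ℝ => ((Real.sqrt (s * q.2) : ℝ) : ℂ))
          (nullT (fun a b c => (T x a b c : ℂ)) A i B j C k, d x) :=
        Complex.ofRealCLM.contDiff.contDiffAt.comp _ h2
      simp only [div_eq_mul_inv]
      refine contDiffAt_fst.mul (h3.inv ?_)
      exact Complex.ofReal_ne_zero.2 (Real.sqrt_pos.2 hx).ne'
    exact (h1.contMDiffAt.comp x
      (((hn A i B j C k).contMDiffAt (x := x)).prodMk_space hds.contMDiffAt)).contMDiffWithinAt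
  · have := isSymm3_nullT (hsymm x) (htrace x) i j k
    exact fun A B C => ⟨congrArg (· / _) (this A B C).1, congrArg (· / _) (this A B C).2⟩
  · exact superenergy_of_quadratic (hsymm x) (htrace x) (hq x) (hd x)
      (Real.sq_sqrt (le_of_lt hx)) (Real.sqrt_pos.2 hx).ne' hs2

/-- The logarithmic derivative of the discriminant under a change of phase. -/
theorem hasD_disc_smul {c : M → ℂ} {Ψ : M → Spinor3} {c' : ℂ} {a : Fin 4} (hc : 𝓔.HasD a c c' x)
    (hΨ : MDifferentiableAt (𝓡 4) 𝓘(ℝ, Spinor3) Ψ x) (h0 : disc (Ψ x) ≠ 0) (hc0 : c x ≠ 0) :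
    𝓔.D a (fun y => disc (c y • Ψ y)) x / disc (c x • Ψ x) =
      4 * (c' / c x) + 𝓔.D a (fun y => disc (Ψ y)) x / disc (Ψ x) := by
  have h1 := (hΨ.hasD (𝓔 := 𝓔) (a := a)).disc
  have h2 := ((hc.mul hc).mul (hc.mul hc)).mul h1
  have h3 := h2.congr (g := fun y => disc (c y • Ψ y)) (Filter.Eventually.of_forall fun y => by
    simp only [disc_smul]; ring)
  rw [h3.2, h1.2, disc_smul]
  field_simp
  ring

theorem massless_of_conditions {T : M → Tensor3}
    (hT : ContMDiff (𝓡 4) 𝓘(ℝ, Tensor3) ∞ T)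
    (hsymm : ∀ x, IsSymm3 (T x)) (htrace : ∀ x, IsTraceFree (T x))
    (hdiv : 𝓔.IsDivergenceFree T) (hne : ∀ x, quartic (T x) ≠ 0)
    (hq : ∀ x, QuadraticIdentity (T x)) (hS : 𝓔.SClosed T) (p : M) :
    ∃ V : Set M, IsOpen V ∧ p ∈ V ∧ 𝓔.IsMasslessSuperenergyOn T V := by
  have hTp : T p ≠ 0 := fun h => hne p (by simp [h, quartic, contr2])
  obtain ⟨V, s, Ψ, hV, hpV, hs, hΨ, h⟩ := exists_superenergy hT hsymm htrace hq hTp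
  have hs2 : s ^ 2 = 1 := by rcases hs with rfl | rfl <;> norm_num
  have hd : ContMDiffOn (𝓡 4) 𝓘(ℝ, ℂ) ∞ (fun y => disc (Ψ y)) V :=
    contDiff_disc.contMDiff.comp_contMDiffOn hΨ
  have hd0 : disc (Ψ p) ≠ 0 := fun h0 => hne p (by
    simpa [h0] using quartic_of_superenergy hs2 (h p hpV).2)
  obtain ⟨W, β, hW, hpW, hWV, hβ, hDβ⟩ := exists_arg (𝓔 := 𝓔) hV hd hpV hd0
  obtain ⟨U, l, hU, hpU, hl, hDl⟩ := exists_primitive (𝓔 := 𝓔) (contMDiff_SLow hT hne) hS p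
  -- The rotation adds dμ to a quarter of the gradient of the argument, which is dβ / 4 before and
  -- must become S = dl.
  let μ : M → ℝ := fun x => l x - 1 / 4 * β x
  let c : M → ℂ := fun x => Complex.exp (Complex.I * μ x)
  have hμ : ContMDiffOn (𝓡 4) 𝓘(ℝ, ℝ) ∞ μ (W ∩ U) :=
    (hl.mono Set.inter_subset_right).sub (contMDiffOn_const.mul (hβ.mono Set.inter_subset_left))
  have hexp : ContDiff ℝ ∞ fun r : ℝ => Complex.exp (Complex.I * r) :=
    (contDiff_const.mul Complex.ofRealCLM.contDiff).cexp
  have hc : ContMDiffOn (𝓡 4) 𝓘(ℝ, ℂ) ∞ c (W ∩ U) := hexp.contMDiff.comp_contMDiffOn hμ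
  have hnorm : ∀ x, ‖c x‖ = 1 := fun x => by
    simp only [c]; rw [mul_comm]; exact Complex.norm_exp_ofReal_mul_I _
  have hΨ' : ContMDiffOn (𝓡 4) 𝓘(ℝ, Spinor3) ∞ (fun x => c x • Ψ x) (W ∩ U) := by
    have h1 : ContDiff ℝ ∞ fun q : ℂ × Spinor3 => q.1 • q.2 := contDiff_fst.smul contDiff_snd
    exact h1.contMDiff.comp_contMDiffOn
      (hc.prodMk_space (hΨ.mono fun x hx => hWV hx.1))
  have hO := hW.inter hU
  have h' : ∀ x ∈ W ∩ U, IsSymm3 (c x • Ψ x) ∧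
      ∀ a b d, ((s * T x a b d : ℝ) : ℂ) = superenergy (c x • Ψ x) a b d := fun x hx =>
    ⟨(h x (hWV hx.1)).1.smul _, fun a b d => by
      rw [superenergy_smul (hnorm x)]; exact (h x (hWV hx.1)).2 a b d⟩
  refine ⟨W ∩ U, hO, ⟨hpW, hpU⟩, s, hs, fun x => c x • Ψ x, hΨ', fun x hx =>
    ⟨(h' x hx).1, (h' x hx).2, ?_⟩⟩
  have hOx := hO.mem_nhds hx
  refine (masslessAt_iff hs2 (hT.mdifferentiable (by simp) x)
    ((hΨ'.contMDiffAt hOx).mdifferentiableAt (by simp))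
    (Filter.eventually_of_mem hOx fun z hz => (h' z hz).1)
    (Filter.eventually_of_mem hOx fun z hz => (h' z hz).2) (hdiv x) (hne x)).2 fun k => ?_
  have hμx := ((hμ.contMDiffAt hOx).mdifferentiableAt (by simp)).hasD (𝓔 := 𝓔) (a := k)
  have hμD : 𝓔.D k μ x = 𝓔.SLow T x k - 1 / 4 * 𝓔.D k β x := by
    have h2 := (((hβ.contMDiffAt (hW.mem_nhds hx.1)).mdifferentiableAt (by simp)).hasD (𝓔 := 𝓔)
      (a := k)).clm ((1 / 4 : ℝ) • ContinuousLinearMap.id ℝ ℝ)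
    have h3 := ((hl.contMDiffAt (hU.mem_nhds hx.2)).mdifferentiableAt (by simp)).hasD (𝓔 := 𝓔)
      (a := k)
    rw [← hDl x hx.2 k]
    exact (h3.sub h2).2
  have hcx : 𝓔.HasD k c (Complex.I * 𝓔.D k μ x * c x) x := by
    have h2 : HasDerivAt (fun z : ℂ => Complex.exp (Complex.I * z))
        (Complex.exp (Complex.I * μ x) * Complex.I) (μ x : ℂ) := by
      simpa using ((hasDerivAt_id (μ x : ℂ)).const_mul Complex.I).cexp
    refine (hμx.ofReal.comp (h2.hasFDerivAt.restrictScalars ℝ)).congr_deriv ?_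
    simp [c]; ring
  have hc0 : c x ≠ 0 := Complex.exp_ne_zero _
  rw [hasD_disc_smul hcx ((hΨ.contMDiffAt (hV.mem_nhds (hWV hx.1))).mdifferentiableAt (by simp))
    (hDβ x hx.1).1 hc0, Complex.add_im, ← (hDβ x hx.1).2 k, mul_div_cancel_right₀ _ hc0, hμD]
  simp
  ring

end SpinFrame

/-! ### Locally constant cocycles -/

open Filter Topology Set in
/-- Over a simply connected space, a locally constant cocycle is a coboundary. -/
theorem exists_trivialization_of_cocycle {X G : Type*} [TopologicalSpace X]
    [SimplyConnectedSpace X] [LocallyPathConnectedSpace X] [Group G] {V : X → Set X}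
    (hV : ∀ p, IsOpen (V p)) (hpV : ∀ p, p ∈ V p) (c : X → X → X → G)
    (hc : ∀ p q, ∀ x ∈ V p ∩ V q, ∀ᶠ y in 𝓝 x, c p q y = c p q x)
    (hc1 : ∀ p, ∀ x ∈ V p, c p p x = 1)
    (hcc : ∀ p q r, ∀ x ∈ V p ∩ V q ∩ V r, c p q x * c q r x = c p r x) :
    ∃ z : X → X → G, (∀ p, ∀ x ∈ V p, ∀ᶠ y in 𝓝 x, z p y = z p x) ∧
      ∀ p q, ∀ x ∈ V p ∩ V q, z q x = z p x * c p q x := by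
  -- With the discrete topology on the fibre, locally constant transition functions are continuous
  -- and the bundle is a covering. They multiply on the right, as the order of factors in the
  -- cocycle condition requires.
  let _ : TopologicalSpace G := ⊥
  have : DiscreteTopology G := ⟨rfl⟩
  let Z : FiberBundleCore X X G :=
    { baseSet := V
      isOpen_baseSet := hV
      indexAt := id
      mem_baseSet_at := hpV
      coordChange := fun p q x v => v * c p q x
      coordChange_self := fun p x hx v => by rw [hc1 p x hx, mul_one]
      continuousOn_coordChange := fun p q => by
        rintro ⟨x, v⟩ ⟨hx, -⟩
        refine ContinuousAt.continuousWithinAt ?_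
        have h1 : ∀ᶠ w in 𝓝 v, w = v := by rw [nhds_discrete]; exact eventually_pure.2 rfl
        have h2 : ∀ᶠ w : X × G in 𝓝 (x, v), w.2 * c p q w.1 = v * c p q x := by
          rw [nhds_prod_eq]
          filter_upwards [(hc p q x hx).prod_mk h1] with w hw
          rw [hw.1, hw.2]
        exact continuousAt_const.congr (h2.mono fun w hw => hw.symm)
      coordChange_comp := fun p q r x hx v => by
        rw [mul_assoc, hcc p q r x hx] }
  have hcov : IsCoveringMap (Bundle.TotalSpace.proj : Bundle.TotalSpace G Z.Fiber → X) :=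
    FiberBundle.isCoveringMap
  obtain ⟨a₀⟩ : Nonempty X := inferInstance
  -- Simple connectedness lifts the identity map, which is a global section of the covering.
  obtain ⟨F, ⟨-, hF⟩, -⟩ := hcov.existsUnique_continuousMap_lifts (ContinuousMap.id X)
    (a₀ := a₀) (e₀ := ⟨a₀, (1 : G)⟩) rfl
  have hF' : ∀ x, (F x).proj = x := fun x => congrFun hF x
  -- The coboundary is the section read in each trivialization: continuous into a discrete space,
  -- hence locally constant.
  refine ⟨fun p x => (Z.localTriv p (F x)).2, fun p x hx => ?_, fun p q x hx => ?_⟩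
  · have h1 : ContinuousAt (fun y => (Z.localTriv p (F y)).2) x := by
      refine continuousAt_snd.comp
        (ContinuousAt.comp (g := Z.localTriv p) ?_ F.continuous.continuousAt)
      refine (Z.localTriv p).continuousAt ?_
      rw [Z.mem_localTriv_source, hF']
      exact hx
    have h2 := h1.tendsto
    rw [nhds_discrete G] at h2
    exact tendsto_pure.1 h2
  · simp only [Z.localTriv_apply]
    have hx' := hx
    rw [← hF' x] at hx'
    have := Z.coordChange_comp (F x).proj p q (F x).proj ⟨⟨hpV _, hx'.1⟩, hx'.2⟩ (F x).2
    exact this.symm.trans (congrArg (fun y => _ * c p q y) (hF' x))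

/-! ### Uniqueness of the spinor up to a constant phase -/

/-- The phase relating two proportional vectors. -/
def ratio {ι : Type*} [Fintype ι] (u v : ι → ℂ) : ℂ :=
  (∑ i, u i * star (v i)) / ∑ i, v i * star (v i)

theorem sum_mul_star_ne_zero {ι : Type*} [Fintype ι] {v : ι → ℂ} (hv : v ≠ 0) :
    ∑ i, v i * star (v i) ≠ 0 := by
  obtain ⟨i, hi⟩ := Function.ne_iff.1 hv
  have h : ∑ i, v i * star (v i) = ((∑ i, ‖v i‖ ^ 2 : ℝ) : ℂ) := by
    push_cast
    exact Finset.sum_congr rfl fun i _ => Complex.mul_conj' _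
  rw [h, Complex.ofReal_ne_zero]
  exact (Finset.sum_pos' (fun _ _ => by positivity)
    ⟨i, Finset.mem_univ i, by have : v i ≠ 0 := hi; positivity⟩).ne'

/-- Equal rank one matrices uu* and vv* have the same line and the same norm, so the projection
coefficient of u on v is a phase. Unlike a quotient of chosen components, this formula depends
smoothly on u and v wherever v is nonzero. -/
theorem eq_ratio_mul {ι : Type*} [Fintype ι] {u v : ι → ℂ} (hv : v ≠ 0)
    (h : ∀ i j, u i * star (u j) = v i * star (v j)) :
    ratio u v * star (ratio u v) = 1 ∧ ∀ i, u i = ratio u v * v i := by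
  have hn := sum_mul_star_ne_zero hv
  have h1 : ∀ i, u i = ratio u v * v i := by
    intro i
    rw [ratio, div_mul_eq_mul_div, eq_div_iff hn, Finset.mul_sum, Finset.sum_mul]
    refine Finset.sum_congr rfl fun j _ => ?_
    linear_combination -u i * h j j + u j * h i j
  refine ⟨?_, h1⟩
  obtain ⟨i, hi⟩ := Function.ne_iff.1 hv
  have hi : v i ≠ 0 := hi
  have h2 := h i i
  rw [h1 i, star_mul'] at h2
  have h3 : star (v i) ≠ 0 := star_ne_zero.2 hi
  field_simp at h2
  linear_combination h2

theorem nullT_bil (Φ χ : Spinor3) (A A' B B' C C' : Fin 2) :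
    nullT (bil Φ χ) A A' B B' C C' = Φ A B C * χ A' B' C' := by
  have h : ∀ a b c, bil Φ χ a b c = up (fun A A' => up (fun B B' => up (fun C C' =>
      Φ A B C * χ A' B' C') c) b) a := by
    intro a b c
    simp only [bil, up, Fin.sum_univ_two]; ring
  have h1 : ∀ (F : Fin 2 → Fin 2 → Fin 4 → ℂ) (a : Fin 4) C C',
      low (fun c => up (fun A A' => F A A' c) a) C C' =
        up (fun A A' => low (F A A') C C') a := by
    intro F a C C'
    simp only [low, up, Fin.sum_univ_two, Finset.mul_sum, mul_add, Finset.sum_add_distrib]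
    simp only [mul_left_comm (σLow _ _ _)]
  have h2 : ∀ (F : Fin 2 → Fin 2 → ℂ) A A', low (fun a => up F a) A A' = F A A' := fun F A A' =>
    congrFun (congrFun (low_up F) A) A'
  simp only [nullT, h, h1, h2]

/-- The components of a spinor as a vector. -/
def flat (Φ : Spinor3) (I : Fin 2 × Fin 2 × Fin 2) : ℂ := Φ I.1 I.2.1 I.2.2

theorem flat_mul_star_of_superenergy {Φ Φ' : Spinor3}
    (h : ∀ a b c, superenergy Φ a b c = superenergy Φ' a b c) (I J : Fin 2 × Fin 2 × Fin 2) :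
    flat Φ I * star (flat Φ J) = flat Φ' I * star (flat Φ' J) := by
  have h1 : bil Φ (conjSpinor Φ) = bil Φ' (conjSpinor Φ') :=
    funext fun a => funext fun b => funext fun c => h a b c
  have h2 := nullT_bil Φ (conjSpinor Φ) I.1 J.1 I.2.1 J.2.1 I.2.2 J.2.2
  rw [h1, nullT_bil] at h2
  exact h2.symm

theorem flat_ne_zero {Φ : Spinor3} (h : disc Φ ≠ 0) : flat Φ ≠ 0 := fun h0 => h (by
  have h1 : ∀ A B C, Φ A B C = 0 := fun A B C => congrFun h0 (A, B, C)
  simp [disc, hess, pol, h1])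

/-- The symbol `σUp 0` is a multiple of the identity, so the component 000 is a positive multiple of
the squared norm. The sign s is thereby determined by T. -/
theorem superenergy_zero (Φ : Spinor3) :
    superenergy Φ 0 0 0 = (((1 / Real.sqrt 2) ^ 3 * ∑ I, ‖flat Φ I‖ ^ 2 : ℝ) : ℂ) := by
  have h : ∀ z : ℂ, ((‖z‖ : ℂ)) ^ 2 = z * star z := fun z => (Complex.mul_conj' z).symm
  push_cast
  simp only [h, flat, Fintype.sum_prod_type, superenergy, σUp, Fin.sum_univ_two]
  simp
  ring

theorem sign_mul_pos {T : Tensor3} {Φ : Spinor3} {s : ℝ} (hd : disc Φ ≠ 0)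
    (h : ∀ a b c, ((s * T a b c : ℝ) : ℂ) = superenergy Φ a b c) : 0 < s * T 0 0 0 := by
  have h1 := h 0 0 0
  rw [superenergy_zero, Complex.ofReal_inj] at h1
  rw [h1]
  obtain ⟨I, hI⟩ := Function.ne_iff.1 (flat_ne_zero hd)
  have : flat Φ I ≠ 0 := hI
  have h2 : 0 < ∑ I, ‖flat Φ I‖ ^ 2 := Finset.sum_pos' (fun _ _ => by positivity)
    ⟨I, Finset.mem_univ I, by positivity⟩
  positivity

namespace SpinFrame

variable {M : Type*} [TopologicalSpace M] [ChartedSpace (EuclideanSpace ℝ (Fin 4)) M]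
  [IsManifold (𝓡 4) ∞ M] {𝓔 : SpinFrame M} {x p : M}

/-- The frame spans each tangent space, so the chart representative has zero derivative and is
constant on a ball. -/
theorem eventually_eq_of_D_eq_zero {F : Type*} [NormedAddCommGroup F] [NormedSpace ℝ F]
    {s : Set M} (hs : IsOpen s) {f : M → F}
    (hf : ∀ x ∈ s, ∀ a, 𝓔.HasD a f 0 x) (hp : p ∈ s) : ∀ᶠ x in nhds p, f x = f p := by
  set φ := extChartAt (𝓡 4) p
  let g : EuclideanSpace ℝ (Fin 4) → F := fun y => f (φ.symm y)
  have hsrc : IsOpen φ.source := isOpen_extChartAt_source p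
  have hO : IsOpen (φ.target ∩ φ.symm ⁻¹' s) :=
    (continuousOn_extChartAt_symm p).isOpen_inter_preimage (isOpen_extChartAt_target p) hs
  have hg : ∀ y ∈ φ.target ∩ φ.symm ⁻¹' s, HasFDerivAt g (0 : _ →L[ℝ] F) y := by
    intro y hy
    have hx := φ.map_target hy.1
    have h1 : DifferentiableAt ℝ g y := by
      have h2 : MDifferentiableAt (𝓡 4) 𝓘(ℝ, F) f (φ.symm y) := (hf _ hy.2 0).1
      have h3 := ((contMDiffOn_extChartAt_symm (I := 𝓡 4) (n := ∞) p).contMDiffAt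
        ((isOpen_extChartAt_target p).mem_nhds hy.1)).mdifferentiableAt (by simp)
      exact (h2.comp y h3).differentiableAt
    have h4 : ∀ a, fderiv ℝ g y (𝓔.X p a (φ.symm y)) = 0 := by
      intro a
      have h5 := hasD_comp_chart (𝓔 := 𝓔) hx (g := g) (by rwa [φ.right_inv hy.1]) a
      rw [φ.right_inv hy.1] at h5
      have h6 := (hf _ hy.2 a).congr (g := fun x => g (φ x)) (Filter.eventuallyEq_of_mem
        (hsrc.mem_nhds hx) fun z hz => by simp only [g]; rw [φ.left_inv hz])
      exact h5.2.symm.trans h6.2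
    have h7 : fderiv ℝ g y = 0 := by
      ext1 v
      rw [← (frameMap_isInvertible (𝓔 := 𝓔) hx).self_apply_inverse v, frameMap_apply]
      simp [h4]
    rw [← h7]
    exact h1.hasFDerivAt
  have hp' : φ p ∈ φ.target ∩ φ.symm ⁻¹' s :=
    ⟨mem_extChartAt_target p, by simpa [φ] using hp⟩
  obtain ⟨r, hr, hball⟩ := Metric.isOpen_iff.1 hO (φ p) hp'
  have hconst : ∀ y ∈ Metric.ball (φ p) r, g y = g (φ p) := fun y hy =>
    (convex_ball (φ p) r).is_const_of_fderivWithin_eq_zero (𝕜 := ℝ)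
      (fun z hz => (hg z (hball hz)).differentiableAt.differentiableWithinAt)
      (fun z hz => by
        rw [fderivWithin_of_isOpen Metric.isOpen_ball hz, (hg z (hball hz)).fderiv])
      hy (Metric.mem_ball_self hr)
  filter_upwards [hsrc.mem_nhds (mem_extChartAt_source p),
    (continuousAt_extChartAt (I := 𝓡 4) p) (Metric.ball_mem_nhds (φ p) hr)] with x hx hx'
  have h8 := hconst _ hx'
  simp only [g] at h8
  rwa [φ.left_inv hx, φ.left_inv (mem_extChartAt_source p)] at h8

/-- Massless fields with the same superenergy tensor differ by a locally constant phase. -/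
theorem eventually_ratio_eq {T : M → Tensor3} {s : ℝ} (hs : s ^ 2 = 1)
    (hT : ContMDiff (𝓡 4) 𝓘(ℝ, Tensor3) ∞ T)
    (hdiv : 𝓔.IsDivergenceFree T) (hne : ∀ x, quartic (T x) ≠ 0) {V : Set M} (hV : IsOpen V)
    {Ψ Ψ' : M → Spinor3} (hΨ : ContMDiffOn (𝓡 4) 𝓘(ℝ, Spinor3) ∞ Ψ V)
    (hΨ' : ContMDiffOn (𝓡 4) 𝓘(ℝ, Spinor3) ∞ Ψ' V)
    (h : ∀ x ∈ V, IsSymm3 (Ψ x) ∧ (∀ a b c, ((s * T x a b c : ℝ) : ℂ) = superenergy (Ψ x) a b c) ∧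
      𝓔.MasslessAt Ψ x)
    (h' : ∀ x ∈ V, IsSymm3 (Ψ' x) ∧
      (∀ a b c, ((s * T x a b c : ℝ) : ℂ) = superenergy (Ψ' x) a b c) ∧ 𝓔.MasslessAt Ψ' x)
    (hp : p ∈ V) :
    ∀ᶠ x in nhds p, ratio (flat (Ψ x)) (flat (Ψ' x)) = ratio (flat (Ψ p)) (flat (Ψ' p)) := by
  have hd : ∀ x ∈ V, disc (Ψ x) ≠ 0 := fun x hx h0 => hne x (by
    simpa [h0] using quartic_of_superenergy hs (h x hx).2.1)
  have hd' : ∀ x ∈ V, disc (Ψ' x) ≠ 0 := fun x hx h0 => hne x (by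
    simpa [h0] using quartic_of_superenergy hs (h' x hx).2.1)
  set c : M → ℂ := fun x => ratio (flat (Ψ x)) (flat (Ψ' x))
  have hc : ∀ x ∈ V, c x * star (c x) = 1 ∧ c x • Ψ' x = Ψ x := by
    intro x hx
    have h1 := eq_ratio_mul (flat_ne_zero (hd' x hx)) (flat_mul_star_of_superenergy fun a b c =>
      ((h x hx).2.1 a b c).symm.trans ((h' x hx).2.1 a b c))
    exact ⟨h1.1, by ext A B C; exact (h1.2 (A, B, C)).symm⟩
  have hcd : ∀ x ∈ V, MDifferentiableAt (𝓡 4) 𝓘(ℝ, ℂ) c x := by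
    intro x hx
    have h1 : ContDiffAt ℝ ∞ (fun q : Spinor3 × Spinor3 => ratio (flat q.1) (flat q.2))
        (Ψ x, Ψ' x) := by
      have h2 : ∀ I, ContDiff ℝ ∞ fun q : Spinor3 × Spinor3 => flat q.1 I := fun I => by
        unfold flat; fun_prop
      have h3 : ∀ I, ContDiff ℝ ∞ fun q : Spinor3 × Spinor3 => flat q.2 I := fun I => by
        unfold flat; fun_prop
      have h4 : ∀ I, ContDiff ℝ ∞ fun q : Spinor3 × Spinor3 => star (flat q.2 I) := fun I =>
        (Complex.conjCLE : ℂ →L[ℝ] ℂ).contDiff.comp (h3 I)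
      simp only [ratio, div_eq_mul_inv]
      refine ContDiffAt.mul (ContDiff.sum fun I _ => (h2 I).mul (h4 I)).contDiffAt
        (ContDiffAt.inv (ContDiff.sum fun I _ => (h3 I).mul (h4 I)).contDiffAt ?_)
      exact sum_mul_star_ne_zero (flat_ne_zero (hd' x hx))
    have hVx := hV.mem_nhds hx
    exact (h1.contMDiffAt.comp x
      ((hΨ.contMDiffAt hVx).prodMk_space (hΨ'.contMDiffAt hVx))).mdifferentiableAt (by simp)
  refine eventually_eq_of_D_eq_zero (𝓔 := 𝓔) hV (fun x hx a => ?_) hp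
  have hVx := hV.mem_nhds hx
  have hc0 : c x ≠ 0 := left_ne_zero_of_mul (by rw [(hc x hx).1]; exact one_ne_zero)
  have hcx := (hcd x hx).hasD (𝓔 := 𝓔) (a := a)
  refine hcx.congr_deriv ?_
  have hΨx := (hΨ.contMDiffAt hVx).mdifferentiableAt (n := ∞) (by simp)
  have hΨx' := (hΨ'.contMDiffAt hVx).mdifferentiableAt (n := ∞) (by simp)
  have h1 := (masslessAt_iff hs (hT.mdifferentiable (by simp) x) hΨx
    (Filter.eventually_of_mem hVx fun z hz => (h z hz).1)
    (Filter.eventually_of_mem hVx fun z hz => (h z hz).2.1) (hdiv x) (hne x)).1 (h x hx).2.2 a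
  have h2 := (masslessAt_iff hs (hT.mdifferentiable (by simp) x) hΨx'
    (Filter.eventually_of_mem hVx fun z hz => (h' z hz).1)
    (Filter.eventually_of_mem hVx fun z hz => (h' z hz).2.1) (hdiv x) (hne x)).1 (h' x hx).2.2 a
  have h3 := hasD_disc_smul hcx hΨx' (hd' x hx) hc0
  have h4 : 𝓔.D a (fun y => disc (c y • Ψ' y)) x = 𝓔.D a (fun y => disc (Ψ y)) x := by
    have h5 := (hΨx.hasD (𝓔 := 𝓔) (a := a)).disc
    have h6 := h5.congr (g := fun y => disc (c y • Ψ' y))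
      (Filter.eventuallyEq_of_mem hVx fun y hy => by simp only [(hc y hy).2])
    exact h6.2.trans h5.2.symm
  rw [h4, (hc x hx).2] at h3
  -- Both fields have a quarter of the gradient of the argument equal to the same S, so the argument
  -- of c is stationary.
  have him : (𝓔.D a c x / c x).im = 0 := by
    have h5 := congrArg Complex.im h3
    rw [Complex.add_im, show (4 * (𝓔.D a c x / c x)).im = 4 * (𝓔.D a c x / c x).im by simp] at h5
    linarith
  -- The modulus of c is identically 1 on V.
  have hre : (𝓔.D a c x / c x).re = 0 := by
    have h5 := ((hcx.mul hcx.star).congr (g := fun _ => (1 : ℂ))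
      (Filter.eventuallyEq_of_mem hVx fun y hy => (hc y hy).1.symm)).2
    rw [(HasD.const (𝓔 := 𝓔) (a := a) (x := x) (1 : ℂ)).2] at h5
    have h6 : 𝓔.D a c x / c x = 𝓔.D a c x * star (c x) := by
      rw [div_eq_iff hc0]
      linear_combination -𝓔.D a c x * (hc x hx).1
    rw [h6]
    have h7 := congrArg Complex.re h5
    simp at h7 ⊢
    linarith
  have h8 : 𝓔.D a c x / c x = 0 := Complex.ext hre him
  exact (div_eq_zero_iff.1 h8).resolve_right hc0

theorem masslessAt_const_smul {Ψ Ψ' : M → Spinor3} {k : ℂ}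
    (hΨ : MDifferentiableAt (𝓡 4) 𝓘(ℝ, Spinor3) Ψ x) (h : 𝓔.MasslessAt Ψ x)
    (he : ∀ᶠ y in nhds x, Ψ' y = k • Ψ y) : 𝓔.MasslessAt Ψ' x := by
  have h1 : ∀ f A B C, 𝓔.nablaSpinor Ψ' f A B C x = k * 𝓔.nablaSpinor Ψ f A B C x := by
    intro f A B C
    have h2 := ((((hΨ.hasD (𝓔 := 𝓔) (a := f)).apply A).apply B).apply C)
    have h3 := (h2.const_mul k).congr (g := fun y => Ψ' y A B C)
      (he.mono fun y hy => by simp [hy])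
    have h4 : ∀ A B C, Ψ' x A B C = k * Ψ x A B C := fun A B C => by simp [he.self_of_nhds]
    simp only [nablaSpinor, h3.2, h2.2, h4, mul_sub, Finset.mul_sum, mul_left_comm k]
  intro A' B C
  simp only [h1, mul_left_comm _ k, ← Finset.mul_sum, h A' B C, mul_zero]

end SpinFrame

/-! ### Gluing over a simply connected manifold -/

namespace SpinFrame

variable {M : Type*} [TopologicalSpace M] [ChartedSpace (EuclideanSpace ℝ (Fin 4)) M]
  [IsManifold (𝓡 4) ∞ M] {𝓔 : SpinFrame M}

open Topology in
theorem global_of_local [SimplyConnectedSpace M] {T : M → Tensor3}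
    (hT : ContMDiff (𝓡 4) 𝓘(ℝ, Tensor3) ∞ T)
    (hdiv : 𝓔.IsDivergenceFree T) (hne : ∀ x, quartic (T x) ≠ 0)
    (hloc : ∀ p : M, ∃ V : Set M, IsOpen V ∧ p ∈ V ∧ 𝓔.IsMasslessSuperenergyOn T V) :
    𝓔.IsMasslessSuperenergyOn T Set.univ := by
  have : LocallyPathConnectedSpace M :=
    ChartedSpace.locallyPathConnectedSpace (EuclideanSpace ℝ (Fin 4)) M
  choose V hV hpV σ hσ Ψ hΨ h using hloc
  have hσ2 : ∀ p, σ p ^ 2 = 1 := fun p => by rcases hσ p with h | h <;> rw [h] <;> norm_num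
  have hd : ∀ p, ∀ x ∈ V p, disc (Ψ p x) ≠ 0 := fun p x hx h0 => hne x (by
    simpa [h0] using quartic_of_superenergy (hσ2 p) (h p x hx).2.1)
  have hpos : ∀ p, ∀ x ∈ V p, 0 < σ p * T x 0 0 0 := fun p x hx =>
    sign_mul_pos (hd p x hx) (h p x hx).2.1
  -- the sign is constant
  obtain ⟨s, hs, hsσ⟩ : ∃ s : ℝ, (s = 1 ∨ s = -1) ∧ ∀ p, σ p = s := by
    obtain ⟨p₀⟩ : Nonempty M := inferInstance
    refine ⟨σ p₀, hσ p₀, fun p => ?_⟩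
    have hcont : Continuous fun x => T x 0 0 0 :=
      (contMDiff_pi_space.1 (contMDiff_pi_space.1 (contMDiff_pi_space.1 hT 0) 0) 0).continuous
    have hT0 : ∀ x, T x 0 0 0 ≠ 0 := fun x h0 => by simpa [h0] using hpos x x (hpV x)
    have h1 := hpos p p (hpV p)
    have h2 := hpos p₀ p₀ (hpV p₀)
    -- Opposite signs at two points would force a zero of T_{000} by connectedness.
    rcases hσ p with h3 | h3 <;> rcases hσ p₀ with h4 | h4 <;> rw [h3] at h1 ⊢ <;>
      rw [h4] at h2 ⊢
    · obtain ⟨x, hx⟩ := mem_range_of_exists_le_of_exists_ge (c := 0) hcont ⟨p₀, by linarith⟩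
        ⟨p, by linarith⟩
      exact absurd hx (hT0 x)
    · obtain ⟨x, hx⟩ := mem_range_of_exists_le_of_exists_ge (c := 0) hcont ⟨p, by linarith⟩
        ⟨p₀, by linarith⟩
      exact absurd hx (hT0 x)
  have hs2 : s ^ 2 = 1 := by rcases hs with rfl | rfl <;> norm_num
  simp only [hsσ] at h
  -- the phases relating the local solutions
  have hr : ∀ p q, ∀ x ∈ V p ∩ V q,
      ratio (flat (Ψ p x)) (flat (Ψ q x)) * star (ratio (flat (Ψ p x)) (flat (Ψ q x))) = 1 ∧
      ∀ I, flat (Ψ p x) I = ratio (flat (Ψ p x)) (flat (Ψ q x)) * flat (Ψ q x) I :=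
    fun p q x hx => eq_ratio_mul (flat_ne_zero (hd q x hx.2))
      (flat_mul_star_of_superenergy fun a b c =>
        ((h p x hx.1).2.1 a b c).symm.trans ((h q x hx.2).2.1 a b c))
  -- A total map to the circle that is the identity on unit complex numbers. Ratios outside the
  -- overlaps may take any value, since the cocycle is tested only on overlaps.
  let toCircle : ℂ → Circle := fun z => Circle.exp (Complex.arg z)
  have htoCircle : ∀ z : ℂ, z * star z = 1 → (toCircle z : ℂ) = z := by
    intro z hz
    have h1 : ‖z‖ = 1 := by
      have h2 := congrArg norm hz
      rw [norm_mul, norm_star, norm_one] at h2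
      nlinarith [norm_nonneg z]
    have h3 := Complex.norm_mul_exp_arg_mul_I z
    rw [h1] at h3
    simpa [toCircle] using h3
  let c : M → M → M → Circle := fun p q x => toCircle (ratio (flat (Ψ p x)) (flat (Ψ q x)))
  have hc : ∀ p q, ∀ x ∈ V p ∩ V q, ∀ I, flat (Ψ p x) I = c p q x * flat (Ψ q x) I :=
    fun p q x hx I => by
      rw [(hr p q x hx).2 I]
      simp only [c]
      rw [htoCircle _ (hr p q x hx).1]
  have hcancel : ∀ p, ∀ x ∈ V p, ∀ u v : Circle,
      (∀ I, (u : ℂ) * flat (Ψ p x) I = v * flat (Ψ p x) I) → u = v := by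
    intro p x hx u v huv
    obtain ⟨I, hI⟩ := Function.ne_iff.1 (flat_ne_zero (hd p x hx))
    exact Circle.ext (mul_right_cancel₀ hI (huv I))
  obtain ⟨z, hz, hzc⟩ := exists_trivialization_of_cocycle hV hpV c
    (fun p q x hx => by
      have h1 := eventually_ratio_eq hs2 hT hdiv hne ((hV p).inter (hV q))
        ((hΨ p).mono Set.inter_subset_left) ((hΨ q).mono Set.inter_subset_right)
        (fun y hy => h p y hy.1) (fun y hy => h q y hy.2) hx
      exact h1.mono fun y hy => by simp only [c, hy])
    (fun p x hx => hcancel p x hx _ _ fun I => by rw [← hc p p x ⟨hx, hx⟩ I]; simp)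
    (fun p q r x hx => hcancel r x hx.2 _ _ fun I => by
      rw [← hc p r x ⟨hx.1.1, hx.2⟩ I, hc p q x hx.1 I, hc q r x ⟨hx.1.2, hx.2⟩ I, Circle.coe_mul]
      ring)
  -- The corrected fields agree on overlaps, so the diagonal choice p = x is, near any point of V p,
  -- a constant multiple of Ψ p, from which it inherits smoothness and the field equation.
  have hglue : ∀ p, ∀ x ∈ V p, (z x x : ℂ) • Ψ x x = (z p x : ℂ) • Ψ p x := by
    intro p x hx
    ext A B C
    have h1 := hc p x x ⟨hx, hpV x⟩ (A, B, C)
    simp only [flat] at h1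
    rw [hzc p x x ⟨hx, hpV x⟩]
    simp only [Pi.smul_apply, smul_eq_mul, h1, Circle.coe_mul]
    ring
  have hev : ∀ p, ∀ x ∈ V p, ∀ᶠ y in 𝓝 x, (z y y : ℂ) • Ψ y y = (z p x : ℂ) • Ψ p y := by
    intro p x hx
    filter_upwards [hz p x hx, (hV p).mem_nhds hx] with y hy hyV
    rw [hglue p y hyV, hy]
  have hsmooth : ∀ p, ContMDiffAt (𝓡 4) 𝓘(ℝ, Spinor3) ∞ (Ψ p) p := fun p =>
    (hΨ p).contMDiffAt ((hV p).mem_nhds (hpV p))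
  refine ⟨s, hs, fun x => (z x x : ℂ) • Ψ x x, fun x _ => ?_, fun x _ => ⟨?_, fun a b d => ?_, ?_⟩⟩
  · refine ContMDiffAt.contMDiffWithinAt (ContMDiffAt.congr_of_eventuallyEq ?_ (hev x x (hpV x)))
    have h1 : ContDiff ℝ ∞ fun Φ : Spinor3 => (z x x : ℂ) • Φ := contDiff_const_smul _
    exact h1.contMDiff.contMDiffAt.comp x (hsmooth x)
  · exact (h x x (hpV x)).1.smul _
  · rw [superenergy_smul (Circle.norm_coe _)]
    exact (h x x (hpV x)).2.1 a b d
  · exact masslessAt_const_smul ((hsmooth x).mdifferentiableAt (by simp)) (h x x (hpV x)).2.2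
      (hev x x (hpV x))

end SpinFrame

end Rainich

end

theorem mainTheorem3 {M : Type*} [TopologicalSpace M] [T2Space M] [SecondCountableTopology M]
    [ChartedSpace (EuclideanSpace ℝ (Fin 4)) M] [IsManifold (𝓡 4) ∞ M]
    (𝓔 : Rainich.SpinFrame M) (T : M → Rainich.Tensor3)
    (hT : ContMDiff (𝓡 4) 𝓘(ℝ, Rainich.Tensor3) ∞ T)
    (hsymm : ∀ x, Rainich.IsSymm3 (T x)) (htrace : ∀ x, Rainich.IsTraceFree (T x))
    (hdiv : 𝓔.IsDivergenceFree T) (hne : ∀ x, Rainich.quartic (T x) ≠ 0) :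
    ((∀ p : M, ∃ V : Set M, IsOpen V ∧ p ∈ V ∧ 𝓔.IsMasslessSuperenergyOn T V) ↔
      (∀ x, Rainich.QuadraticIdentity (T x)) ∧ 𝓔.SClosed T) ∧
    (SimplyConnectedSpace M →
      (𝓔.IsMasslessSuperenergyOn T Set.univ ↔
        (∀ x, Rainich.QuadraticIdentity (T x)) ∧ 𝓔.SClosed T)) := by
  have h1 : (∀ p : M, ∃ V : Set M, IsOpen V ∧ p ∈ V ∧ 𝓔.IsMasslessSuperenergyOn T V) ↔
      (∀ x, Rainich.QuadraticIdentity (T x)) ∧ 𝓔.SClosed T := by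
    constructor
    · intro h
      choose V hV hpV h using h
      have h2 := fun x => Rainich.SpinFrame.conditions_of_massless hT hdiv hne (hV x) (h x) (hpV x)
      exact ⟨fun x => (h2 x).1, fun x => (h2 x).2⟩
    · rintro ⟨hq, hS⟩ p
      exact Rainich.SpinFrame.massless_of_conditions hT hsymm htrace hdiv hne hq hS p
  refine ⟨h1, fun _ => Iff.trans ⟨fun h p => ?_, fun h => ?_⟩ h1⟩
  · exact ⟨Set.univ, isOpen_univ, Set.mem_univ p, h⟩
  · exact Rainich.SpinFrame.global_of_local hT hdiv hne h
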